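/- Let $\mathcal O=\mathbb C[[z]]$, $\mathcal K=\mathbb C((z))$, let $G$ be a connected reductive algebraic group over $\mathbb C$, and let $N$ be a finite-dimensional rational representation of $G$. Write $N_{\mathcal O}=N\otimes\mathcal O$, $N_{\mathcal K}=N\otimes\mathcal K$, and let $G_{\mathcal K}$ be the group $G$ over $\mathcal K$. Let $\mathrm{Gr}=G(\mathcal K)/G(\mathcal O)$ be the affine Grassmannian with its (reduced) ind-variety structure: for a closed embedding $G\hookrightarrow GL_r$, the point $[g]$ is identified with the lattice $g\mathcal O^r\subset\mathcal K^r$, the set of points with $z^k\mathcal O^r\subseteq g\mathcal O^r\subseteq z^{-k}\mathcal O^r$ and $\dim(g\mathcal O^r/z^k\mathcal O^r)=d$ is regarded, through the Plücker embedding, as a subset of the Grassmannian of $d$-dimensional subspaces of $z^{-k}\mathcal O^r/z^k\mathcal O^r$ with the induced Zariski topology, and a subset of $\mathrm{Gr}$ is closed if and only if its intersection with each of these pieces is closed in the piece. Let $\mathrm{Gr}(\sigma)$, $\sigma\in\pi_1(G)$, be the connected components of $\mathrm{Gr}$. For $c\in N_{\mathcal K}$ let $$\mathrm{Sp}_c=\{[g]\in\mathrm{Gr}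 : c\in gN_{\mathcal O}\},\qquad \mathrm{Sp}_c(\sigma)=\mathrm{Sp}_c\cap\mathrm{Gr}(\sigma).$$ For a character $\chi$ of the algebraic group $G_{\mathcal K}$, call $c\in N_{\mathcal K}$ $\chi$-stable if there are $n\in\mathbb N$ and a polynomial function $f\in\mathcal K[N]$ with $f(gv)=\chi(g)^nf(v)$ for all $g,v$ such that $f(c)\neq0$ and the orbit $G_{\mathcal K}c$ is Zariski closed in $\{f\ne0\}$, and if the stabilizer of $c$ in $G_{\mathcal K}$ is finite; here the varieties over $\mathcal K$, the orbit and the stabilizer are understood through their points over an algebraic closure of $\mathcal K$. **Theorem.** Let $c\in N_{\mathcal K}$ be $\chi$-stable for some character $\chi$ of $G_{\mathcal K}$, and suppose that $G(\mathcal K)$ acts freely on $c$, i.e. the stabilizer of $c$ in $G(\mathcal K)$ is trivial. Then for each $\sigma\in\pi_1(G)$, $\mathrm{Sp}_c(\sigma)$ is a finite-dimensional projective variety: for every closed embedding $G\hookrightarrow GL_r$ as above, there are $k,d$ such that $\mathrm{Sp}_c(\sigma)$ lies in the piece of $\mathrm{Gr}$ given by $k,d$, and the Plücker embedding of this piece maps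 $\mathrm{Sp}_c(\sigma)$ bijectively onto a Zariski closed subset of a finite-dimensional projective space over $\mathbb C$. (A variety may be reducible or empty.) -/

import Mathlib

open scoped TensorProduct LinearAlgebra.Projectivization

noncomputable section

namespace BFN

/-! ### Affine algebraic groups over `ℂ` and their points

An affine algebraic group `G` over `ℂ` is given by its coordinate ring `A = ℂ[G]`, a finitely
generated commutative Hopf algebra over `ℂ`. The group is connected (equivalently, irreducible)
precisely when `A` is an integral domain. -/

/-- The group `G(R)` of `R`-points of the affine group with coordinate ring `A`: the algebra
homomorphisms `A → R` with the convolution product `(g h)(a) = ∑ g(a₁) h(a₂)`. -/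
def Points (A R : Type*) [CommRing A] [Algebra ℂ A] [CommRing R] [Algebra ℂ R] :=
  WithConv (A →ₐ[ℂ] R)

namespace Points

variable {A : Type*} [CommRing A] [HopfAlgebra ℂ A]
variable {R S : Type*} [CommRing R] [Algebra ℂ R] [CommRing S] [Algebra ℂ S]

/-- A point as an evaluation homomorphism on functions. -/
def eval (g : Points A R) : A →ₐ[ℂ] R := WithConv.ofConv g

theorem eval_injective : Function.Injective (eval : Points A R → A →ₐ[ℂ] R) :=
  WithConv.ofConv_injective

instance : Monoid (Points A R) := inferInstanceAs (Monoid (WithConv (A →ₐ[ℂ] R)))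

instance : Inv (Points A R) where
  inv g := WithConv.toConv (g.eval.comp (HopfAlgebra.antipodeAlgHom ℂ A))

theorem one_eval (a : A) : (1 : Points A R).eval a = algebraMap ℂ R (Coalgebra.counit (R := ℂ) a) :=
  rfl

theorem mul_eval (g h : Points A R) (a : A) :
    (g * h).eval a =
      Algebra.TensorProduct.lift g.eval h.eval (fun _ _ => .all _ _)
        (Coalgebra.comul (R := ℂ) a) :=
  AlgHom.convMul_apply _ _ a

theorem inv_eval (g : Points A R) (a : A) : (g⁻¹).eval a = g.eval (HopfAlgebra.antipode ℂ a) :=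
  rfl

instance : Group (Points A R) where
  inv_mul_cancel g := by
    apply eval_injective
    ext a
    rw [mul_eval, one_eval, ← AlgHom.commutes g.eval,
      ← HopfAlgebra.mul_antipode_rTensor_comul_apply (R := ℂ) a]
    generalize (Coalgebra.comul (R := ℂ) a : A ⊗[ℂ] A) = t
    induction t with
    | zero => simp
    | tmul x y => simp [inv_eval]
    | add x y hx hy => simp only [map_add, hx, hy]

/-- Functoriality of points: a homomorphism `φ : R → S` induces `G(R) → G(S)`. -/
def map (φ : R →ₐ[ℂ] S) : Points A R →* Points A S where
  toFun g := WithConv.toConv (φ.comp g.eval)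
  map_one' := by
    apply eval_injective
    ext a
    exact φ.commutes _
  map_mul' g h := by
    apply eval_injective
    ext a
    refine Eq.trans (congrArg φ (mul_eval g h a)) (Eq.trans ?_ (AlgHom.convMul_apply _ _ a).symm)
    generalize (Coalgebra.comul (R := ℂ) a : A ⊗[ℂ] A) = t
    induction t with
    | zero => simp
    | tmul x y => simp [eval]
    | add x y hx hy => simp only [map_add, hx, hy]

end Points

/-- A rational representation of `G` on `ℂⁿ`, i.e. a homomorphism of algebraic groups
`G → GL_n`, given by its matrix coefficients. -/
structure Rep (A : Type*) [CommRing A] [HopfAlgebra ℂ A] (n : ℕ) where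
  /-- the matrix coefficients -/
  coeff : Matrix (Fin n) (Fin n) A
  comul_coeff : ∀ i j, Coalgebra.comul (R := ℂ) (coeff i j) =
    ∑ k, coeff i k ⊗ₜ[ℂ] coeff k j
  counit_coeff : ∀ i j, Coalgebra.counit (R := ℂ) (coeff i j) = (1 : Matrix (Fin n) (Fin n) ℂ) i j

namespace Rep

variable {A : Type*} [CommRing A] [HopfAlgebra ℂ A] {n : ℕ}
variable {R : Type*} [CommRing R] [Algebra ℂ R]

/-- The matrix by which `g ∈ G(R)` acts on `Rⁿ = ℂⁿ ⊗ R`. -/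
def mat (ρ : Rep A n) (g : Points A R) : Matrix (Fin n) (Fin n) R := ρ.coeff.map g.eval

theorem mat_one (ρ : Rep A n) : ρ.mat (1 : Points A R) = 1 := by
  ext i j
  simp only [mat, Matrix.map_apply, Points.one_eval, ρ.counit_coeff, Matrix.one_apply]
  split_ifs <;> simp

theorem mat_mul (ρ : Rep A n) (g h : Points A R) : ρ.mat (g * h) = ρ.mat g * ρ.mat h := by
  ext i j
  simp [mat, Matrix.map_apply, Points.mul_eval, ρ.comul_coeff, Matrix.mul_apply]

/-- `ρ : G → GL_n` is a closed embedding: the coordinate functions of `GL_n`, which are generated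
by the entries of a matrix and of its inverse, restrict to generators of `ℂ[G]`. -/
def IsClosedEmbedding (ρ : Rep A n) : Prop :=
  Algebra.adjoin ℂ (Set.range (fun p : Fin n × Fin n => ρ.coeff p.1 p.2) ∪
    Set.range (fun p : Fin n × Fin n => HopfAlgebra.antipode ℂ (ρ.coeff p.1 p.2))) = ⊤

/-- A subspace of `ℂⁿ` is stable under `G`. -/
def IsStableSubspace (ρ : Rep A n) (W : Submodule ℂ (Fin n → ℂ)) : Prop :=
  ∀ g : Points A ℂ, ∀ w ∈ W, (ρ.mat g).mulVec w ∈ W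

end Rep

/-- `G` is reductive: every finite-dimensional rational representation of `G` is completely
reducible (for groups over `ℂ` this is one of the standard definitions; it is equivalent to the
triviality of the unipotent radical). -/
def IsReductive (A : Type*) [CommRing A] [HopfAlgebra ℂ A] : Prop :=
  ∀ (n : ℕ) (ρ : Rep A n) (W : Submodule ℂ (Fin n → ℂ)), ρ.IsStableSubspace W →
    ∃ W' : Submodule ℂ (Fin n → ℂ), ρ.IsStableSubspace W' ∧ IsCompl W W'

/-! ### Stability over `𝒦 = ℂ((z))` -/

/-- `𝒪 = ℂ[[z]]`. -/
abbrev OO : Type := PowerSeries ℂ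

/-- `𝒦 = ℂ((z))`, the field of Laurent series. (A type of its own, so that it carries exactly one
`ℂ`-algebra structure, the coefficientwise one.) -/
def KK : Type := LaurentSeries ℂ

instance : Field KK := inferInstanceAs (Field (LaurentSeries ℂ))

instance : Algebra ℂ KK := (HahnSeries.instAlgebra : Algebra ℂ (HahnSeries ℤ ℂ))

/-- The coefficient of `z ^ j` in a Laurent series. -/
def coeffK (j : ℤ) : KK →ₗ[ℂ] ℂ where
  toFun x := HahnSeries.coeff (x : LaurentSeries ℂ) j
  map_add' _ _ := rfl
  map_smul' _ _ := rfl

/-- The inclusion `𝒪 → 𝒦`. -/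
def incl : OO →ₐ[ℂ] KK := HahnSeries.ofPowerSeriesAlg ℤ ℂ

theorem coeffK_incl (f : OO) (n : ℕ) : coeffK n (incl f) = PowerSeries.coeff n f :=
  HahnSeries.ofPowerSeries_apply_coeff (Γ := ℤ) f n

theorem coeffK_incl_neg (f : OO) {j : ℤ} (hj : j < 0) : coeffK j (incl f) = 0 := by
  change HahnSeries.coeff (HahnSeries.ofPowerSeries ℤ ℂ f) j = 0
  rw [HahnSeries.ofPowerSeries_apply]
  apply HahnSeries.embDomain_of_notMem_range
  rintro ⟨n, hn⟩
  have : (n : ℤ) = j := hn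
  omega

theorem coeffK_ext {x y : KK} (h : ∀ j, coeffK j x = coeffK j y) : x = y :=
  HahnSeries.ext (funext h)

/-- An algebraic closure of `𝒦`. Varieties over `𝒦` are described through their points in it. -/
abbrev KKbar : Type := AlgebraicClosure KK

section Stability

variable {A : Type*} [CommRing A] [HopfAlgebra ℂ A]

/-- A function on the variety `G_𝒦`, i.e. an element of `𝒦[G] = 𝒦 ⊗ ℂ[G]`, evaluated at a
geometric point. -/
def evalBar (χ : KK ⊗[ℂ] A) (g : Points A KKbar) : KKbar :=
  Algebra.TensorProduct.lift (Algebra.ofId KK KKbar) g.eval (fun _ _ => .all _ _) χ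

/-- `c ∈ N_𝒦`, as a geometric point of the variety `N_𝒦`. -/
def toBar {m : ℕ} (c : Fin m → KK) : Fin m → KKbar := fun i => algebraMap KK KKbar (c i)

/-- `f ∈ 𝒦[N]` is `n χ`-semi-invariant: `f (g v) = χ(g)ⁿ f(v)`. -/
def IsSemiInvariant {m : ℕ} (ν : Rep A m) (χ : KK ⊗[ℂ] A) (n : ℕ)
    (f : MvPolynomial (Fin m) KK) : Prop :=
  ∀ (g : Points A KKbar) (v : Fin m → KKbar),
    MvPolynomial.aeval ((ν.mat g).mulVec v) f = evalBar χ g ^ n * MvPolynomial.aeval v f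

/-- The orbit of `c` under `G_𝒦` (as a subset of the set of geometric points of `N_𝒦`). -/
def orbitBar {m : ℕ} (ν : Rep A m) (c : Fin m → KK) : Set (Fin m → KKbar) :=
  Set.range fun g : Points A KKbar => (ν.mat g).mulVec (toBar c)

/-- The orbit of `c` is Zariski closed in the open subset `{f ≠ 0}` of `N_𝒦`. -/
def OrbitClosedIn {m : ℕ} (ν : Rep A m) (f : MvPolynomial (Fin m) KK) (c : Fin m → KK) : Prop :=
  ∃ I : Ideal (MvPolynomial (Fin m) KKbar), ∀ v : Fin m → KKbar, MvPolynomial.aeval v f ≠ 0 →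
    (v ∈ orbitBar ν c ↔ v ∈ MvPolynomial.zeroLocus KKbar I)

/-- `c ∈ N_𝒦` is `χ`-polystable: some `n χ`-semi-invariant `f ∈ 𝒦[N]` does not vanish at `c`, and the
orbit of `c` is closed in `{f ≠ 0}`. Here `χ` is a character of `G_𝒦`, i.e. a group-like element of
`𝒦[G]`. -/
def IsPolystable {m : ℕ} (ν : Rep A m) (χ : KK ⊗[ℂ] A) (c : Fin m → KK) : Prop :=
  ∃ (n : ℕ) (f : MvPolynomial (Fin m) KK), IsSemiInvariant ν χ n f ∧
    MvPolynomial.aeval c f ≠ 0 ∧ OrbitClosedIn ν f c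

/-- `c ∈ N_𝒦` is `χ`-stable: it is `χ`-polystable and its stabilizer in the algebraic group `G_𝒦`
is finite. -/
def IsStable {m : ℕ} (ν : Rep A m) (χ : KK ⊗[ℂ] A) (c : Fin m → KK) : Prop :=
  IsPolystable ν χ c ∧
    {g : Points A KKbar | (ν.mat g).mulVec (toBar c) = toBar c}.Finite

/-- The group `G(𝒦)` acts freely on `c`: the stabilizer of `c` is trivial. -/
def ActsFreelyOn {m : ℕ} (ν : Rep A m) (c : Fin m → KK) : Prop :=
  ∀ g : Points A KK, (ν.mat g).mulVec c = c → g = 1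

end Stability

/-! ### The affine Grassmannian and the Springer fibre -/

/-- `zᵏ 𝒪ⁿ`, the vectors in `𝒦ⁿ` all of whose coefficients in degrees `< k` vanish. -/
def stdLattice (n : ℕ) (k : ℤ) : Submodule ℂ (Fin n → KK) where
  carrier := {v | ∀ i, ∀ j : ℤ, j < k → coeffK j (v i) = 0}
  zero_mem' := fun i j _ => by simp
  add_mem' := fun {a b} ha hb i j hj => by simp [ha i j hj, hb i j hj]
  smul_mem' := fun t a ha i j hj => by
    rw [Pi.smul_apply, map_smul, ha i j hj, smul_zero]

section Grassmannian

variable {A : Type*} [CommRing A] [HopfAlgebra ℂ A]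

variable (A) in
/-- `G(𝒪)` as a subgroup of `G(𝒦)`. -/
def arcGroup : Subgroup (Points A KK) := (Points.map (A := A) incl).range

variable (A) in
/-- The affine Grassmannian `Gr = G(𝒦) / G(𝒪)`. -/
abbrev Gr := Points A KK ⧸ arcGroup A

/-- The Springer fibre `Sp_c = {[g] ∈ Gr : c ∈ g N_𝒪}`. -/
def springerFibre {m : ℕ} (ν : Rep A m) (c : Fin m → KK) : Set (Gr A) :=
  {x | ∃ g : Points A KK, (g : Gr A) = x ∧ ∃ w ∈ stdLattice m 0, (ν.mat g).mulVec w = c}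

end Grassmannian

/-! ### The Zariski topology on projective space and Plücker vectors -/

/-- The Zariski topology on the projective space of `ℂ^ι`: the sets `{p ≠ 0}`, for `p` a
homogeneous polynomial, form a basis. -/
@[reducible]
def zariski (ι : Type*) : TopologicalSpace (ℙ ℂ (ι → ℂ)) :=
  TopologicalSpace.generateFrom
    {U | ∃ (n : ℕ) (p : MvPolynomial ι ℂ), p.IsHomogeneous n ∧
      U = {x | MvPolynomial.eval x.rep p ≠ 0}}

section Plucker

variable {ι : Type*} [Fintype ι]

/-- The Plücker coordinates (the maximal minors) of a `d`-tuple of vectors in `ℂ^ι`, indexed by all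
sequences of `d` columns. -/
def minors {d : ℕ} (b : Fin d → ι → ℂ) : (Fin d → ι) → ℂ :=
  fun I => Matrix.det (Matrix.of fun s t => b s (I t))

theorem minors_ne_zero {d : ℕ} {b : Fin d → ι → ℂ} (hb : LinearIndependent ℂ b) :
    minors b ≠ 0 := by
  set M : Matrix (Fin d) ι ℂ := Matrix.of b with hM
  have hrank : M.rank = d := by
    have h := LinearIndependent.rank_matrix (M := M) hb
    simpa using h
  obtain ⟨κ, a, ha, hspan, hli⟩ := exists_linearIndependent' ℂ M.col
  have : Finite κ := Finite.of_injective a ha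
  have : Fintype κ := Fintype.ofFinite κ
  have hcard : Fintype.card κ = d := by
    rw [← finrank_span_eq_card hli, hspan, ← Matrix.rank_eq_finrank_span_cols, hrank]
  let e : Fin d ≃ κ := (Fintype.equivFinOfCardEq hcard).symm
  intro h0
  have hdet : (M.submatrix id (a ∘ e)).det = 0 := congrFun h0 (a ∘ e)
  have hli' : LinearIndependent ℂ (M.submatrix id (a ∘ e)).col :=
    hli.comp e e.injective
  have hu := Matrix.linearIndependent_cols_iff_isUnit.mp hli'
  rw [Matrix.isUnit_iff_isUnit_det, hdet] at hu
  exact not_isUnit_zero hu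

/-- The point of projective space given by the Plücker coordinates of a `d`-dimensional subspace of
`ℂ^ι` (they do not depend, up to a scalar, on the basis of the subspace). -/
def pluckerPoint {d : ℕ} (W : Submodule ℂ (ι → ℂ)) (hW : Module.finrank ℂ W = d) :
    ℙ ℂ ((Fin d → ι) → ℂ) :=
  Projectivization.mk ℂ
    (minors fun s => ((Module.finBasisOfFinrankEq ℂ W hW s : W) : ι → ℂ))
    (minors_ne_zero (LinearIndependent.map'
      (Module.finBasisOfFinrankEq ℂ W hW).linearIndependent W.subtype W.ker_subtype))

end Plucker

/-! ### The ind-variety structure of the affine Grassmannian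

A closed embedding `ρ : G → GL_r` identifies the point `[g]` of `Gr` with the lattice
`g 𝒪^r ⊆ 𝒦^r`. The lattices between `zᵏ 𝒪^r` and `z⁻ᵏ 𝒪^r` are subspaces of the
finite-dimensional space `z⁻ᵏ 𝒪^r / zᵏ 𝒪^r`, hence points of ordinary Grassmannians; these are
embedded into projective spaces by Plücker coordinates. -/

section IndVariety

variable {A : Type*} [CommRing A] [HopfAlgebra ℂ A] {r : ℕ}

/-- The lattice `g 𝒪^r`. -/
def latticeOf (ρ : Rep A r) (g : Points A KK) : Submodule ℂ (Fin r → KK) :=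
  (stdLattice r 0).map ((ρ.mat g).mulVecLin.restrictScalars ℂ)

theorem mem_stdLattice_iff {v : Fin r → KK} :
    v ∈ stdLattice r 0 ↔ ∃ w : Fin r → OO, v = fun i => incl (w i) := by
  constructor
  · intro hv
    refine ⟨fun i => PowerSeries.mk fun n => coeffK n (v i), funext fun i => coeffK_ext fun j => ?_⟩
    rcases lt_or_ge j 0 with hj | hj
    · rw [hv i j hj, coeffK_incl_neg _ hj]
    · lift j to ℕ using hj
      rw [coeffK_incl, PowerSeries.coeff_mk]
  · rintro ⟨w, rfl⟩ i j hj
    exact coeffK_incl_neg _ hj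

theorem mulVec_mem_stdLattice (ρ : Rep A r) {h : Points A KK} (hh : h ∈ arcGroup A)
    {v : Fin r → KK} (hv : v ∈ stdLattice r 0) : (ρ.mat h).mulVec v ∈ stdLattice r 0 := by
  obtain ⟨h', rfl⟩ := hh
  obtain ⟨w, rfl⟩ := mem_stdLattice_iff.mp hv
  refine mem_stdLattice_iff.mpr ⟨(ρ.mat h').mulVec w, funext fun i => ?_⟩
  simp only [Matrix.mulVec, dotProduct, map_sum, map_mul]
  rfl

theorem latticeOf_mul_arc (ρ : Rep A r) (g h : Points A KK) (hh : h ∈ arcGroup A) :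
    latticeOf ρ (g * h) = latticeOf ρ g := by
  ext v
  simp only [latticeOf, Submodule.mem_map, LinearMap.restrictScalars_apply,
    Matrix.mulVecLin_apply]
  constructor
  · rintro ⟨w, hw, rfl⟩
    exact ⟨_, mulVec_mem_stdLattice ρ hh hw, by rw [Matrix.mulVec_mulVec, ρ.mat_mul]⟩
  · rintro ⟨w, hw, rfl⟩
    refine ⟨_, mulVec_mem_stdLattice ρ (inv_mem hh) hw, ?_⟩
    rw [Matrix.mulVec_mulVec, ← ρ.mat_mul, mul_inv_cancel_right]

/-- The lattice `g 𝒪^r` attached to the point `[g]` of the affine Grassmannian. -/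
def lattice (ρ : Rep A r) (x : Gr A) : Submodule ℂ (Fin r → KK) :=
  Quotient.liftOn' x (latticeOf ρ) fun g g' hgg' => by
    have h := latticeOf_mul_arc ρ g (g⁻¹ * g') (QuotientGroup.leftRel_apply.mp hgg')
    rw [mul_inv_cancel_left] at h
    exact h.symm

/-- The coefficients of a vector in `𝒦^r` in degrees `-k, …, k - 1`; on `z⁻ᵏ 𝒪^r` this is the
quotient map to `z⁻ᵏ 𝒪^r / zᵏ 𝒪^r`. -/
def window (r k : ℕ) : (Fin r → KK) →ₗ[ℂ] (Fin r × Fin (2 * k) → ℂ) where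
  toFun v p := coeffK ((p.2 : ℤ) - k) (v p.1)
  map_add' v w := by ext p; simp
  map_smul' t v := by ext p; simp

/-- The points `[g]` of the affine Grassmannian with `zᵏ 𝒪^r ⊆ g 𝒪^r ⊆ z⁻ᵏ 𝒪^r` and
`dim (g 𝒪^r / zᵏ 𝒪^r) = d`. -/
def piece (ρ : Rep A r) (k d : ℕ) : Set (Gr A) :=
  {x | stdLattice r k ≤ lattice ρ x ∧ lattice ρ x ≤ stdLattice r (-k) ∧
    Module.finrank ℂ ((lattice ρ x).map (window r k)) = d}

/-- The Plücker embedding of a piece of the affine Grassmannian. -/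
def plucker (ρ : Rep A r) (k d : ℕ) (x : piece ρ k d) :
    ℙ ℂ ((Fin d → Fin r × Fin (2 * k)) → ℂ) :=
  pluckerPoint ((lattice ρ x.1).map (window r k)) x.2.2.2

/-- The ind-Zariski topology of the affine Grassmannian: a subset is closed if and only if its
intersection with each piece is closed in the topology of the piece, which is induced by the
Zariski topology of projective space. -/
@[reducible]
def grTopology (ρ : Rep A r) : TopologicalSpace (Gr A) :=
  ⨆ (k : ℕ) (d : ℕ), TopologicalSpace.coinduced (Subtype.val : piece ρ k d → Gr A)
    (TopologicalSpace.induced (plucker ρ k d) (zariski _))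

/-- The connected component of the affine Grassmannian that contains the point `x`. -/
def component (ρ : Rep A r) (x : Gr A) : Set (Gr A) :=
  @connectedComponent (Gr A) (grTopology ρ) x

/-- A set of points of the affine Grassmannian is a finite-dimensional projective variety: it lies
in one of the pieces, and the Plücker embedding of this piece identifies it with a
Zariski closed subset of a finite-dimensional projective space over `ℂ`. -/
def IsProjectiveVariety (ρ : Rep A r) (S : Set (Gr A)) : Prop :=
  ∃ k d : ℕ, S ⊆ piece ρ k d ∧
    Set.InjOn (plucker ρ k d) (Subtype.val ⁻¹' S) ∧
    @IsClosed _ (zariski (Fin d → Fin r × Fin (2 * k))) (plucker ρ k d '' (Subtype.val ⁻¹' S))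

end IndVariety

end BFN

end

noncomputable section

namespace BFN

/-! ### Closed points of finitely generated algebras -/

/-! Two facts carry the theorem: the Springer fibre is closed in every piece of Gr, and its part in
one connected component lies in one piece. Since components are closed and the Plücker map is
injective on a piece, this gives a closed set in projective space.

Closedness. A lattice in a piece is `M 𝒪^r` for an invertible matrix `M` over `𝒦`. As `G ⊆ GL(V)` is
reductive, it is the stabilizer of its invariant tensors in the powers of `V ⊕ V* ⊕ ℂ`
(`exists_point_of_fixes`). The lattice comes from `G(𝒦)` exactly when `N = M⁻¹` takes all invariant
tensors to integral ones; the hard direction is `exists_factorization`. There, complete reducibility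
gives a complex matrix `h₀` with the same effect on invariant tensors as `N` modulo `z`
(`exists_reduction`). The logarithmic derivative of `N` is replaced by an integral matrix `ξ` with
the same action on the tensors `N t`, which is possible because the rank of the linear system
defining `ξ` does not drop at `z = 0` (`exists_integral_solution`). The solution of `h' = ξ h`,
`h(0) = h₀`, agrees with `N` on invariant tensors, so `h⁻¹ N` lies in `G(𝒦)`. The representation on
which `c` lives embeds in tensor powers (`exists_tensor_embedding`), so `c ∈ g N_𝒪` is also
integrality of certain tensors on the lattice. Integrality can be tested on generators of the
lattice and its dual, which depend polynomially on the Plücker coordinates in a chart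
(`exists_springer_equations`).

Boundedness. For stable `c`, the map `g ↦ (g⁻¹ c, χ(g)ⁿ)` has closed image and finite fibres, and it
is equivariant for the transitive right translations of `G`. Such a map is finite
(`isIntegral_of_homogeneous`), so the entries of `g` and `g⁻¹` satisfy monic equations over the
polynomials in `g⁻¹ c` and `χ(g)ⁿ` (`exists_monic_relation`). On the Springer fibre `g⁻¹ c` is
integral. The function `χⁿ` comes from a complex character; the condition that its pole has order at
most `e`, and the negation, both define Springer fibres of one-dimensional representations, so by
the closedness already shown the bound holds on entire components (`exists_val_character`). Hence
the poles of `g` and `g⁻¹` are uniformly bounded, which fixes `k`; and `d` is then fixed because `d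
- k r` is locally constant. -/

theorem exists_algHom_to_field (k A : Type*) [Field k] [IsAlgClosed k] [CommRing A] [Algebra k A]
    [Algebra.FiniteType k A] [Nontrivial A] : Nonempty (A →ₐ[k] k) := by
  obtain ⟨m, hm⟩ := Ideal.exists_maximal A
  let _ : Field (A ⧸ m) := Ideal.Quotient.field m
  have : Module.Finite k (A ⧸ m) := finite_of_finite_type_of_isJacobsonRing k (A ⧸ m)
  have hb := IsAlgClosed.algebraMap_bijective_of_isIntegral (k := k) (K := A ⧸ m)
  exact ⟨((AlgEquiv.ofBijective (Algebra.ofId k (A ⧸ m)) hb).symm : (A ⧸ m) →ₐ[k] k).comp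
    (Ideal.Quotient.mkₐ k m)⟩

/-- Rabinowitsch's trick: the localization at a non-nilpotent element is a nonzero finitely
generated algebra, so it has a point. -/
theorem exists_algHom_ne_zero {k A : Type*} [Field k] [IsAlgClosed k] [CommRing A] [Algebra k A]
    [Algebra.FiniteType k A] [IsReduced A] {a : A} (ha : a ≠ 0) : ∃ f : A →ₐ[k] k, f a ≠ 0 := by
  have hn : ¬ IsNilpotent a := fun h => ha h.eq_zero
  have : Nontrivial (Localization.Away a) := by
    rw [← not_subsingleton_iff_nontrivial]
    intro hs
    have h0 : algebraMap A (Localization.Away a) 1 = 0 := Subsingleton.elim _ _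
    obtain ⟨⟨_, n, rfl⟩, hc⟩ := (IsLocalization.map_eq_zero_iff (Submonoid.powers a) _ _).mp h0
    exact hn ⟨n, by simpa using hc⟩
  have : Algebra.FiniteType k (Localization.Away a) :=
    Algebra.FiniteType.trans (S := A) ‹_›
      (IsLocalization.finiteType_of_monoid_fg (Submonoid.powers a) (Localization.Away a))
  obtain ⟨f⟩ := exists_algHom_to_field k (Localization.Away a)
  refine ⟨f.comp (IsScalarTower.toAlgHom k A (Localization.Away a)), ?_⟩
  have hu : IsUnit (algebraMap A (Localization.Away a) a) :=
    IsLocalization.Away.algebraMap_isUnit a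
  exact (hu.map f).ne_zero

theorem eq_of_forall_algHom_eq {k A : Type*} [Field k] [IsAlgClosed k] [CommRing A] [Algebra k A]
    [Algebra.FiniteType k A] [IsReduced A] {a b : A} (h : ∀ f : A →ₐ[k] k, f a = f b) : a = b := by
  by_contra hab
  obtain ⟨f, hf⟩ := exists_algHom_ne_zero (k := k) (sub_ne_zero.mpr hab)
  exact hf (by rw [map_sub, h, sub_self])

theorem exists_algHom_of_ideal_ne_top {k A : Type*} [Field k] [IsAlgClosed k] [CommRing A]
    [Algebra k A] [Algebra.FiniteType k A] {I : Ideal A} (hI : I ≠ ⊤) :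
    ∃ f : A →ₐ[k] k, ∀ a ∈ I, f a = 0 := by
  have : Nontrivial (A ⧸ I) := Ideal.Quotient.nontrivial_iff.mpr hI
  obtain ⟨f⟩ := exists_algHom_to_field k (A ⧸ I)
  refine ⟨f.comp (Ideal.Quotient.mkₐ k I), fun a ha => ?_⟩
  simp [Ideal.Quotient.eq_zero_iff_mem.mpr ha]

theorem pow_mem_of_forall_algHom {k A : Type*} [Field k] [IsAlgClosed k] [CommRing A]
    [Algebra k A] [Algebra.FiniteType k A] {I : Ideal A} {a : A}
    (h : ∀ f : A →ₐ[k] k, (∀ b ∈ I, f b = 0) → f a = 0) : ∃ n, a ^ n ∈ I := by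
  have hr : a ∈ I.radical := by
    rw [← Ideal.Quotient.eq_zero_iff_mem]
    have : IsReduced (A ⧸ I.radical) :=
      (Ideal.isRadical_iff_quotient_reduced _).mp (Ideal.radical_isRadical I)
    refine eq_of_forall_algHom_eq (k := k) fun f => ?_
    rw [map_zero]
    exact h (f.comp (Ideal.Quotient.mkₐ k I.radical)) fun b hb => by
      simp [Ideal.Quotient.eq_zero_iff_mem.mpr (Ideal.le_radical hb)]
  exact hr

/-! ### Representations on coordinate spaces with an arbitrary finite index set -/

section Rep

variable {A : Type*} [CommRing A] [HopfAlgebra ℂ A]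
variable {R S : Type*} [CommRing R] [Algebra ℂ R] [CommRing S] [Algebra ℂ S]

theorem Points.ext {g h : Points A R} (H : ∀ a, g.eval a = h.eval a) : g = h :=
  Points.eval_injective (AlgHom.ext H)

/-- The point of `G` with a given evaluation homomorphism. -/
def Points.ofHom (f : A →ₐ[ℂ] R) : Points A R := WithConv.toConv f

@[simp] theorem Points.eval_ofHom (f : A →ₐ[ℂ] R) : (Points.ofHom f).eval = f := rfl

@[simp] theorem Points.map_eval (φ : R →ₐ[ℂ] S) (g : Points A R) (a : A) :
    (Points.map φ g).eval a = φ (g.eval a) := rfl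

/-- Being the matrix of coefficients of a representation. -/
structure IsRep {ι : Type*} [Fintype ι] [DecidableEq ι] (τ : Matrix ι ι A) : Prop where
  comul : ∀ i j, Coalgebra.comul (R := ℂ) (τ i j) = ∑ k, τ i k ⊗ₜ[ℂ] τ k j
  counit : ∀ i j, Coalgebra.counit (R := ℂ) (τ i j) = (1 : Matrix ι ι ℂ) i j

variable {ι : Type*}

/-- The matrix of a point. -/
def pmat (τ : Matrix ι ι A) (g : Points A R) : Matrix ι ι R := τ.map g.eval

theorem pmat_apply (τ : Matrix ι ι A) (g : Points A R) (i j : ι) :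
    pmat τ g i j = g.eval (τ i j) := rfl

variable [Fintype ι] [DecidableEq ι]

theorem IsRep.pmat_mul {τ : Matrix ι ι A} (h : IsRep τ) (g g' : Points A R) :
    pmat τ (g * g') = pmat τ g * pmat τ g' := by
  ext i j
  simp [pmat, Points.mul_eval, h.comul, Matrix.mul_apply]

theorem IsRep.pmat_one {τ : Matrix ι ι A} (h : IsRep τ) : pmat τ (1 : Points A R) = 1 := by
  ext i j
  simp only [pmat, Matrix.map_apply, Points.one_eval, h.counit, Matrix.one_apply]
  split_ifs <;> simp

/-- The first projection `G × G → G`, as a point of `G`. -/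
def fstPoint (A : Type*) [CommRing A] [HopfAlgebra ℂ A] : Points A (A ⊗[ℂ] A) :=
  Points.ofHom Algebra.TensorProduct.includeLeft

/-- The second projection `G × G → G`, as a point of `G`. -/
def sndPoint (A : Type*) [CommRing A] [HopfAlgebra ℂ A] : Points A (A ⊗[ℂ] A) :=
  Points.ofHom Algebra.TensorProduct.includeRight

theorem fst_mul_snd_eval (a : A) :
    (fstPoint A * sndPoint A).eval a = Coalgebra.comul (R := ℂ) a := by
  rw [Points.mul_eval]
  generalize (Coalgebra.comul (R := ℂ) a : A ⊗[ℂ] A) = t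
  induction t with
  | zero => simp
  | tmul x y => simp [fstPoint, sndPoint]
  | add x y hx hy => simp only [map_add, hx, hy]

/-- The two projections are the universal pair of points of `G`, and their product evaluates to the
comultiplication, so multiplicativity has to be checked on this pair only. -/
theorem IsRep.of_pmat {τ : Matrix ι ι A}
    (hmul : pmat τ (fstPoint A * sndPoint A) = pmat τ (fstPoint A) * pmat τ (sndPoint A))
    (hone : pmat τ (1 : Points A ℂ) = 1) : IsRep τ where
  comul i j := by
    have := congrFun (congrFun hmul i) j
    rw [pmat_apply, fst_mul_snd_eval] at this
    rw [this]
    simp [Matrix.mul_apply, pmat, fstPoint, sndPoint]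
  counit i j := by
    have := congrFun (congrFun hone i) j
    rwa [pmat_apply, Points.one_eval] at this

theorem IsRep.submatrix {κ : Type*} [Fintype κ] [DecidableEq κ] {τ : Matrix ι ι A} (h : IsRep τ)
    (e : κ ≃ ι) : IsRep (τ.submatrix e e) where
  comul i j := by
    simp only [Matrix.submatrix_apply, h.comul]
    exact (e.sum_comp fun k => τ (e i) k ⊗ₜ[ℂ] τ k (e j)).symm
  counit i j := by
    simp [h.counit, Matrix.one_apply]

/-- Complete reducibility in terms of an equivariant projection. -/
theorem IsReductive.exists_projection (hG : IsReductive A) {τ : Matrix ι ι A} (hτ : IsRep τ)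
    (W : Submodule ℂ (ι → ℂ))
    (hW : ∀ g : Points A ℂ, ∀ w ∈ W, (pmat τ g).mulVec w ∈ W) :
    ∃ e : (ι → ℂ) →ₗ[ℂ] (ι → ℂ), LinearMap.ker e = W ∧ (∀ u, u - e u ∈ W) ∧
      ∀ (g : Points A ℂ) u, e ((pmat τ g).mulVec u) = (pmat τ g).mulVec (e u) := by
  -- `IsReductive` speaks of representations indexed by `Fin n`, so the problem is transported there
  -- and the projection is transported back.
  let E : Fin (Fintype.card ι) ≃ ι := (Fintype.equivFin ι).symm
  have hτ' := hτ.submatrix E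
  let ρ : Rep A (Fintype.card ι) := ⟨_, hτ'.comul, hτ'.counit⟩
  let F : (ι → ℂ) ≃ₗ[ℂ] (Fin (Fintype.card ι) → ℂ) := LinearEquiv.funCongrLeft ℂ ℂ E
  have hF : ∀ (g : Points A ℂ) (u : ι → ℂ),
      F ((pmat τ g).mulVec u) = (ρ.mat g).mulVec (F u) := by
    intro g u
    ext i
    simp only [F, LinearEquiv.funCongrLeft_apply, LinearMap.funLeft_apply, Matrix.mulVec,
      dotProduct, Rep.mat, ρ, Matrix.map_apply, Matrix.submatrix_apply, pmat]
    exact (E.sum_comp fun k => g.eval (τ (E i) k) * u k).symm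
  have hWs : ρ.IsStableSubspace (W.map F.toLinearMap) := by
    rintro g _ ⟨w, hw, rfl⟩
    exact ⟨_, hW g w hw, hF g w⟩
  obtain ⟨W', hW', hc⟩ := hG _ ρ _ hWs
  let p := W'.projection (W.map F.toLinearMap) hc.symm
  have hp : ∀ u, p u ∈ W' := fun u => Submodule.projection_apply_mem hc.symm u
  have hker : LinearMap.ker p = W.map F.toLinearMap := Submodule.ker_projection hc.symm
  have hsub : ∀ u, u - p u ∈ W.map F.toLinearMap := by
    intro u
    rw [← hker, LinearMap.mem_ker, map_sub]
    have : p (p u) = p u := Submodule.projection_apply_of_mem_left hc.symm (hp u)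
    rw [this, sub_self]
  have hpg : ∀ (g : Points A ℂ) u, p ((ρ.mat g).mulVec u) = (ρ.mat g).mulVec (p u) := by
    intro g u
    have h1 : (ρ.mat g).mulVec u = (ρ.mat g).mulVec (u - p u) + (ρ.mat g).mulVec (p u) := by
      rw [← Matrix.mulVec_add, sub_add_cancel]
    have h2 : p ((ρ.mat g).mulVec (u - p u)) = 0 := by
      rw [← LinearMap.mem_ker, hker]
      exact hWs g _ (hsub u)
    rw [h1, map_add, h2, zero_add]
    exact Submodule.projection_apply_of_mem_left hc.symm (hW' g _ (hp u))
  refine ⟨F.symm.toLinearMap ∘ₗ p ∘ₗ F.toLinearMap, ?_, ?_, ?_⟩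
  · ext u
    simp only [LinearMap.mem_ker, LinearMap.comp_apply, LinearEquiv.coe_coe,
      LinearEquiv.map_eq_zero_iff]
    rw [← LinearMap.mem_ker, hker]
    constructor
    · rintro ⟨w, hw, hwu⟩
      rwa [← F.injective hwu]
    · exact fun hu => ⟨u, hu, rfl⟩
  · intro u
    obtain ⟨w, hw, hwu⟩ := hsub (F u)
    have : u - F.symm (p (F u)) = w := by
      apply F.injective
      rw [map_sub, F.apply_symm_apply]
      exact hwu.symm
    simpa [this] using hw
  · intro g u
    apply F.injective
    simp only [LinearMap.comp_apply, LinearEquiv.coe_coe, hF, hpg, F.apply_symm_apply]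

end Rep

/-! ### Tensor powers of matrices -/

section Tens

variable {R S : Type*} [CommRing R] [CommRing S]

/-- The tensor product of a family of matrices. -/
def tens {ι : Type*} {D : ℕ} (f : Fin D → Matrix ι ι R) : Matrix (Fin D → ι) (Fin D → ι) R :=
  Matrix.of fun I J => ∏ s, f s (I s) (J s)

/-- The `D`-th tensor power of a matrix. -/
def tpow {ι : Type*} (D : ℕ) (Z : Matrix ι ι R) : Matrix (Fin D → ι) (Fin D → ι) R :=
  tens fun _ => Z

theorem tens_apply {ι : Type*} {D : ℕ} (f : Fin D → Matrix ι ι R) (I J : Fin D → ι) :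
    tens f I J = ∏ s, f s (I s) (J s) := rfl

theorem tpow_apply {ι : Type*} (D : ℕ) (Z : Matrix ι ι R) (I J : Fin D → ι) :
    tpow D Z I J = ∏ s, Z (I s) (J s) := rfl

theorem tpow_map {ι : Type*} (D : ℕ) (Z : Matrix ι ι R) (φ : R →+* S) :
    (tpow D Z).map φ = tpow D (Z.map φ) := by
  ext I J
  simp [tpow_apply]

theorem tens_mul {ι : Type*} [Fintype ι] {D : ℕ} (f g : Fin D → Matrix ι ι R) :
    tens f * tens g = tens fun s => f s * g s := by
  ext I J
  simp only [Matrix.mul_apply, tens_apply, ← Finset.prod_mul_distrib]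
  rw [Finset.prod_univ_sum]
  simp

theorem tpow_one {ι : Type*} [DecidableEq ι] (D : ℕ) : tpow D (1 : Matrix ι ι R) = 1 := by
  ext I J
  rw [tpow_apply, Matrix.one_apply]
  split_ifs with h
  · exact Finset.prod_eq_one fun s _ => by rw [h]; exact Matrix.one_apply_eq _
  · obtain ⟨s, hs⟩ := Function.ne_iff.mp h
    exact Finset.prod_eq_zero (Finset.mem_univ s) (Matrix.one_apply_ne hs)

theorem tpow_mul {ι : Type*} [Fintype ι] (D : ℕ) (Z Z' : Matrix ι ι R) : tpow D (Z * Z') = tpow D Z * tpow D Z' :=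
  (tens_mul _ _).symm

end Tens

/-! ### The standard representation, its dual and the trivial one -/

/-- The index set of `V ⊕ V* ⊕ ℂ`, for `V = ℂ^r`. -/
abbrev Idx (r : ℕ) : Type := Fin r ⊕ (Fin r ⊕ Unit)

section Blk

variable {R S : Type*} [CommRing R] [CommRing S] {r : ℕ}

/-- The block diagonal matrix with blocks `X`, `Yᵀ` and `1`. -/
def blk (X Y : Matrix (Fin r) (Fin r) R) : Matrix (Idx r) (Idx r) R :=
  Matrix.fromBlocks X 0 0 (Matrix.fromBlocks Y.transpose 0 0 1)

theorem blk_mul (X Y X' Y' : Matrix (Fin r) (Fin r) R) :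
    blk X Y * blk X' Y' = blk (X * X') (Y' * Y) := by
  simp [blk, Matrix.fromBlocks_multiply, Matrix.transpose_mul]

theorem blk_one : blk (1 : Matrix (Fin r) (Fin r) R) 1 = 1 := by
  simp [blk]

theorem blk_map (X Y : Matrix (Fin r) (Fin r) R) (φ : R →+* S) :
    (blk X Y).map φ = blk (X.map φ) (Y.map φ) := by
  simp [blk, Matrix.fromBlocks_map, Matrix.transpose_map, Matrix.map_zero, Matrix.map_one]

theorem blk_mul_blk_inv {X Y : Matrix (Fin r) (Fin r) R} (h : X * Y = 1) :
    blk X Y * blk Y X = 1 := by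
  rw [blk_mul, h, blk_one]

end Blk

section Kap

variable {A : Type*} [CommRing A] [HopfAlgebra ℂ A] {r : ℕ}
variable {R S : Type*} [CommRing R] [Algebra ℂ R] [CommRing S] [Algebra ℂ S]

/-- The coefficients of the representation `V ⊕ V* ⊕ ℂ`. -/
def kap (ρ : Rep A r) : Matrix (Idx r) (Idx r) A :=
  blk ρ.coeff (ρ.coeff.map (HopfAlgebra.antipode ℂ))

theorem pmat_kap (ρ : Rep A r) (g : Points A R) : pmat (kap ρ) g = blk (ρ.mat g) (ρ.mat g⁻¹) :=
  blk_map _ _ (g.eval : A →+* R)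

theorem isRep_kap (ρ : Rep A r) : IsRep (kap ρ) := by
  apply IsRep.of_pmat
  · simp only [pmat_kap, blk_mul, ← ρ.mat_mul, mul_inv_rev]
  · rw [pmat_kap, inv_one, ρ.mat_one, blk_one]

theorem pmat_tpow {ι : Type*} (τ : Matrix ι ι A) (D : ℕ) (g : Points A R) :
    pmat (tpow D τ) g = tpow D (pmat τ g) := tpow_map D τ (g.eval : A →+* R)

theorem IsRep.tpow {ι : Type*} [Fintype ι] [DecidableEq ι] {τ : Matrix ι ι A} (h : IsRep τ)
    (D : ℕ) : IsRep (BFN.tpow D τ) := by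
  apply IsRep.of_pmat
  · simp only [pmat_tpow, h.pmat_mul, tpow_mul]
  · rw [pmat_tpow, h.pmat_one, tpow_one]

/-- The sum of copies of a representation, indexed by `κ`. -/
theorem IsRep.blockDiagonal {ι κ : Type*} [Fintype ι] [DecidableEq ι] [Fintype κ] [DecidableEq κ]
    {τ : Matrix ι ι A} (h : IsRep τ) :
    IsRep (Matrix.blockDiagonal fun _ : κ => τ) := by
  apply IsRep.of_pmat
  · have key (g : Points A (A ⊗[ℂ] A)) : pmat (Matrix.blockDiagonal fun _ : κ => τ) g =
        Matrix.blockDiagonal fun _ : κ => pmat τ g :=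
      Matrix.blockDiagonal_map _ _ (map_zero _)
    rw [key, key, key, ← Matrix.blockDiagonal_mul]
    simp only [h.pmat_mul]
  · have key (g : Points A ℂ) : pmat (Matrix.blockDiagonal fun _ : κ => τ) g =
        Matrix.blockDiagonal fun _ : κ => pmat τ g :=
      Matrix.blockDiagonal_map _ _ (map_zero _)
    rw [key, h.pmat_one]
    exact Matrix.blockDiagonal_one

end Kap

/-! ### The generic pair of matrices -/

section Generic

variable {r : ℕ} {R S : Type*} [CommRing R] [Algebra ℂ R] [CommRing S] [Algebra ℂ S]

/-- The polynomial ring in the entries of two matrices. -/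
abbrev MatPoly (r : ℕ) : Type := MvPolynomial ((Fin r × Fin r) ⊕ (Fin r × Fin r)) ℂ

/-- The generic matrix with blocks `X`, `Yᵀ` and `1`. -/
def genMat (r : ℕ) : Matrix (Idx r) (Idx r) (MatPoly r) :=
  blk (Matrix.of fun i j => MvPolynomial.X (Sum.inl (i, j)))
    (Matrix.of fun i j => MvPolynomial.X (Sum.inr (i, j)))

/-- Evaluation of polynomials at a pair of matrices. -/
def evalPair (X Y : Matrix (Fin r) (Fin r) R) : MatPoly r →ₐ[ℂ] R :=
  MvPolynomial.aeval (Sum.elim (fun p => X p.1 p.2) fun p => Y p.1 p.2)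

theorem genMat_map_evalPair (X Y : Matrix (Fin r) (Fin r) R) :
    (genMat r).map (evalPair X Y) = blk X Y := by
  refine (blk_map _ _ (evalPair X Y : MatPoly r →+* R)).trans ?_
  congr 1 <;> ext i j <;> simp [evalPair]

theorem algHom_eq_evalPair (f : MatPoly r →ₐ[ℂ] R) :
    f = evalPair (Matrix.of fun i j => f (MvPolynomial.X (Sum.inl (i, j))))
      (Matrix.of fun i j => f (MvPolynomial.X (Sum.inr (i, j)))) := by
  apply MvPolynomial.algHom_ext
  rintro (p | p) <;> simp [evalPair]

theorem comp_evalPair (φ : R →ₐ[ℂ] S) (X Y : Matrix (Fin r) (Fin r) R) :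
    φ.comp (evalPair X Y) = evalPair (X.map φ) (Y.map φ) := by
  apply MvPolynomial.algHom_ext
  rintro (p | p) <;> simp [evalPair]

/-- The polynomial attached to a tensor. -/
def restitution (r D : ℕ) :
    ((Fin D → Idx r) × (Fin D → Idx r) → ℂ) →ₗ[ℂ] MatPoly r :=
  Fintype.linearCombination ℂ fun p => tpow D (genMat r) p.1 p.2

theorem restitution_apply {D : ℕ} (u : (Fin D → Idx r) × (Fin D → Idx r) → ℂ) :
    restitution r D u = ∑ p, u p • tpow D (genMat r) p.1 p.2 := rfl

theorem evalPair_restitution {D : ℕ} (X Y : Matrix (Fin r) (Fin r) R)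
    (u : (Fin D → Idx r) × (Fin D → Idx r) → ℂ) :
    evalPair X Y (restitution r D u) = ∑ I, ∑ J, u (I, J) • tpow D (blk X Y) I J := by
  rw [restitution_apply, map_sum, Fintype.sum_prod_type]
  refine Finset.sum_congr rfl fun I _ => Finset.sum_congr rfl fun J _ => ?_
  rw [map_smul, ← genMat_map_evalPair X Y]
  simp [tpow_apply]

theorem mul_mem_range_restitution {D : ℕ} {F : MatPoly r}
    (hF : F ∈ LinearMap.range (restitution r D)) (i j : Idx r) :
    F * genMat r i j ∈ LinearMap.range (restitution r (D + 1)) := by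
  have hr (D : ℕ) : LinearMap.range (restitution r D) = Submodule.span ℂ
      (Set.range fun p : (Fin D → Idx r) × (Fin D → Idx r) => tpow D (genMat r) p.1 p.2) :=
    Fintype.range_linearCombination ℂ _
  rw [hr] at hF ⊢
  induction hF using Submodule.span_induction with
  | mem x hx =>
    obtain ⟨p, rfl⟩ := hx
    refine Submodule.subset_span ⟨(Fin.snoc p.1 i, Fin.snoc p.2 j), ?_⟩
    simp [tpow_apply, Fin.prod_univ_castSucc]
  | zero => simp
  | add x y _ _ hx hy => rw [add_mul]; exact add_mem hx hy
  | smul a x _ hx => rw [smul_mul_assoc]; exact Submodule.smul_mem _ _ hx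

/-- The trivial summand of `V ⊕ V* ⊕ ℂ` contributes the entry `1`, so that lower degree tensors are
also tensors of higher degree. -/
theorem range_restitution_mono : Monotone fun D => LinearMap.range (restitution r D) := by
  refine monotone_nat_of_le_succ fun D F hF => ?_
  have := mul_mem_range_restitution hF (.inr (.inr ())) (.inr (.inr ()))
  simpa [genMat, blk] using this

theorem exists_mem_range_restitution (F : MatPoly r) :
    ∃ D, F ∈ LinearMap.range (restitution r D) := by
  induction F using MvPolynomial.induction_on with
  | C a =>
    refine ⟨0, fun _ => a, ?_⟩
    rw [restitution_apply, Fintype.sum_prod_type]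
    simp [tpow_apply, MvPolynomial.smul_eq_C_mul]
  | add p q hp hq =>
    obtain ⟨D, hp⟩ := hp
    obtain ⟨D', hq⟩ := hq
    exact ⟨max D D', add_mem (range_restitution_mono (le_max_left _ _) hp)
      (range_restitution_mono (le_max_right _ _) hq)⟩
  | mul_X p n hp =>
    obtain ⟨D, hp⟩ := hp
    refine ⟨D + 1, ?_⟩
    rcases n with ⟨i, j⟩ | ⟨i, j⟩
    · simpa [genMat, blk] using mul_mem_range_restitution hp (.inl i) (.inl j)
    -- The indices are exchanged because the second block is the transpose of `Y`.
    · simpa [genMat, blk] using mul_mem_range_restitution hp (.inr (.inl j)) (.inr (.inl i))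

theorem exists_forall_mem_range_restitution {κ : Type*} [Finite κ] (F : κ → MatPoly r) :
    ∃ D, ∀ k, F k ∈ LinearMap.range (restitution r D) := by
  choose D hD using fun k => exists_mem_range_restitution (F k)
  obtain ⟨B, hB⟩ := (Set.finite_range D).bddAbove
  exact ⟨B, fun k => range_restitution_mono (hB ⟨k, rfl⟩) (hD k)⟩

end Generic

/-! ### Lifting functions on the group to tensors by complete reducibility -/

section Reynolds

variable {A : Type*} [CommRing A] [HopfAlgebra ℂ A] {r : ℕ}

/-- An invariant tensor on `V ⊕ V* ⊕ ℂ`. -/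
def IsInvTensor (ρ : Rep A r) {D : ℕ} (t : (Fin D → Idx r) → ℂ) : Prop :=
  ∀ g : Points A ℂ, (tpow D (pmat (kap ρ) g)).mulVec t = t

/-- The action of a group element on a family of tensors. -/
def actFamily {κ : Type*} (ρ : Rep A r) (D : ℕ) (g : Points A ℂ)
    (u : (Fin D → Idx r) × κ → ℂ) : (Fin D → Idx r) × κ → ℂ :=
  fun p => (tpow D (pmat (kap ρ) g)).mulVec (fun J => u (J, p.2)) p.1

theorem pmat_blockDiagonal_mulVec {κ : Type*} [Fintype κ] [DecidableEq κ] (ρ : Rep A r) (D : ℕ)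
    (g : Points A ℂ) (u : (Fin D → Idx r) × κ → ℂ) :
    (pmat (Matrix.blockDiagonal fun _ : κ => tpow D (kap ρ)) g).mulVec u = actFamily ρ D g u := by
  funext p
  simp only [pmat, Matrix.mulVec, dotProduct, actFamily, Fintype.sum_prod_type,
    Matrix.blockDiagonal_apply, Matrix.map_apply]
  refine Finset.sum_congr rfl fun J _ => ?_
  rw [Finset.sum_eq_single p.2 (fun x _ hx => by rw [if_neg hx.symm, map_zero, zero_mul])
    (fun h => absurd (Finset.mem_univ _) h)]
  simp [tpow_apply]

/-- A substitute for the Reynolds operator: `e` projects onto an invariant complement of `ker φ`.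
Passing from `u` to `e u` does not change the value of `φ`, and relations that hold only after
applying `φ` become relations between tensors. -/
theorem exists_projection_family {κ V : Type*} [Fintype κ] [DecidableEq κ] [AddCommGroup V]
    [Module ℂ V] (hG : IsReductive A) (ρ : Rep A r) (D : ℕ)
    (φ : ((Fin D → Idx r) × κ → ℂ) →ₗ[ℂ] V)
    (hφ : ∀ g u, φ u = 0 → φ (actFamily ρ D g u) = 0) :
    ∃ e : ((Fin D → Idx r) × κ → ℂ) →ₗ[ℂ] ((Fin D → Idx r) × κ → ℂ),
      LinearMap.ker e = LinearMap.ker φ ∧ (∀ u, φ (e u) = φ u) ∧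
      ∀ g u, e (actFamily ρ D g u) = actFamily ρ D g (e u) := by
  obtain ⟨e, h1, h2, h3⟩ := hG.exists_projection
    (((isRep_kap ρ).tpow D).blockDiagonal (κ := κ)) (LinearMap.ker φ) (by
      intro g w hw
      rw [pmat_blockDiagonal_mulVec]
      exact hφ g w hw)
  refine ⟨e, h1, fun u => ?_, fun g u => ?_⟩
  · have := h2 u
    rw [LinearMap.mem_ker, map_sub, sub_eq_zero] at this
    exact this.symm
  · have := h3 g u
    rwa [pmat_blockDiagonal_mulVec, pmat_blockDiagonal_mulVec] at this

/-- If `φ u` does not move, then `g u - u` lies in `ker φ = ker e`, so the tensors `e u` are fixed.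
-/
theorem exists_invariant_lift {κ V : Type*} [Fintype κ] [DecidableEq κ] [AddCommGroup V]
    [Module ℂ V] (hG : IsReductive A) (ρ : Rep A r) (D : ℕ)
    (φ : ((Fin D → Idx r) × κ → ℂ) →ₗ[ℂ] V)
    (hφ : ∀ g u, φ u = 0 → φ (actFamily ρ D g u) = 0) (u : (Fin D → Idx r) × κ → ℂ)
    (hu : ∀ g, φ (actFamily ρ D g u) = φ u) :
    ∃ u', φ u' = φ u ∧ ∀ k, IsInvTensor ρ fun J => u' (J, k) := by
  obtain ⟨e, h1, h2, h3⟩ := exists_projection_family hG ρ D φ hφ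
  refine ⟨e u, h2 u, fun k g => ?_⟩
  have h4 : e (actFamily ρ D g u) = e u := by
    rw [← sub_eq_zero, ← map_sub, ← LinearMap.mem_ker, h1, LinearMap.mem_ker, map_sub, hu, sub_self]
  rw [h3] at h4
  funext J
  exact congrFun h4 (J, k)

variable {R : Type*} [CommRing R] [Algebra ℂ R]

/-- The polynomial attached to the `k`-th member of a family of tensors. -/
def restFamily {κ : Type*} (r D : ℕ) (k : κ) :
    ((Fin D → Idx r) × ((Fin D → Idx r) × κ) → ℂ) →ₗ[ℂ] MatPoly r :=
  restitution r D ∘ₗ LinearMap.funLeft ℂ ℂ fun p => (p.2, (p.1, k))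

theorem evalPair_restFamily {κ : Type*} {D : ℕ} (k : κ) (X Y : Matrix (Fin r) (Fin r) R)
    (u : (Fin D → Idx r) × ((Fin D → Idx r) × κ) → ℂ) :
    evalPair X Y (restFamily r D k u) = ∑ I, (tpow D (blk X Y)).mulVec
      (fun J => algebraMap ℂ R (u (J, (I, k)))) I := by
  rw [restFamily, LinearMap.comp_apply, evalPair_restitution]
  refine Finset.sum_congr rfl fun I _ => Finset.sum_congr rfl fun J _ => ?_
  rw [Algebra.smul_def, mul_comm]
  rfl

theorem exists_restFamily_eq {κ : Type*} [Finite κ] (F : κ → MatPoly r) :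
    ∃ D, ∃ u : (Fin D → Idx r) × ((Fin D → Idx r) × κ) → ℂ, ∀ k, restFamily r D k u = F k := by
  obtain ⟨D, hD⟩ := exists_forall_mem_range_restitution F
  choose v hv using hD
  exact ⟨D, fun p => v p.2.2 (p.2.1, p.1), fun k => hv k⟩

theorem exists_restFamily_eq_two {κ μ : Type*} [Finite κ] [Finite μ] (F : μ → κ → MatPoly r) :
    ∃ D, ∃ u : μ → (Fin D → Idx r) × ((Fin D → Idx r) × κ) → ℂ,
      ∀ j k, restFamily r D k (u j) = F j k := by
  obtain ⟨D, hD⟩ := exists_forall_mem_range_restitution fun p : μ × κ => F p.1 p.2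
  choose v hv using hD
  exact ⟨D, fun j p => v (j, p.2.2) (p.2.1, p.1), fun j k => hv (j, k)⟩

/-- A matrix over `ℂ`, considered over a `ℂ`-algebra. -/
abbrev bmap {m n : Type*} (R : Type*) [CommRing R] [Algebra ℂ R] (M : Matrix m n ℂ) :
    Matrix m n R := M.map (algebraMap ℂ R)

theorem bmap_mul {l m n : Type*} [Fintype m] (M : Matrix l m ℂ) (N : Matrix m n ℂ) :
    bmap R (M * N) = bmap R M * bmap R N := Matrix.map_mul

theorem bmap_mulVec {m n : Type*} [Fintype n] (M : Matrix m n ℂ) (v : n → ℂ) :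
    (bmap R M).mulVec (fun j => algebraMap ℂ R (v j)) = fun i => algebraMap ℂ R (M.mulVec v i) := by
  funext i
  simp [Matrix.mulVec, dotProduct]

/-- As `blk (X g) (g⁻¹ Y)` is `blk X Y` times the matrix of `g`, acting on the column index of the
tensors is right translation of the polynomials. The row index merely labels the members of the
family. -/
theorem evalPair_restFamily_act {κ : Type*} {D : ℕ} (ρ : Rep A r) (g : Points A ℂ) (k : κ)
    (X Y : Matrix (Fin r) (Fin r) R)
    (u : (Fin D → Idx r) × ((Fin D → Idx r) × κ) → ℂ) :
    evalPair X Y (restFamily r D k (actFamily ρ D g u)) =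
      evalPair (X * bmap R (ρ.mat g)) (bmap R (ρ.mat g⁻¹) * Y) (restFamily r D k u) := by
  simp only [evalPair_restFamily]
  refine Finset.sum_congr rfl fun I _ => ?_
  have h1 : blk (X * bmap R (ρ.mat g)) (bmap R (ρ.mat g⁻¹) * Y) =
      blk X Y * bmap R (pmat (kap ρ) g) := by
    rw [pmat_kap, ← blk_mul]
    exact congrArg _ (blk_map _ _ (algebraMap ℂ R)).symm
  rw [h1, tpow_mul, ← Matrix.mulVec_mulVec]
  have h2 : tpow D (bmap R (pmat (kap ρ) g)) = bmap R (tpow D (pmat (kap ρ) g)) :=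
    (tpow_map D _ (algebraMap ℂ R)).symm
  rw [h2, bmap_mulVec]
  rfl

/-- Right translation of functions on `G`. -/
def rightTranslation (g : Points A ℂ) : A →ₐ[ℂ] A :=
  (Points.ofHom (AlgHom.id ℂ A) * Points.map (Algebra.ofId ℂ A) g).eval

theorem map_rightTranslation {n : ℕ} (ρ : Rep A n) (g : Points A ℂ) :
    ρ.coeff.map (rightTranslation g) = ρ.coeff * bmap A (ρ.mat g) := by
  have := ρ.mat_mul (Points.ofHom (AlgHom.id ℂ A)) (Points.map (Algebra.ofId ℂ A) g)
  refine this.trans ?_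
  congr 1

theorem map_antipode_rightTranslation {n : ℕ} (ρ : Rep A n) (g : Points A ℂ) :
    (ρ.coeff.map (HopfAlgebra.antipode ℂ)).map (rightTranslation g) =
      bmap A (ρ.mat g⁻¹) * ρ.coeff.map (HopfAlgebra.antipode ℂ) := by
  have := ρ.mat_mul (Points.map (Algebra.ofId ℂ A) g)⁻¹ (Points.ofHom (AlgHom.id ℂ A))⁻¹
  rw [← mul_inv_rev] at this
  refine this.trans ?_
  rw [← map_inv]
  congr 1

/-- The restriction of polynomials to `G`. -/
def restrict (ρ : Rep A r) : MatPoly r →ₐ[ℂ] A :=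
  evalPair ρ.coeff (ρ.coeff.map (HopfAlgebra.antipode ℂ))

theorem eval_restrict (ρ : Rep A r) (g : Points A R) (F : MatPoly r) :
    g.eval (restrict ρ F) = evalPair (ρ.mat g) (ρ.mat g⁻¹) F :=
  DFunLike.congr_fun (comp_evalPair g.eval _ _) F

theorem restrict_surjective {ρ : Rep A r} (hρ : ρ.IsClosedEmbedding) :
    Function.Surjective (restrict ρ) := by
  rw [← AlgHom.range_eq_top, eq_top_iff, ← hρ, Algebra.adjoin_le_iff]
  rintro _ (⟨p, rfl⟩ | ⟨p, rfl⟩)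
  · exact ⟨MvPolynomial.X (Sum.inl p), by simp [restrict, evalPair]⟩
  · exact ⟨MvPolynomial.X (Sum.inr p), by simp [restrict, evalPair]⟩

theorem restrict_restFamily_act {κ : Type*} {D : ℕ} (ρ : Rep A r) (g : Points A ℂ) (k : κ)
    (u : (Fin D → Idx r) × ((Fin D → Idx r) × κ) → ℂ) :
    restrict ρ (restFamily r D k (actFamily ρ D g u)) =
      rightTranslation g (restrict ρ (restFamily r D k u)) := by
  rw [restrict, evalPair_restFamily_act]
  refine (DFunLike.congr_fun ((comp_evalPair (rightTranslation g) _ _).trans ?_)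
    (restFamily r D k u)).symm
  rw [map_rightTranslation, map_antipode_rightTranslation]

/-! ### Points -/

variable [Algebra.FiniteType ℂ A]

theorem eq_of_points [IsReduced A] {a b : A} (h : ∀ g : Points A ℂ, g.eval a = g.eval b) : a = b :=
  eq_of_forall_algHom_eq (k := ℂ) fun f => h (Points.ofHom f)

/-- Invariance is an identity between functions on `G`; it can be checked at complex points because
`A` is reduced, and then specialized to points over any algebra. -/
theorem IsInvTensor.mulVec_eq [IsReduced A] {ρ : Rep A r} {D : ℕ} {t : (Fin D → Idx r) → ℂ}
    (ht : IsInvTensor ρ t) (g : Points A R) :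
    (tpow D (pmat (kap ρ) g)).mulVec (fun J => algebraMap ℂ R (t J)) =
      fun J => algebraMap ℂ R (t J) := by
  funext I
  have h : (tpow D (kap ρ)).mulVec (fun J => algebraMap ℂ A (t J)) I = algebraMap ℂ A (t I) := by
    refine eq_of_points fun h => ?_
    rw [AlgHom.commutes]
    refine Eq.trans ?_ (congrFun (ht h) I)
    simp [Matrix.mulVec, dotProduct, tpow_apply, pmat]
  have h' := congrArg g.eval h
  rw [AlgHom.commutes] at h'
  rw [← h']
  simp [Matrix.mulVec, dotProduct, tpow_apply, pmat]

/-- Every representation of a reductive group `G ⊆ GL(V)` embeds into a sum of copies of a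
tensor power of `V ⊕ V* ⊕ ℂ`. -/
theorem exists_tensor_embedding [IsReduced A] (hG : IsReductive A) {ρ : Rep A r}
    (hρ : ρ.IsClosedEmbedding) {m : ℕ} (ν : Rep A m) :
    ∃ (D : ℕ) (ψ : (Fin D → Idx r) × Fin m → Matrix (Fin D → Idx r) (Fin m) ℂ),
      (∀ a, tpow D (kap ρ) * bmap A (ψ a) = bmap A (ψ a) * ν.coeff) ∧
      ∀ i j, ∑ I, ψ (I, i) I j = (1 : Matrix (Fin m) (Fin m) ℂ) i j := by
  classical
  choose F hF using fun j i => restrict_surjective hρ (ν.coeff i j)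
  obtain ⟨D, u, hu⟩ := exists_restFamily_eq_two F
  -- `φ` turns families of tensors into vectors of `m` functions on `G`; the families `u j` are
  -- chosen so that `φ (u j)` is the `j`-th column of `ν`.
  let φ : ((Fin D → Idx r) × ((Fin D → Idx r) × Fin m) → ℂ) →ₗ[ℂ] (Fin m → A) :=
    LinearMap.pi fun i => (restrict ρ).toLinearMap ∘ₗ restFamily r D i
  have hφ : ∀ g v i, φ (actFamily ρ D g v) i = rightTranslation g (φ v i) := fun g v i =>
    restrict_restFamily_act ρ g i v
  have hφu : ∀ j i, φ (u j) i = ν.coeff i j := by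
    intro j i
    rw [← hF j i, ← hu j i]
    rfl
  obtain ⟨e, h1, h2, h3⟩ := exists_projection_family hG ρ D φ (by
    intro g v hv
    funext i
    rw [hφ, hv, Pi.zero_apply, map_zero])
  refine ⟨D, fun a => Matrix.of fun J j => e (u j) (J, a), fun a => ?_, fun i j => ?_⟩
  · ext J j
    refine eq_of_points fun g => ?_
    -- Right translation by `g` transforms the columns of `ν` among themselves by the matrix `ν(g)`.
    -- The identity holds after applying `φ`, hence after applying `e`, which has the same kernel.
    have h4 : e (actFamily ρ D g (u j)) = e (∑ k, g.eval (ν.coeff k j) • u k) := by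
      rw [← sub_eq_zero, ← map_sub, ← LinearMap.mem_ker, h1, LinearMap.mem_ker, map_sub,
        sub_eq_zero]
      funext i
      rw [hφ, hφu, map_sum, Finset.sum_apply]
      have := congrFun (congrFun (map_rightTranslation ν g) i) j
      refine this.trans ?_
      simp only [Matrix.mul_apply, map_smul, Pi.smul_apply, hφu, Matrix.map_apply, Rep.mat]
      exact Finset.sum_congr rfl fun k _ => by rw [Algebra.smul_def, mul_comm]
    rw [h3, map_sum] at h4
    have h5 := congrFun h4 (J, a)
    simp only [actFamily, Matrix.mulVec, dotProduct, tpow_apply, pmat, Matrix.map_apply,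
      Finset.sum_apply, map_smul, Pi.smul_apply, smul_eq_mul] at h5
    simp only [Matrix.mul_apply, map_sum, map_mul, Matrix.map_apply, Matrix.of_apply, tpow_apply,
      map_prod, AlgHom.commutes, Algebra.algebraMap_self, RingHom.id_apply]
    rw [h5]
    exact Finset.sum_congr rfl fun k _ => mul_comm _ _
  -- Evaluating functions at the identity of `G` supplies the left inverse of the embedding.
  · have h4 : (1 : Points A ℂ).eval (φ (e (u j)) i) = (1 : Matrix (Fin m) (Fin m) ℂ) i j := by
      rw [h2, hφu, Points.one_eval, ν.counit_coeff]
      rfl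
    rw [← h4]
    refine Eq.trans ?_ (eval_restrict ρ 1 (restFamily r D i (e (u j)))).symm
    rw [evalPair_restFamily, inv_one, ρ.mat_one, blk_one, tpow_one]
    simp

end Reynolds

/-! ### A reductive group is the stabilizer of its invariant tensors -/

section Criterion

variable {A : Type*} [CommRing A] [HopfAlgebra ℂ A] {r : ℕ}
variable {R : Type*} [CommRing R] [Algebra ℂ R]

/-- The canonical element of `V ⊗ V*`. -/
def pairTensor (r : ℕ) : (Fin 2 → Idx r) → ℂ := fun J =>
  ∑ k : Fin r, if J = ![.inl k, .inr (.inl k)] then 1 else 0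

theorem pairTensor_mulVec (X Y : Matrix (Fin r) (Fin r) R) (I : Fin 2 → Idx r) :
    (tpow 2 (blk X Y)).mulVec (fun J => algebraMap ℂ R (pairTensor r J)) I =
      ∑ k, blk X Y (I 0) (.inl k) * blk X Y (I 1) (.inr (.inl k)) := by
  simp only [Matrix.mulVec, dotProduct, pairTensor, map_sum, Finset.mul_sum]
  rw [Finset.sum_comm]
  refine Finset.sum_congr rfl fun k _ => ?_
  simp [apply_ite (algebraMap ℂ R), tpow_apply]

/-- Fixing this tensor amounts to `X Y = 1`; thus the equations for invariant tensors already force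
a pair `(X, Y)` to be a matrix and its inverse. -/
theorem pairTensor_mulVec_apply (X Y : Matrix (Fin r) (Fin r) R) (i j : Fin r) :
    (tpow 2 (blk X Y)).mulVec (fun J => algebraMap ℂ R (pairTensor r J))
      ![.inl i, .inr (.inl j)] = (X * Y) i j := by
  rw [pairTensor_mulVec]
  simp [blk, Matrix.mul_apply]

theorem pairTensor_mulVec_of_mul_eq_one {X Y : Matrix (Fin r) (Fin r) R} (h : X * Y = 1) :
    (tpow 2 (blk X Y)).mulVec (fun J => algebraMap ℂ R (pairTensor r J)) =
      fun J => algebraMap ℂ R (pairTensor r J) := by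
  funext I
  have h1 := pairTensor_mulVec (1 : Matrix (Fin r) (Fin r) R) 1 I
  rw [blk_one, tpow_one, Matrix.one_mulVec] at h1
  rw [pairTensor_mulVec, h1]
  rcases h0 : I 0 with i | i <;> rcases h1 : I 1 with j | j | j <;> simp [blk]
  have := congrFun (congrFun h i) j
  rw [Matrix.mul_apply] at this
  rw [this]
  simp [Matrix.one_apply]

theorem isInvTensor_pairTensor (ρ : Rep A r) : IsInvTensor ρ (pairTensor r) := fun g => by
  rw [pmat_kap]
  exact pairTensor_mulVec_of_mul_eq_one (R := ℂ) (by rw [← ρ.mat_mul, mul_inv_cancel, ρ.mat_one])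

theorem exists_comp_eq_of_ker_le {P B C : Type*} [CommRing P] [Algebra ℂ P] [CommRing B]
    [Algebra ℂ B] [CommRing C] [Algebra ℂ C] {π : P →ₐ[ℂ] B} (hπ : Function.Surjective π)
    {f : P →ₐ[ℂ] C} (h : ∀ a, π a = 0 → f a = 0) : ∃ k : B →ₐ[ℂ] C, ∀ a, k (π a) = f a := by
  refine ⟨(Ideal.Quotient.liftₐ (RingHom.ker π) f h).comp
    (Ideal.quotientKerAlgEquivOfSurjective hπ).symm.toAlgHom, fun a => ?_⟩
  have : (Ideal.quotientKerAlgEquivOfSurjective hπ).symm (π a) = Ideal.Quotient.mk _ a := by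
    rw [AlgEquiv.symm_apply_eq]
    rfl
  change (Ideal.Quotient.liftₐ (RingHom.ker π) f h)
    ((Ideal.quotientKerAlgEquivOfSurjective hπ).symm (π a)) = f a
  rw [this]
  rfl

theorem mat_eq_of_eval_restrict {ρ : Rep A r} {g : Points A R} {X Y : Matrix (Fin r) (Fin r) R}
    (h : ∀ F, g.eval (restrict ρ F) = evalPair X Y F) : ρ.mat g = X := by
  ext i j
  have := h (MvPolynomial.X (Sum.inl (i, j)))
  rw [eval_restrict] at this
  simpa [evalPair] using this

/-- The polynomial functions given by an invariant tensor. -/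
def tensorPoly {D : ℕ} (t : (Fin D → Idx r) → ℂ) (I : Fin D → Idx r) : MatPoly r :=
  (tpow D (genMat r)).mulVec (fun J => algebraMap ℂ _ (t J)) I

theorem evalPair_tensorPoly {D : ℕ} (t : (Fin D → Idx r) → ℂ) (I : Fin D → Idx r)
    (X Y : Matrix (Fin r) (Fin r) R) :
    evalPair X Y (tensorPoly t I) =
      (tpow D (blk X Y)).mulVec (fun J => algebraMap ℂ R (t J)) I := by
  simp only [tensorPoly, Matrix.mulVec, dotProduct, map_sum, map_mul, AlgHom.commutes,
    ← genMat_map_evalPair X Y, tpow_apply, map_prod, Matrix.map_apply]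

/-- The restriction of polynomials to a translate of `G`. -/
def restrictTranslate (ρ : Rep A r) (X Y : Matrix (Fin r) (Fin r) ℂ) : MatPoly r →ₐ[ℂ] A :=
  evalPair (bmap A X * ρ.coeff) (ρ.coeff.map (HopfAlgebra.antipode ℂ) * bmap A Y)

theorem eval_restrictTranslate (ρ : Rep A r) (X Y : Matrix (Fin r) (Fin r) ℂ) (g : Points A ℂ)
    (F : MatPoly r) :
    g.eval (restrictTranslate ρ X Y F) = evalPair (X * ρ.mat g) (ρ.mat g⁻¹ * Y) F := by
  refine (DFunLike.congr_fun (comp_evalPair g.eval _ _) F).trans ?_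
  congr 2
  · ext i j
    simp [Matrix.mul_apply, Rep.mat]
  · ext i j
    simp [Matrix.mul_apply, Rep.mat, Points.inv_eval]

theorem restrictTranslate_surjective {ρ : Rep A r} (hρ : ρ.IsClosedEmbedding)
    {X Y : Matrix (Fin r) (Fin r) ℂ} (h : X * Y = 1) :
    Function.Surjective (restrictTranslate ρ X Y) := by
  have h' : Y * X = 1 := mul_eq_one_comm.mp h
  intro a
  obtain ⟨F, rfl⟩ := restrict_surjective hρ a
  -- The substitution that undoes the translation.
  let σ : MatPoly r →ₐ[ℂ] MatPoly r := evalPair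
    (bmap _ Y * Matrix.of fun i j => MvPolynomial.X (Sum.inl (i, j)))
    ((Matrix.of fun i j => MvPolynomial.X (Sum.inr (i, j))) * bmap _ X)
  refine ⟨σ F, ?_⟩
  refine DFunLike.congr_fun ((comp_evalPair (restrictTranslate ρ X Y) _ _).trans ?_) F
  have hb : ∀ M : Matrix (Fin r) (Fin r) ℂ,
      (bmap (MatPoly r) M).map (restrictTranslate ρ X Y) = bmap A M := by
    intro M
    ext i j
    exact AlgHom.commutes (restrictTranslate ρ X Y) _
  rw [restrict]
  congr 1
  · refine (Matrix.map_mul (f := (restrictTranslate ρ X Y : MatPoly r →+* A))).trans ?_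
    have : (Matrix.of fun i j : Fin r => (MvPolynomial.X (Sum.inl (i, j)) : MatPoly r)).map
        (restrictTranslate ρ X Y) = bmap A X * ρ.coeff := by
      ext i j
      simp [restrictTranslate, evalPair]
    refine (congrArg₂ (· * ·) (hb Y) this).trans ?_
    rw [← mul_assoc, ← bmap_mul (R := A), h']
    simp [bmap]
  · refine (Matrix.map_mul (f := (restrictTranslate ρ X Y : MatPoly r →+* A))).trans ?_
    have : (Matrix.of fun i j : Fin r => (MvPolynomial.X (Sum.inr (i, j)) : MatPoly r)).map
        (restrictTranslate ρ X Y) = ρ.coeff.map (HopfAlgebra.antipode ℂ) * bmap A Y := by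
      ext i j
      simp [restrictTranslate, evalPair]
    refine (congrArg₂ (· * ·) this (hb X)).trans ?_
    rw [mul_assoc, ← bmap_mul (R := A), h']
    simp [bmap]

/-- If `G` and its translate `X G` are disjoint, some polynomial is `0` on `G` and `1` on `X G`.
Complete reducibility lets it be built from invariant tensors, and a matrix that fixes these gives
it equal values at `1` and at `X`: a contradiction. If the two sets meet, then `X` lies in `G`. -/
theorem exists_point_of_fixes_complex (hG : IsReductive A) {ρ : Rep A r}
    (hρ : ρ.IsClosedEmbedding) {X Y : Matrix (Fin r) (Fin r) ℂ} (hXY : X * Y = 1)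
    (hfix : ∀ (D : ℕ) (t : (Fin D → Idx r) → ℂ), IsInvTensor ρ t →
      (tpow D (blk X Y)).mulVec t = t) :
    ∃ g : Points A ℂ, ρ.mat g = X := by
  by_cases htop : RingHom.ker (restrict ρ) ⊔ RingHom.ker (restrictTranslate ρ X Y) = ⊤
  · exfalso
    obtain ⟨F, hF, F', hF', hFF⟩ := Submodule.mem_sup.mp
      ((Ideal.eq_top_iff_one _).mp htop)
    rw [RingHom.mem_ker] at hF hF'
    have hF1 : restrictTranslate ρ X Y F = 1 := by
      have := congrArg (restrictTranslate ρ X Y) hFF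
      rwa [map_add, map_one, hF', add_zero] at this
    obtain ⟨D, u, hu⟩ := exists_restFamily_eq fun _ : Unit => F
    specialize hu ()
    let φ : ((Fin D → Idx r) × ((Fin D → Idx r) × Unit) → ℂ) →ₗ[ℂ] A × A :=
      (((restrict ρ).toLinearMap).prod (restrictTranslate ρ X Y).toLinearMap) ∘ₗ
        restFamily r D ()
    have hact : ∀ g v, φ (actFamily ρ D g v) =
        (rightTranslation g (φ v).1, rightTranslation g (φ v).2) := by
      intro g v
      refine Prod.ext (restrict_restFamily_act ρ g () v) ?_
      change restrictTranslate ρ X Y (restFamily r D () (actFamily ρ D g v)) =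
        rightTranslation g (restrictTranslate ρ X Y (restFamily r D () v))
      rw [restrictTranslate, evalPair_restFamily_act]
      refine (DFunLike.congr_fun ((comp_evalPair (rightTranslation g) _ _).trans ?_)
        (restFamily r D () v)).symm
      have hb : ∀ M : Matrix (Fin r) (Fin r) ℂ,
          (bmap A M).map (rightTranslation g) = bmap A M := by
        intro M
        ext i j
        exact AlgHom.commutes (rightTranslation g) _
      congr 1
      · refine (Matrix.map_mul (f := (rightTranslation g : A →+* A))).trans ?_
        refine (congrArg₂ (· * ·) (hb X) (map_rightTranslation ρ g)).trans ?_
        rw [mul_assoc]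
      · refine (Matrix.map_mul (f := (rightTranslation g : A →+* A))).trans ?_
        refine (congrArg₂ (· * ·) (map_antipode_rightTranslation ρ g) (hb Y)).trans ?_
        rw [mul_assoc]
    -- The pair of constant functions `(0, 1)` does not move under right translation, which is what
    -- allows the tensors to be made invariant.
    have hφu : φ u = (0, 1) := by
      refine Prod.ext ?_ ?_
      · change restrict ρ (restFamily r D () u) = 0
        rw [hu, hF]
      · change restrictTranslate ρ X Y (restFamily r D () u) = 1
        rw [hu, hF1]
    obtain ⟨u', hu', hinv⟩ := exists_invariant_lift hG ρ D φ (by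
      intro g v hv
      rw [hact, hv]
      simp) u (by
      intro g
      rw [hact, hφu]
      simp)
    rw [hφu] at hu'
    have e0 : restrict ρ (restFamily r D () u') = 0 := congrArg Prod.fst hu'
    have e1 : restrictTranslate ρ X Y (restFamily r D () u') = 1 := congrArg Prod.snd hu'
    -- Evaluation at the identity gives the value at the matrix `1` for `e2` and at `X` for `e3`.
    have e2 := congrArg (1 : Points A ℂ).eval e0
    have e3 := congrArg (1 : Points A ℂ).eval e1
    rw [eval_restrict, map_zero, evalPair_restFamily, inv_one, ρ.mat_one, blk_one, tpow_one] at e2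
    rw [eval_restrictTranslate, map_one, evalPair_restFamily, inv_one, ρ.mat_one, mul_one,
      one_mul] at e3
    simp only [Algebra.algebraMap_self, RingHom.id_apply, Matrix.one_mulVec] at e2 e3
    have e4 : ∀ I, (tpow D (blk X Y)).mulVec (fun J => u' (J, (I, ()))) I = u' (I, (I, ())) :=
      fun I => congrFun (hfix D _ (hinv (I, ()))) I
    simp only [e4] at e3
    exact zero_ne_one (e2.symm.trans e3)
  -- A common point of `G` and `X G`: it is the matrix of `k` and also `X` times the matrix of `k'`.
  · obtain ⟨f, hf⟩ := exists_algHom_of_ideal_ne_top (k := ℂ) htop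
    obtain ⟨k, hk⟩ := exists_comp_eq_of_ker_le (restrict_surjective hρ) (f := f) fun a ha =>
      hf a (Ideal.mem_sup_left ha)
    obtain ⟨k', hk'⟩ := exists_comp_eq_of_ker_le (restrictTranslate_surjective hρ hXY) (f := f)
      fun a ha => hf a (Ideal.mem_sup_right ha)
    have h1 : ρ.mat (Points.ofHom k) = X * ρ.mat (Points.ofHom k') := by
      refine mat_eq_of_eval_restrict (Y := ρ.mat (Points.ofHom k')⁻¹ * Y) fun F => ?_
      rw [← eval_restrictTranslate]
      exact (hk F).trans (hk' F).symm
    refine ⟨Points.ofHom k * (Points.ofHom k')⁻¹, ?_⟩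
    rw [ρ.mat_mul, h1, mul_assoc, ← ρ.mat_mul, mul_inv_cancel, ρ.mat_one, mul_one]

/-- A matrix that fixes all tensors that are fixed by `G` belongs to `G`. -/
theorem exists_point_of_fixes (hG : IsReductive A) {ρ : Rep A r} [IsReduced R]
    (hρ : ρ.IsClosedEmbedding) {p q : Matrix (Fin r) (Fin r) R}
    (hfix : ∀ (D : ℕ) (t : (Fin D → Idx r) → ℂ), IsInvTensor ρ t →
      (tpow D (blk p q)).mulVec (fun J => algebraMap ℂ R (t J)) =
        fun J => algebraMap ℂ R (t J)) :
    ∃ g : Points A R, ρ.mat g = p := by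
  let s : Set (MatPoly r) := {F | ∃ (D : ℕ) (t : (Fin D → Idx r) → ℂ) (I : Fin D → Idx r),
    IsInvTensor ρ t ∧ F = tensorPoly t I - algebraMap ℂ _ (t I)}
  have hker : ∀ F, restrict ρ F = 0 → evalPair p q F = 0 := by
    intro F hF
    -- By the complex case the fixing equations `s` have no zeros outside `G`, so a power of `F` is
    -- in their ideal. The power is removed at the end because `R` is reduced.
    obtain ⟨n, hn⟩ := pow_mem_of_forall_algHom (k := ℂ) (I := Ideal.span s) (a := F) (by
      intro f hf
      set X : Matrix (Fin r) (Fin r) ℂ := Matrix.of fun i j => f (MvPolynomial.X (Sum.inl (i, j)))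
        with hX
      set Y : Matrix (Fin r) (Fin r) ℂ := Matrix.of fun i j => f (MvPolynomial.X (Sum.inr (i, j)))
        with hY
      have hfe : f = evalPair X Y := algHom_eq_evalPair f
      have hfix' : ∀ (D : ℕ) (t : (Fin D → Idx r) → ℂ), IsInvTensor ρ t →
          (tpow D (blk X Y)).mulVec t = t := by
        intro D t ht
        funext I
        have := hf _ (Ideal.subset_span ⟨D, t, I, ht, rfl⟩)
        rw [map_sub, AlgHom.commutes, hfe, evalPair_tensorPoly, sub_eq_zero] at this
        exact this
      have hXY : X * Y = 1 := by
        ext i j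
        have h1 := pairTensor_mulVec_apply X Y i j
        have h2 := pairTensor_mulVec_apply (1 : Matrix (Fin r) (Fin r) ℂ) 1 i j
        simp only [Algebra.algebraMap_self, RingHom.id_apply] at h1 h2
        rw [blk_one, tpow_one, Matrix.one_mulVec, one_mul] at h2
        rw [← h1, ← h2, hfix' _ _ (isInvTensor_pairTensor ρ)]
      obtain ⟨g, hg⟩ := exists_point_of_fixes_complex hG hρ hXY hfix'
      have hgi : ρ.mat g⁻¹ = Y := by
        have h1 : ρ.mat g⁻¹ * X = 1 := by rw [← hg, ← ρ.mat_mul, inv_mul_cancel, ρ.mat_one]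
        calc ρ.mat g⁻¹ = ρ.mat g⁻¹ * (X * Y) := by rw [hXY, mul_one]
          _ = Y := by rw [← mul_assoc, h1, one_mul]
      rw [hfe, ← hg, ← hgi, ← eval_restrict, hF, map_zero])
    have h0 : ∀ G ∈ Ideal.span s, evalPair p q G = 0 := by
      intro G hG
      have : Ideal.span s ≤ RingHom.ker (evalPair p q) := by
        rw [Ideal.span_le]
        rintro _ ⟨D, t, I, ht, rfl⟩
        rw [SetLike.mem_coe, RingHom.mem_ker, map_sub, AlgHom.commutes, evalPair_tensorPoly,
          hfix D t ht, sub_self]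
      exact this hG
    have h1 := h0 _ hn
    rw [map_pow] at h1
    exact IsNilpotent.eq_zero ⟨n, h1⟩
  obtain ⟨k, hk⟩ := exists_comp_eq_of_ker_le (restrict_surjective hρ) hker
  exact ⟨Points.ofHom k, mat_eq_of_eval_restrict hk⟩

end Criterion

/-! ### Laurent series -/

theorem incl_injective : Function.Injective incl := HahnSeries.ofPowerSeries_injective

/-- `𝒪` as a subring of `𝒦`. -/
def intK : Subalgebra ℂ KK := incl.range

theorem incl_mem_intK (f : OO) : incl f ∈ intK := ⟨f, rfl⟩

theorem mem_intK {x : KK} : x ∈ intK ↔ ∀ j < 0, coeffK j x = 0 := by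
  constructor
  · rintro ⟨f, rfl⟩ j hj
    exact coeffK_incl_neg f hj
  · intro h
    refine ⟨PowerSeries.mk fun n => coeffK n x, coeffK_ext fun j => ?_⟩
    rcases lt_or_ge j 0 with hj | hj
    · rw [h j hj]
      exact coeffK_incl_neg _ hj
    · lift j to ℕ using hj
      exact (coeffK_incl _ j).trans (PowerSeries.coeff_mk _ _)

theorem constantCoeff_eq_coeffK (f : OO) : PowerSeries.constantCoeff f = coeffK 0 (incl f) := by
  have := coeffK_incl f 0
  rw [Nat.cast_zero] at this
  rw [this, PowerSeries.coeff_zero_eq_constantCoeff]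

/-! ### Reduction modulo `z` of a matrix with integral invariants -/

section Special

variable {A : Type*} [CommRing A] [HopfAlgebra ℂ A] {r : ℕ}

/-- A matrix over `𝒦` at which all invariants are regular has a reduction modulo `z`, as far as
the invariants are concerned. -/
theorem exists_reduction (hG : IsReductive A) (ρ : Rep A r)
    {N N' : Matrix (Fin r) (Fin r) KK} (hN : N * N' = 1)
    (H : ∀ (D : ℕ) (t : (Fin D → Idx r) → ℂ), IsInvTensor ρ t → ∀ I,
      (tpow D (blk N N')).mulVec (fun J => algebraMap ℂ KK (t J)) I ∈ intK) :
    ∃ h h' : Matrix (Fin r) (Fin r) ℂ, h * h' = 1 ∧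
      ∀ (D : ℕ) (t : (Fin D → Idx r) → ℂ), IsInvTensor ρ t → ∀ I,
        coeffK 0 ((tpow D (blk N N')).mulVec (fun J => algebraMap ℂ KK (t J)) I) =
          (tpow D (blk h h')).mulVec t I := by
  classical
  let GX : Matrix (Fin r) (Fin r) (MatPoly r) :=
    Matrix.of fun i j => MvPolynomial.X (Sum.inl (i, j))
  let GY : Matrix (Fin r) (Fin r) (MatPoly r) :=
    Matrix.of fun i j => MvPolynomial.X (Sum.inr (i, j))
  let α : Points A ℂ → MatPoly r →ₐ[ℂ] MatPoly r := fun g =>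
    evalPair (GX * bmap _ (ρ.mat g)) (bmap _ (ρ.mat g⁻¹) * GY)
  have hid : ∀ F : MatPoly r, evalPair GX GY F = F := fun F => by
    have := algHom_eq_evalPair (AlgHom.id ℂ (MatPoly r))
    exact (DFunLike.congr_fun this F).symm
  -- The `G`-invariant polynomials whose value at `(N, N')` lies in `z 𝒪`. A common complex zero of
  -- them is the reduction looked for.
  let s : Set (MatPoly r) := {F | (∀ g, α g F = F) ∧
    ∃ f : OO, incl f = evalPair N N' F ∧ PowerSeries.constantCoeff f = 0}
  have hne : Ideal.span s ≠ ⊤ := by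
    intro htop
    have h1 : (1 : MatPoly r) ∈ Ideal.span s := by rw [htop]; trivial
    -- In a relation `1 = ∑ aᵢ Fᵢ` both `1` and the `Fᵢ` are invariant, so the `aᵢ` can be taken to
    -- come from invariant tensors. By `H` their values at `(N, N')` are then integral, and the
    -- right-hand side lies in `z 𝒪`: a contradiction.
    obtain ⟨n, a, F, haF⟩ := Submodule.mem_span_set'.mp h1
    obtain ⟨D, u, hu⟩ := exists_restFamily_eq a
    let φ : ((Fin D → Idx r) × ((Fin D → Idx r) × Fin n) → ℂ) →ₗ[ℂ] MatPoly r :=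
      ∑ i, LinearMap.mulRight ℂ (F i : MatPoly r) ∘ₗ restFamily r D i
    have hφ : ∀ v, φ v = ∑ i, restFamily r D i v * F i := fun v => by
      simp [φ, LinearMap.sum_apply]
    have hφu : φ u = 1 := by
      rw [hφ, ← haF]
      simp only [hu, smul_eq_mul]
    have hact : ∀ g v, φ (actFamily ρ D g v) = α g (φ v) := by
      intro g v
      rw [hφ, hφ, map_sum]
      refine Finset.sum_congr rfl fun i _ => ?_
      rw [map_mul, (F i).2.1 g, ← hid (restFamily r D i (actFamily ρ D g v)),
        evalPair_restFamily_act]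
    obtain ⟨u', hu', hinv⟩ := exists_invariant_lift hG ρ D φ (by
      intro g v hv
      rw [hact, hv, map_zero]) u (by
      intro g
      rw [hact, hφu, map_one])
    rw [hφu, hφ] at hu'
    have hb : ∀ i, ∃ b : OO, incl b = evalPair N N' (restFamily r D i u') := by
      intro i
      have : evalPair N N' (restFamily r D i u') ∈ intK := by
        rw [evalPair_restFamily]
        exact sum_mem fun I _ => H D _ (hinv (I, i)) I
      exact this
    choose b hb using hb
    choose f hf using fun i => (F i).2.2
    have h2 : ∑ i, b i * f i = 1 := by
      apply incl_injective
      rw [map_sum, map_one]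
      have := congrArg (evalPair N N') hu'
      rw [map_sum, map_one] at this
      rw [← this]
      refine Finset.sum_congr rfl fun i _ => ?_
      rw [map_mul, map_mul, hb, (hf i).1]
    have h3 := congrArg (PowerSeries.constantCoeff (R := ℂ)) h2
    rw [map_sum, map_one] at h3
    refine zero_ne_one (Eq.trans (Eq.symm ?_) h3)
    refine Finset.sum_eq_zero fun i _ => ?_
    rw [map_mul, (hf i).2, mul_zero]
  obtain ⟨f, hf⟩ := exists_algHom_of_ideal_ne_top (k := ℂ) hne
  set X : Matrix (Fin r) (Fin r) ℂ := Matrix.of fun i j => f (MvPolynomial.X (Sum.inl (i, j)))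
  set Y : Matrix (Fin r) (Fin r) ℂ := Matrix.of fun i j => f (MvPolynomial.X (Sum.inr (i, j)))
  have hfe : f = evalPair X Y := algHom_eq_evalPair f
  have key : ∀ (D : ℕ) (t : (Fin D → Idx r) → ℂ), IsInvTensor ρ t → ∀ I,
      coeffK 0 ((tpow D (blk N N')).mulVec (fun J => algebraMap ℂ KK (t J)) I) =
        (tpow D (blk X Y)).mulVec t I := by
    intro D t ht I
    obtain ⟨y, hy⟩ := H D t ht I
    replace hy : incl y = _ := hy
    -- Subtracting the constant coefficient of its value puts every coordinate of an invariant
    -- tensor into `s`.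
    have hmem : tensorPoly t I - algebraMap ℂ _ (PowerSeries.constantCoeff y) ∈ s := by
      refine ⟨fun g => ?_, y - algebraMap ℂ OO (PowerSeries.constantCoeff y), ?_, ?_⟩
      · rw [map_sub, AlgHom.commutes]
        congr 1
        rw [evalPair_tensorPoly, ← blk_mul, tpow_mul, ← Matrix.mulVec_mulVec]
        have h1 : blk (bmap (MatPoly r) (ρ.mat g)) (bmap _ (ρ.mat g⁻¹)) =
            bmap _ (pmat (kap ρ) g) := by
          rw [pmat_kap]
          exact (blk_map _ _ (algebraMap ℂ (MatPoly r))).symm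
        have h2 : tpow D (bmap (MatPoly r) (pmat (kap ρ) g)) =
            bmap _ (tpow D (pmat (kap ρ) g)) := (tpow_map D _ (algebraMap ℂ (MatPoly r))).symm
        rw [h1, h2, bmap_mulVec, ht g]
        rfl
      · rw [map_sub, map_sub, AlgHom.commutes, AlgHom.commutes, hy, evalPair_tensorPoly]
      · rw [map_sub]
        simp
    have h3 := hf _ (Ideal.subset_span hmem)
    rw [map_sub, AlgHom.commutes, hfe, evalPair_tensorPoly, sub_eq_zero] at h3
    rw [← hy, ← constantCoeff_eq_coeffK]
    exact h3.symm
  refine ⟨X, Y, ?_, key⟩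
  ext i j
  have h1 := pairTensor_mulVec_apply X Y i j
  have h2 := pairTensor_mulVec_apply N N' i j
  have h3 := key 2 _ (isInvTensor_pairTensor ρ) ![.inl i, .inr (.inl j)]
  simp only [Algebra.algebraMap_self, RingHom.id_apply] at h1
  rw [h1, h2, hN] at h3
  rw [← h3, Matrix.one_apply, Matrix.one_apply]
  have h4 := coeffK_incl 1 0
  rw [map_one, Nat.cast_zero] at h4
  split_ifs
  · rw [h4]; simp
  · rw [map_zero]

end Special

/-! ### The differential of the tensor power -/

section Lie

variable {R : Type*} [CommRing R]

theorem derivation_prod [Algebra ℂ R] (d : Derivation ℂ R R) {κ : Type*} [DecidableEq κ]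
    (s : Finset κ) (f : κ → R) :
    d (∏ i ∈ s, f i) = ∑ i ∈ s, d (f i) * ∏ j ∈ s.erase i, f j := by
  induction s using Finset.induction_on with
  | empty => simp
  | insert a s ha ih =>
    rw [Finset.prod_insert ha, d.leibniz, ih, Finset.sum_insert ha, Finset.erase_insert ha,
      smul_eq_mul, smul_eq_mul, Finset.mul_sum, add_comm]
    congr 1
    · exact mul_comm _ _
    · refine Finset.sum_congr rfl fun i hi => ?_
      have hia : a ≠ i := fun h => ha (h ▸ hi)
      rw [Finset.erase_insert_of_ne hia, Finset.prod_insert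
        (fun h => ha (Finset.mem_of_mem_erase h))]
      ring

/-- The action of the Lie algebra on the tensor power. -/
def tder {ι : Type*} [DecidableEq ι] (D : ℕ) (H : Matrix ι ι R) :
    Matrix (Fin D → ι) (Fin D → ι) R :=
  ∑ s, tens (Function.update (fun _ => 1) s H)

theorem tens_update_apply {ι : Type*} {D : ℕ} (F : Fin D → Matrix ι ι R) (s : Fin D)
    (H : Matrix ι ι R) (I J : Fin D → ι) :
    tens (Function.update F s H) I J = H (I s) (J s) *
      ∏ j ∈ Finset.univ.erase s, F j (I j) (J j) := by
  rw [tens_apply, ← Finset.mul_prod_erase _ _ (Finset.mem_univ s), Function.update_self]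
  congr 1
  refine Finset.prod_congr rfl fun j hj => ?_
  rw [Function.update_of_ne (Finset.ne_of_mem_erase hj)]

theorem tder_add {ι : Type*} [DecidableEq ι] (D : ℕ) (H H' : Matrix ι ι R) :
    tder D (H + H') = tder D H + tder D H' := by
  rw [tder, tder, tder, ← Finset.sum_add_distrib]
  refine Finset.sum_congr rfl fun s _ => ?_
  ext I J
  simp only [tens_update_apply, Matrix.add_apply, add_mul]

theorem tder_smul {ι : Type*} [DecidableEq ι] (D : ℕ) (a : R) (H : Matrix ι ι R) :
    tder D (a • H) = a • tder D H := by
  rw [tder, tder, Finset.smul_sum]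
  refine Finset.sum_congr rfl fun s _ => ?_
  ext I J
  simp only [tens_update_apply, Matrix.smul_apply, smul_eq_mul, mul_assoc]

theorem tder_map {ι S : Type*} [DecidableEq ι] [CommRing S] (D : ℕ) (H : Matrix ι ι R)
    (φ : R →+* S) : (tder D H).map φ = tder D (H.map φ) := by
  ext I J
  simp only [tder, Matrix.map_apply, Matrix.sum_apply, map_sum, tens_update_apply, map_mul,
    map_prod]
  refine Finset.sum_congr rfl fun s _ => ?_
  congr 1
  refine Finset.prod_congr rfl fun j _ => ?_
  rw [Matrix.one_apply, Matrix.one_apply]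
  split_ifs <;> simp

theorem tder_mul_tpow {ι : Type*} [Fintype ι] [DecidableEq ι] (D : ℕ) (H P : Matrix ι ι R) :
    tder D H * tpow D P = ∑ s, tens (Function.update (fun _ => P) s (H * P)) := by
  rw [tder, Finset.sum_mul]
  refine Finset.sum_congr rfl fun s _ => ?_
  rw [tpow, tens_mul]
  congr 1
  funext j
  rcases eq_or_ne j s with rfl | hj
  · simp
  · simp [Function.update_of_ne hj]

theorem tpow_mul_tder {ι : Type*} [Fintype ι] [DecidableEq ι] (D : ℕ) (H P : Matrix ι ι R) :
    tpow D P * tder D H = ∑ s, tens (Function.update (fun _ => P) s (P * H)) := by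
  rw [tder, Finset.mul_sum]
  refine Finset.sum_congr rfl fun s _ => ?_
  rw [tpow, tens_mul]
  congr 1
  funext j
  rcases eq_or_ne j s with rfl | hj
  · simp
  · simp [Function.update_of_ne hj]

theorem derivation_tpow [Algebra ℂ R] {ι : Type*} [Fintype ι] [DecidableEq ι]
    (d : Derivation ℂ R R) (D : ℕ) {P H : Matrix ι ι R} (h : P.map d = H * P) :
    (tpow D P).map d = tder D H * tpow D P := by
  rw [tder_mul_tpow, ← h]
  ext I J
  simp only [Matrix.map_apply, tpow_apply, derivation_prod, Matrix.sum_apply, tens_update_apply]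

variable {r : ℕ}

/-- The action of the Lie algebra on `V ⊕ V* ⊕ ℂ`. -/
def lieBlk (ξ : Matrix (Fin r) (Fin r) R) : Matrix (Idx r) (Idx r) R :=
  Matrix.fromBlocks ξ 0 0 (Matrix.fromBlocks (-ξ.transpose) 0 0 0)

theorem lieBlk_add (ξ η : Matrix (Fin r) (Fin r) R) : lieBlk (ξ + η) = lieBlk ξ + lieBlk η := by
  simp [lieBlk, Matrix.fromBlocks_add, add_comm]

theorem lieBlk_smul (a : R) (ξ : Matrix (Fin r) (Fin r) R) : lieBlk (a • ξ) = a • lieBlk ξ := by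
  simp [lieBlk, Matrix.fromBlocks_smul]

theorem lieBlk_map {S : Type*} [CommRing S] (ξ : Matrix (Fin r) (Fin r) R) (φ : R →+* S) :
    (lieBlk ξ).map φ = lieBlk (ξ.map φ) := by
  simp only [lieBlk, Matrix.fromBlocks_map, Matrix.map_zero _ (map_zero φ)]
  congr 2
  ext i j
  simp

theorem blk_mul_lieBlk {p q : Matrix (Fin r) (Fin r) R} (h : q * p = 1)
    (η : Matrix (Fin r) (Fin r) R) : blk p q * lieBlk η = lieBlk (p * η * q) * blk p q := by
  have h' : p.transpose * q.transpose = 1 := by rw [← Matrix.transpose_mul, h, Matrix.transpose_one]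
  simp only [blk, lieBlk, Matrix.fromBlocks_multiply, Matrix.transpose_mul]
  simp [mul_assoc, h, h']

theorem tpow_mul_tder_lieBlk (D : ℕ) {p q : Matrix (Fin r) (Fin r) R} (h : q * p = 1)
    (η : Matrix (Fin r) (Fin r) R) :
    tpow D (blk p q) * tder D (lieBlk η) = tder D (lieBlk (p * η * q)) * tpow D (blk p q) := by
  rw [tder_mul_tpow, tpow_mul_tder, blk_mul_lieBlk h]

theorem derivation_mul_matrix [Algebra ℂ R] {l m n : Type*} [Fintype m] (d : Derivation ℂ R R)
    (P : Matrix l m R) (Q : Matrix m n R) : (P * Q).map d = P.map d * Q + P * Q.map d := by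
  ext i j
  simp only [Matrix.map_apply, Matrix.mul_apply, map_sum, d.leibniz, smul_eq_mul,
    Matrix.add_apply, ← Finset.sum_add_distrib]
  exact Finset.sum_congr rfl fun k _ => by ring

theorem derivation_one_matrix [Algebra ℂ R] {m : Type*} [DecidableEq m] (d : Derivation ℂ R R) :
    (1 : Matrix m m R).map d = 0 := by
  ext i j
  rw [Matrix.map_apply, Matrix.one_apply]
  split_ifs <;> simp

/-- Differentiating `Y X = 1` gives `Y' = -Y ξ`, which accounts for the sign in the dual block of
`lieBlk`. -/
theorem derivation_blk [Algebra ℂ R] (d : Derivation ℂ R R) {X Y ξ : Matrix (Fin r) (Fin r) R}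
    (hXY : X * Y = 1) (h : X.map d = ξ * X) : (blk X Y).map d = lieBlk ξ * blk X Y := by
  have hYX : Y * X = 1 := mul_eq_one_comm.mp hXY
  have h1 : Y.map d = -(Y * ξ) := by
    have h2 := derivation_mul_matrix d Y X
    rw [hYX, derivation_one_matrix, h] at h2
    calc Y.map d = Y.map d * X * Y := by rw [mul_assoc, hXY, mul_one]
      _ = -(Y * (ξ * X)) * Y := by rw [eq_neg_of_add_eq_zero_left h2.symm]
      _ = -(Y * ξ) := by rw [neg_mul, mul_assoc, mul_assoc, hXY, mul_one]
  simp only [blk, lieBlk, Matrix.fromBlocks_multiply, Matrix.fromBlocks_map, h,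
    Matrix.transpose_map, h1, derivation_one_matrix, Matrix.map_zero _ (map_zero d)]
  simp [Matrix.transpose_mul]

/-- The tensor `t` is constant, so its image under `X` solves the linear system given by the
logarithmic derivative `ξ` of `X`. -/
theorem derivation_tpow_mulVec [Algebra ℂ R] (d : Derivation ℂ R R) (D : ℕ)
    {X Y ξ : Matrix (Fin r) (Fin r) R} (hXY : X * Y = 1) (h : X.map d = ξ * X)
    (t : (Fin D → Idx r) → ℂ) (I : Fin D → Idx r) :
    d ((tpow D (blk X Y)).mulVec (fun J => algebraMap ℂ R (t J)) I) =
      (tder D (lieBlk ξ)).mulVec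
        ((tpow D (blk X Y)).mulVec (fun J => algebraMap ℂ R (t J))) I := by
  rw [Matrix.mulVec_mulVec, ← derivation_tpow d D (derivation_blk d hXY h)]
  simp only [Matrix.mulVec, dotProduct, map_sum, Matrix.map_apply, d.leibniz, d.map_algebraMap,
    smul_eq_mul]
  exact Finset.sum_congr rfl fun J _ => by rw [mul_zero, zero_add, mul_comm]

/-- The covectors that describe the infinitesimal action on a vector. -/
def lieCoeff {D : ℕ} (y : (Fin D → Idx r) → R) (I : Fin D → Idx r) (p : Fin r × Fin r) : R :=
  (tder D (lieBlk (Matrix.single p.1 p.2 1))).mulVec y I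

theorem tder_lieBlk_mulVec {D : ℕ} (ξ : Matrix (Fin r) (Fin r) R) (y : (Fin D → Idx r) → R)
    (I : Fin D → Idx r) :
    (tder D (lieBlk ξ)).mulVec y I = ∑ p, lieCoeff y I p * ξ p.1 p.2 := by
  let L : Matrix (Fin r) (Fin r) R →ₗ[R] R :=
    { toFun := fun ξ => (tder D (lieBlk ξ)).mulVec y I
      map_add' := fun ξ η => by simp [lieBlk_add, tder_add, Matrix.add_mulVec]
      map_smul' := fun a ξ => by simp [lieBlk_smul, tder_smul, Matrix.smul_mulVec] }
  have hL : ∀ η, (tder D (lieBlk η)).mulVec y I = L η := fun _ => rfl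
  simp only [lieCoeff, hL, Fintype.sum_prod_type]
  conv_lhs => rw [Matrix.matrix_eq_sum_single ξ, map_sum]
  refine Finset.sum_congr rfl fun i _ => ?_
  rw [map_sum]
  refine Finset.sum_congr rfl fun j _ => ?_
  have : Matrix.single i j (ξ i j) = ξ i j • Matrix.single i j (1 : R) := by
    rw [Matrix.smul_single, smul_eq_mul, mul_one]
  rw [this, map_smul, smul_eq_mul, mul_comm]

end Lie

/-! ### The derivation of `𝒦` -/

instance : Algebra OO KK := incl.toRingHom.toAlgebra

instance : IsFractionRing OO KK :=
  inferInstanceAs (IsFractionRing (PowerSeries ℂ) (LaurentSeries ℂ))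

instance : IsScalarTower ℂ OO KK := IsScalarTower.of_algebraMap_eq fun a => (incl.commutes a).symm

theorem algebraMap_eq_incl (f : OO) : algebraMap OO KK f = incl f := rfl

/-- The derivation of `𝒪`. -/
abbrev derO : Derivation ℂ OO OO := PowerSeries.derivative ℂ

/-- Power series as series with coefficients in the dual numbers over `𝒦`. -/
def inclDual : OO →+* TrivSqZeroExt KK KK where
  toFun f := TrivSqZeroExt.inl (incl f) + TrivSqZeroExt.inr (incl (derO f))
  map_one' := by ext <;> simp
  map_mul' f g := by
    ext
    · simp
    · simp
      ring
  map_zero' := by ext <;> simp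
  map_add' f g := by ext <;> simp

/-- A dual number is a unit when its first component is. Hence the ring homomorphism `f ↦ f + f' ε`
extends to the fraction field `𝒦`, and its second component extends the derivation. -/
theorem isUnit_inclDual (f : nonZeroDivisors OO) : IsUnit (inclDual f) := by
  rw [TrivSqZeroExt.isUnit_iff_isUnit_fst]
  have : (inclDual f).fst = algebraMap OO KK f := by simp [inclDual, algebraMap_eq_incl]
  rw [this]
  exact IsLocalization.map_units KK f

/-- The Taylor expansion to first order on `𝒦`. -/
def taylorK : KK →+* TrivSqZeroExt KK KK := IsLocalization.lift isUnit_inclDual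

theorem taylorK_incl (f : OO) : taylorK (incl f) = inclDual f :=
  IsLocalization.lift_eq isUnit_inclDual f

theorem taylorK_fst (x : KK) : (taylorK x).fst = x := by
  have : (TrivSqZeroExt.fstHom KK KK KK).toRingHom.comp taylorK = RingHom.id KK := by
    apply IsLocalization.ringHom_ext (nonZeroDivisors OO)
    ext f
    simp [algebraMap_eq_incl, taylorK_incl, inclDual]
  exact DFunLike.congr_fun this x

/-- The derivation of `𝒦`. -/
def derK : Derivation ℂ KK KK where
  toFun x := (taylorK x).snd
  map_add' x y := by simp
  map_smul' a x := by
    rw [Algebra.smul_def, ← AlgHom.commutes incl, map_mul, taylorK_incl]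
    simp only [inclDual, Algebra.smul_def]
    simp
    exact Or.inl (incl.commutes a)
  map_one_eq_zero' := by simp
  leibniz' x y := by simp [taylorK_fst, mul_comm]

theorem derK_incl (f : OO) : derK (incl f) = incl (derO f) := by
  change (taylorK (incl f)).snd = _
  rw [taylorK_incl]
  simp [inclDual]

/-! ### Linear differential equations over `𝒪` -/

/-- The coefficients of the solution of `h' = ξ h`. -/
def odeCoeff {r : ℕ} (ξ : ℕ → Matrix (Fin r) (Fin r) ℂ) (h₀ : Matrix (Fin r) (Fin r) ℂ) :
    ℕ → Matrix (Fin r) (Fin r) ℂ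
  | 0 => h₀
  -- The coefficient of `zⁿ` in `h' = ξ h`, divided by `n + 1`.
  | n + 1 => ((n : ℂ) + 1)⁻¹ • ∑ i : Fin (n + 1), ξ (n - i) * odeCoeff ξ h₀ i

theorem exists_ode_solution {r : ℕ} (ξ : Matrix (Fin r) (Fin r) OO)
    (h₀ : Matrix (Fin r) (Fin r) ℂ) :
    ∃ h : Matrix (Fin r) (Fin r) OO, h.map derO = ξ * h ∧
      h.map PowerSeries.constantCoeff = h₀ := by
  let c := odeCoeff (fun n => ξ.map (PowerSeries.coeff n)) h₀
  refine ⟨Matrix.of fun i j => PowerSeries.mk fun n => c n i j, ?_, ?_⟩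
  · ext i j n
    have hn : ((n : ℂ) + 1) ≠ 0 := by exact_mod_cast Nat.succ_ne_zero n
    have hc : c (n + 1) = ((n : ℂ) + 1)⁻¹ •
        ∑ k : Fin (n + 1), ξ.map (PowerSeries.coeff (n - k)) * c k := by
      simp only [c]
      rw [odeCoeff]
    simp only [Matrix.map_apply, Matrix.of_apply, PowerSeries.coeff_derivative,
      PowerSeries.coeff_mk, Matrix.mul_apply, map_sum, PowerSeries.coeff_mul]
    rw [hc, Matrix.smul_apply, smul_eq_mul, mul_comm, ← mul_assoc, mul_inv_cancel₀ hn, one_mul,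
      Matrix.sum_apply]
    simp only [Matrix.mul_apply, Matrix.map_apply]
    rw [Finset.sum_comm]
    refine Finset.sum_congr rfl fun k _ => ?_
    rw [← Finset.Nat.sum_antidiagonal_swap, Finset.Nat.sum_antidiagonal_eq_sum_range_succ_mk,
      Finset.sum_range]
    rfl
  · ext i j
    simp [c, odeCoeff, ← PowerSeries.coeff_zero_eq_constantCoeff_apply]

theorem ode_unique {J : Type*} [Fintype J] (B : Matrix J J OO) {y y' : J → OO}
    (hy : ∀ i, derO (y i) = B.mulVec y i) (hy' : ∀ i, derO (y' i) = B.mulVec y' i)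
    (h0 : ∀ i, PowerSeries.constantCoeff (y i) = PowerSeries.constantCoeff (y' i)) : y = y' := by
  have key : ∀ n i, PowerSeries.coeff n (y i) = PowerSeries.coeff n (y' i) := by
    intro n
    induction n using Nat.strong_induction_on with
    | _ n ih =>
      intro i
      rcases n with _ | n
      · simpa using h0 i
      · have hn : ((n : ℂ) + 1) ≠ 0 := by exact_mod_cast Nat.succ_ne_zero n
        have h1 := congrArg (PowerSeries.coeff n) (hy i)
        have h2 := congrArg (PowerSeries.coeff n) (hy' i)
        rw [PowerSeries.coeff_derivative] at h1 h2
        apply mul_right_cancel₀ hn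
        rw [h1, h2]
        simp only [Matrix.mulVec, dotProduct, map_sum, PowerSeries.coeff_mul]
        refine Finset.sum_congr rfl fun k _ => Finset.sum_congr rfl fun p hp => ?_
        rw [ih p.2 (by have := Finset.HasAntidiagonal.mem_antidiagonal.mp hp; omega)]
  funext i
  ext n
  exact key n i

/-! ### Linear systems whose rank does not drop at `z = 0` -/

theorem exists_right_inverse_of_linearIndependent {k : Type*} [Field k] {κ τ : Type*} [Fintype κ]
    [DecidableEq κ] [Fintype τ] {M : Matrix κ τ k} (hM : LinearIndependent k M.row) :
    ∃ B : Matrix τ κ k, M * B = 1 := by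
  classical
  rw [← Matrix.mulVec_surjective_iff_exists_right_inverse]
  have : LinearMap.range M.mulVecLin = ⊤ := by
    apply Submodule.eq_top_of_finrank_eq
    rw [Module.finrank_fintype_fun_eq_card]
    exact hM.rank_matrix
  exact LinearMap.range_eq_top.mp this

theorem finrank_ker_of_right_inverse {k : Type*} [Field k] {κ τ : Type*} [Fintype κ]
    [DecidableEq κ] [Fintype τ] {M : Matrix κ τ k} {B : Matrix τ κ k} (h : M * B = 1) :
    Module.finrank k (LinearMap.ker M.mulVecLin) + Fintype.card κ = Fintype.card τ := by
  classical
  have h1 := LinearMap.finrank_range_add_finrank_ker M.mulVecLin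
  have h2 : LinearMap.range M.mulVecLin = ⊤ := LinearMap.range_eq_top.mpr
    (Matrix.mulVec_surjective_iff_exists_right_inverse.mpr ⟨B, h⟩)
  rw [h2, finrank_top, Module.finrank_fintype_fun_eq_card, Module.finrank_fintype_fun_eq_card] at h1
  omega

theorem exists_unit_inverse {κ : Type*} [Fintype κ] [DecidableEq κ] {C : Matrix κ κ OO}
    (h : IsUnit (C.map PowerSeries.constantCoeff)) : ∃ C' : Matrix κ κ OO, C * C' = 1 := by
  rw [Matrix.isUnit_iff_isUnit_det] at h
  have h1 : IsUnit C.det := by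
    rw [PowerSeries.isUnit_iff_constantCoeff, RingHom.map_det]
    exact h
  exact ⟨C⁻¹, Matrix.mul_nonsing_inv C h1⟩

/-- `hrank` says that over `𝒦` the homogeneous system has at least as many independent solutions as
at `z = 0`, so its rank does not drop at `z = 0`. Equations chosen to be a basis at `z = 0` can be
solved over `𝒪`, and over `𝒦` they imply all the others. -/
theorem exists_integral_solution {Ω τ : Type*} [Fintype τ] (a : Ω → τ → OO)
    (hrank : ∃ (κ : Type) (_ : Fintype κ) (w : κ → τ → KK), LinearIndependent KK w ∧
      (∀ k ω, ∑ i, incl (a ω i) * w k i = 0) ∧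
      ∀ (V : Submodule ℂ (τ → ℂ)),
        (∀ v ∈ V, ∀ ω, ∑ i, PowerSeries.constantCoeff (a ω i) * v i = 0) →
        Module.finrank ℂ V ≤ Fintype.card κ)
    (v : τ → KK) (hv : ∀ ω, ∑ i, incl (a ω i) * v i ∈ intK) :
    ∃ v' : τ → OO, ∀ ω, ∑ i, incl (a ω i) * incl (v' i) = ∑ i, incl (a ω i) * v i := by
  classical
  obtain ⟨κ, _, w, hw, hwa, hV⟩ := hrank
  obtain ⟨σ, s, -, hspan, hli⟩ := exists_linearIndependent' ℂ
    (fun ω i => PowerSeries.constantCoeff (a ω i))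
  have : Finite σ := hli.finite
  have : Fintype σ := Fintype.ofFinite σ
  let M : Matrix σ τ OO := Matrix.of fun j => a (s j)
  let M₀ : Matrix σ τ ℂ := M.map PowerSeries.constantCoeff
  have hM₀ : LinearIndependent ℂ M₀.row := hli
  obtain ⟨B, hB⟩ := exists_right_inverse_of_linearIndependent hM₀
  -- The product of `M` with the constant matrix `B` is `1` modulo `z`, hence invertible over `𝒪`.
  obtain ⟨C', hC'⟩ := exists_unit_inverse (C := M * bmap OO B) (by
    have h1 : (M * bmap OO B).map PowerSeries.constantCoeff = M₀ * B := by
      rw [Matrix.map_mul]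
      congr 1
    rw [h1, hB]
    exact isUnit_one)
  choose f hf using hv
  replace hf : ∀ ω, incl (f ω) = ∑ i, incl (a ω i) * v i := hf
  have hMB : M * (bmap OO B * C') = 1 := by rw [← Matrix.mul_assoc, hC']
  let v' : τ → OO := (bmap OO B * C').mulVec fun j => f (s j)
  have hv' : ∀ j, ∑ i, incl (a (s j) i) * incl (v' i) = ∑ i, incl (a (s j) i) * v i := by
    intro j
    have h1 : M.mulVec v' = fun j => f (s j) := by
      rw [Matrix.mulVec_mulVec, hMB, Matrix.one_mulVec]
    have h2 := congrArg incl (congrFun h1 j)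
    rw [hf] at h2
    rw [← h2]
    simp [M, Matrix.mulVec, dotProduct]
  let MK : Matrix σ τ KK := M.map incl
  have hMK : MK * (bmap OO B * C').map incl = 1 := by
    have := congrArg (fun X : Matrix σ σ OO => X.map (incl : OO →+* KK)) hMB
    simp only [Matrix.map_mul, Matrix.map_one _ (map_zero _) (map_one _)] at this
    rw [← this]
    exact congrArg _ (Matrix.map_mul (f := (incl : OO →+* KK)))
  have hker0 : Module.finrank ℂ (LinearMap.ker M₀.mulVecLin) ≤ Fintype.card κ := by
    refine hV _ fun x hx ω => ?_
    have h1 : (fun i => PowerSeries.constantCoeff (a ω i)) ∈ Submodule.span ℂ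
        (Set.range ((fun ω i => PowerSeries.constantCoeff (a ω i)) ∘ s)) := by
      rw [hspan]
      exact Submodule.subset_span ⟨ω, rfl⟩
    have h2 : ∀ c ∈ Submodule.span ℂ
        (Set.range ((fun ω i => PowerSeries.constantCoeff (a ω i)) ∘ s)),
        ∑ i, c i * x i = 0 := by
      intro c hc
      induction hc using Submodule.span_induction with
      | mem c hc =>
        obtain ⟨j, rfl⟩ := hc
        exact congrFun (LinearMap.mem_ker.mp hx) j
      | zero => simp
      | add c d _ _ hc hd => simp [add_mul, Finset.sum_add_distrib, hc, hd]
      | smul b c _ hc => simp [mul_assoc, ← Finset.mul_sum, hc]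
    exact h2 _ h1
  -- The chosen equations have the same number of independent solutions over `𝒦` as at `z = 0`, at
  -- most the number of the `w k`. So the `w k` span these solutions, and each solution of the
  -- chosen equations satisfies every equation.
  have hspanw : Submodule.span KK (Set.range w) = LinearMap.ker MK.mulVecLin := by
    apply Submodule.eq_of_le_of_finrank_le
    · rw [Submodule.span_le]
      rintro _ ⟨k, rfl⟩
      rw [SetLike.mem_coe, LinearMap.mem_ker]
      funext j
      exact hwa k (s j)
    · rw [finrank_span_eq_card hw]
      have h1 := finrank_ker_of_right_inverse hMK
      have h2 := finrank_ker_of_right_inverse hB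
      omega
  have hdiff : (fun i => v i - incl (v' i)) ∈ Submodule.span KK (Set.range w) := by
    rw [hspanw, LinearMap.mem_ker]
    funext j
    have := hv' j
    simp only [Matrix.mulVecLin_apply, Matrix.mulVec, dotProduct, mul_sub,
      Finset.sum_sub_distrib, MK, M, Matrix.map_apply, Matrix.of_apply]
    rw [this, sub_self]
    rfl
  refine ⟨v', fun ω => ?_⟩
  have h3 : ∀ c ∈ Submodule.span KK (Set.range w), ∑ i, incl (a ω i) * c i = 0 := by
    intro c hc
    induction hc using Submodule.span_induction with
    | mem c hc =>
      obtain ⟨k, rfl⟩ := hc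
      exact hwa k ω
    | zero => simp
    | add c d _ _ hc hd => simp [mul_add, Finset.sum_add_distrib, hc, hd]
    | smul b c _ hc => simp [mul_left_comm _ b, ← Finset.mul_sum, hc]
  have h4 := h3 _ hdiff
  simp only [mul_sub, Finset.sum_sub_distrib] at h4
  exact (sub_eq_zero.mp h4).symm

/-! ### Factorization through `GL_r(𝒪)` and `G(𝒦)` -/

section Factor

variable {R S : Type*} [CommRing R] [CommRing S] {r : ℕ}

theorem map_mulVec {m n : Type*} [Fintype n] (φ : R →+* S) (M : Matrix m n R) (v : n → R) (i : m) :
    φ (M.mulVec v i) = (M.map φ).mulVec (fun j => φ (v j)) i := by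
  simp [Matrix.mulVec, dotProduct]

theorem lieCoeff_map {D : ℕ} (φ : R →+* S) (y : (Fin D → Idx r) → R) (I : Fin D → Idx r)
    (p : Fin r × Fin r) : φ (lieCoeff y I p) = lieCoeff (fun J => φ (y J)) I p := by
  rw [lieCoeff, lieCoeff, map_mulVec, tder_map, lieBlk_map]
  congr 4
  exact Matrix.map_single _ _ _ φ |>.trans (by rw [map_one])

theorem linearIndependent_bmap {κ τ : Type*} [Fintype κ] [Fintype τ] {v : κ → τ → ℂ}
    (hv : LinearIndependent ℂ v) :
    LinearIndependent KK fun k i => algebraMap ℂ KK (v k i) := by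
  classical
  obtain ⟨B, hB⟩ := exists_right_inverse_of_linearIndependent (M := Matrix.of v) hv
  have h1 : bmap KK (Matrix.of v) * bmap KK B = 1 := by
    rw [← bmap_mul (R := KK), hB]
    simp [bmap]
  refine (Matrix.vecMul_injective_iff (M := bmap KK (Matrix.of v))).mp fun x x' hx => ?_
  have h2 := congrArg (fun u => Matrix.vecMul u (bmap KK B)) hx
  simpa [Matrix.vecMul_vecMul, h1] using h2

/-- Conjugation-like linear maps on matrices, in coordinates. -/
def sandwich (P Q : Matrix (Fin r) (Fin r) R) : (Fin r × Fin r → R) →ₗ[R] (Fin r × Fin r → R) where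
  toFun x p := (P * (Matrix.of fun i j => x (i, j)) * Q) p.1 p.2
  map_add' x y := by
    funext p
    have : (Matrix.of fun i j => (x + y) (i, j)) =
      (Matrix.of fun i j => x (i, j)) + Matrix.of fun i j => y (i, j) := rfl
    rw [this, mul_add, add_mul]
    rfl
  map_smul' a x := by
    funext p
    have : (Matrix.of fun i j => (a • x) (i, j)) = a • Matrix.of fun i j => x (i, j) := rfl
    rw [this, Matrix.mul_smul, Matrix.smul_mul]
    rfl

theorem sandwich_injective {P Q P' Q' : Matrix (Fin r) (Fin r) R} (hP : P' * P = 1)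
    (hQ : Q * Q' = 1) : Function.Injective (sandwich P Q) := by
  refine Function.LeftInverse.injective (g := sandwich P' Q') fun x => ?_
  funext p
  change (P' * (P * (Matrix.of fun i j => x (i, j)) * Q) * Q') p.1 p.2 = _
  have : P' * (P * (Matrix.of fun i j => x (i, j)) * Q) * Q' =
      (P' * P) * (Matrix.of fun i j => x (i, j)) * (Q * Q') := by simp only [mul_assoc]
  rw [this, hP, hQ, one_mul, mul_one]
  rfl

variable {A : Type*} [CommRing A] [HopfAlgebra ℂ A]

/-- A matrix over `𝒦` at which all invariants of `G` are regular belongs to `GL_r(𝒪) G(𝒦)`. -/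
theorem exists_factorization [Algebra.FiniteType ℂ A] [IsReduced A] (hG : IsReductive A)
    {ρ : Rep A r} (hρ : ρ.IsClosedEmbedding) {N N' : Matrix (Fin r) (Fin r) KK} (hN : N * N' = 1)
    (H : ∀ (D : ℕ) (t : (Fin D → Idx r) → ℂ), IsInvTensor ρ t → ∀ I,
      (tpow D (blk N N')).mulVec (fun J => algebraMap ℂ KK (t J)) I ∈ intK) :
    ∃ (g : Points A KK) (h h' : Matrix (Fin r) (Fin r) OO), h * h' = 1 ∧
      N = h.map incl * ρ.mat g := by
  have hN' : N' * N = 1 := mul_eq_one_comm.mp hN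
  obtain ⟨h₀, h₀', hh₀, hred⟩ := exists_reduction hG ρ hN H
  have hh₀' : h₀' * h₀ = 1 := mul_eq_one_comm.mp hh₀
  let Ω : Type := Σ D : ℕ, {t : (Fin D → Idx r) → ℂ // IsInvTensor ρ t} × (Fin D → Idx r)
  have hy' : ∀ (D : ℕ) (t : {t : (Fin D → Idx r) → ℂ // IsInvTensor ρ t}),
      ∃ y : (Fin D → Idx r) → OO, (fun I => incl (y I)) =
        (tpow D (blk N N')).mulVec (fun J => algebraMap ℂ KK (t.1 J)) := by
    intro D t
    choose y hy using fun I => H D t.1 t.2 I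
    exact ⟨y, funext hy⟩
  choose y hy using hy'
  have hy0 : ∀ D t, (fun I => PowerSeries.constantCoeff (y D t I)) =
      (tpow D (blk h₀ h₀')).mulVec t.1 := by
    intro D t
    funext I
    rw [constantCoeff_eq_coeffK, ← hred D t.1 t.2 I, ← hy D t]
  let a : Ω → Fin r × Fin r → OO := fun ω => lieCoeff (y ω.1 ω.2.1) ω.2.2
  have hinclmap : ∀ ω p, incl (a ω p) = lieCoeff (fun I => incl (y ω.1 ω.2.1 I)) ω.2.2 p :=
    fun ω p => lieCoeff_map (incl : OO →+* KK) _ _ _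
  have ha : ∀ (ω : Ω) (ξ : Matrix (Fin r) (Fin r) KK), ∑ p, incl (a ω p) * ξ p.1 p.2 =
      (tder ω.1 (lieBlk ξ)).mulVec ((tpow ω.1 (blk N N')).mulVec
        (fun J => algebraMap ℂ KK (ω.2.1.1 J))) ω.2.2 := by
    intro ω ξ
    rw [← hy, tder_lieBlk_mulVec]
    simp only [hinclmap]
  have ha0 : ∀ (ω : Ω) (ξ : Matrix (Fin r) (Fin r) ℂ),
      ∑ p, PowerSeries.constantCoeff (a ω p) * ξ p.1 p.2 =
      (tder ω.1 (lieBlk ξ)).mulVec ((tpow ω.1 (blk h₀ h₀')).mulVec ω.2.1.1) ω.2.2 := by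
    intro ω ξ
    rw [← hy0, tder_lieBlk_mulVec]
    refine Finset.sum_congr rfl fun p _ => ?_
    congr 1
    exact lieCoeff_map (PowerSeries.constantCoeff : OO →+* ℂ) _ _ _
  -- The logarithmic derivative of `N`. It may have poles, but its action on the integral tensors `y
  -- = N t` is `y'`, which is integral.
  let ξ : Matrix (Fin r) (Fin r) KK := N.map derK * N'
  have hξ : N.map derK = ξ * N := by rw [mul_assoc, hN', mul_one]
  have hderK : ∀ ω : Ω, ∑ p, incl (a ω p) * ξ p.1 p.2 = incl (derO (y ω.1 ω.2.1 ω.2.2)) := by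
    intro ω
    rw [ha, ← derivation_tpow_mulVec derK ω.1 hN hξ, ← hy, derK_incl]
  obtain ⟨x, hx⟩ := exists_integral_solution a (by
    -- The solutions at `z = 0` are the matrices annihilating all tensors `h₀ t`. Conjugation by `N
    -- h₀⁻¹` takes them to matrices over `𝒦` annihilating all `N t`, and it preserves linear
    -- independence.
    let V₀ : Submodule ℂ (Fin r × Fin r → ℂ) :=
      ⨅ ω : Ω, LinearMap.ker (Fintype.linearCombination ℂ
        (fun p => PowerSeries.constantCoeff (a ω p)))
    have hV₀ : ∀ v, v ∈ V₀ ↔ ∀ ω, ∑ p, PowerSeries.constantCoeff (a ω p) * v p = 0 := by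
      intro v
      simp only [V₀, Submodule.mem_iInf, LinearMap.mem_ker, Fintype.linearCombination_apply,
        smul_eq_mul, mul_comm]
    let b := Module.finBasis ℂ V₀
    have hb : LinearIndependent ℂ fun k => (b k : Fin r × Fin r → ℂ) :=
      b.linearIndependent.map' V₀.subtype V₀.ker_subtype
    have hinj : Function.Injective (sandwich (N * bmap KK h₀') (bmap KK h₀ * N')) := by
      refine sandwich_injective (P' := bmap KK h₀ * N') (Q' := N * bmap KK h₀') ?_ ?_
      · rw [mul_assoc, ← mul_assoc N', hN', one_mul, ← bmap_mul (R := KK), hh₀]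
        simp [bmap]
      · rw [mul_assoc, ← mul_assoc N', hN', one_mul, ← bmap_mul (R := KK), hh₀]
        simp [bmap]
    refine ⟨_, inferInstance, fun k => sandwich (N * bmap KK h₀') (bmap KK h₀ * N')
      fun p => algebraMap ℂ KK ((b k : Fin r × Fin r → ℂ) p), ?_, ?_, ?_⟩
    · exact (linearIndependent_bmap hb).map' _ (LinearMap.ker_eq_bot.mpr hinj)
    · intro k ω
      obtain ⟨D, t, I⟩ := ω
      let ζ : Matrix (Fin r) (Fin r) ℂ := Matrix.of fun i j => (b k : Fin r × Fin r → ℂ) (i, j)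
      have h1 : ∀ I, (tder D (lieBlk ζ)).mulVec ((tpow D (blk h₀ h₀')).mulVec t.1) I = 0 := by
        intro I
        rw [← ha0 ⟨D, t, I⟩ ζ]
        exact (hV₀ _).mp (b k).2 ⟨D, t, I⟩
      have h2 : (tder D (lieBlk (h₀' * ζ * h₀))).mulVec t.1 = 0 := by
        have h3 := tpow_mul_tder_lieBlk D hh₀ ζ
        have h4 : tpow D (blk h₀' h₀) * tpow D (blk h₀ h₀') = 1 := by
          rw [← tpow_mul, blk_mul_blk_inv hh₀', tpow_one]
        calc _ = (tder D (lieBlk (h₀' * ζ * h₀)) * tpow D (blk h₀' h₀)).mulVec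
              ((tpow D (blk h₀ h₀')).mulVec t.1) := by
              rw [Matrix.mulVec_mulVec, mul_assoc (tder D _), h4, mul_one]
          _ = 0 := by
              rw [← h3, ← Matrix.mulVec_mulVec, funext h1]
              exact Matrix.mulVec_zero _
      have h5 : (sandwich (N * bmap KK h₀') (bmap KK h₀ * N')
          fun p => algebraMap ℂ KK ((b k : Fin r × Fin r → ℂ) p)) =
          fun p => (N * bmap KK (h₀' * ζ * h₀) * N') p.1 p.2 := by
        funext p
        rw [bmap_mul, bmap_mul]
        change (N * bmap KK h₀' * bmap KK ζ * (bmap KK h₀ * N')) p.1 p.2 = _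
        simp only [mul_assoc]
      beta_reduce
      rw [h5, ha, Matrix.mulVec_mulVec, ← tpow_mul_tder_lieBlk D hN', ← Matrix.mulVec_mulVec]
      have h6 : tder D (lieBlk (bmap KK (h₀' * ζ * h₀))) =
          bmap KK (tder D (lieBlk (h₀' * ζ * h₀))) := by
        refine Eq.symm ((tder_map D _ (algebraMap ℂ KK)).trans ?_)
        rw [lieBlk_map]
      rw [h6, bmap_mulVec, h2]
      have h7 : (fun _ : Fin D → Idx r => algebraMap ℂ KK ((0 : (Fin D → Idx r) → ℂ) I)) = 0 := by
        funext _
        simp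
      simp only [Pi.zero_apply, map_zero]
      exact congrFun (Matrix.mulVec_zero _) I
    · intro V hV
      rw [Fintype.card_fin]
      exact Submodule.finrank_mono fun v hv => (hV₀ v).mpr (hV v hv))
    (fun p => ξ p.1 p.2) (fun ω => by rw [hderK]; exact incl_mem_intK _)
  let ξ' : Matrix (Fin r) (Fin r) OO := Matrix.of fun i j => x (i, j)
  obtain ⟨h, hh, hh0⟩ := exists_ode_solution ξ' h₀
  obtain ⟨h', hhh'⟩ := exists_unit_inverse (C := h) (by
    rw [hh0]
    exact IsUnit.of_mul_eq_one _ hh₀)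
  have hh'h : h' * h = 1 := mul_eq_one_comm.mp hhh'
  have hh0' : h'.map PowerSeries.constantCoeff = h₀' := by
    have h1 := congrArg (fun X : Matrix (Fin r) (Fin r) OO => X.map PowerSeries.constantCoeff) hh'h
    simp only [Matrix.map_mul, hh0, Matrix.map_one _ (map_zero _) (map_one _)] at h1
    calc _ = h'.map PowerSeries.constantCoeff * (h₀ * h₀') := by rw [hh₀, mul_one]
      _ = h₀' := by rw [← mul_assoc, h1, one_mul]
  -- Both sides solve the linear system given by `ξ'`, with the same initial value `h₀ t`.
  have hyy : ∀ D t, y D t = (tpow D (blk h h')).mulVec (fun J => algebraMap ℂ OO (t.1 J)) := by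
    intro D t
    refine ode_unique (tder D (lieBlk ξ')) (fun I => ?_) (fun I => ?_) (fun I => ?_)
    · apply incl_injective
      rw [← hderK ⟨D, t, I⟩, ← hx, tder_lieBlk_mulVec, map_sum]
      refine Finset.sum_congr rfl fun p _ => ?_
      rw [map_mul]
      rfl
    · exact derivation_tpow_mulVec derO D hhh' hh t.1 I
    · rw [map_mulVec, tpow_map, blk_map, hh0, hh0']
      refine (congrFun (hy0 D t) I).trans ?_
      congr 2
  -- Since `N` and `h` have the same effect on invariant tensors, `h⁻¹ N` fixes them.
  have hfix : ∀ (D : ℕ) (t : (Fin D → Idx r) → ℂ), IsInvTensor ρ t →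
      (tpow D (blk (h'.map incl * N) (N' * h.map incl))).mulVec
        (fun J => algebraMap ℂ KK (t J)) = fun J => algebraMap ℂ KK (t J) := by
    intro D t ht
    rw [← blk_mul, tpow_mul, ← Matrix.mulVec_mulVec, ← hy D ⟨t, ht⟩, hyy D ⟨t, ht⟩]
    have h1 : blk (h'.map incl) (h.map incl) = (blk h' h).map incl :=
      (blk_map h' h (incl : OO →+* KK)).symm
    have h2 : tpow D ((blk h' h).map incl) = (tpow D (blk h' h)).map incl :=
      (tpow_map D _ (incl : OO →+* KK)).symm
    funext I
    rw [h1, h2]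
    refine (map_mulVec (incl : OO →+* KK) (tpow D (blk h' h)) _ I).symm.trans ?_
    rw [Matrix.mulVec_mulVec, ← tpow_mul, blk_mul_blk_inv hh'h, tpow_one, Matrix.one_mulVec]
    exact incl.commutes _
  obtain ⟨g, hg⟩ := exists_point_of_fixes hG hρ hfix
  refine ⟨g, h, h', hhh', ?_⟩
  have h3 : h.map incl * h'.map incl = 1 := by
    refine (Matrix.map_mul (f := (incl : OO →+* KK))).symm.trans ?_
    rw [hhh']
    exact Matrix.map_one _ (map_zero _) (map_one _)
  rw [hg, ← mul_assoc, h3, one_mul]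

end Factor

/-! ### Zariski closed subsets of projective space in affine charts -/

section Chart

variable {ι : Type*}

/-- A condition on a vector that is given by polynomial equations. -/
def IsPolyCond (P : (ι → ℂ) → Prop) : Prop :=
  ∃ Q : Set (MvPolynomial ι ℂ), ∀ v, P v ↔ ∀ q ∈ Q, MvPolynomial.eval v q = 0

/-- A polynomial function. -/
def IsPolyFun (f : (ι → ℂ) → ℂ) : Prop :=
  ∃ p : MvPolynomial ι ℂ, ∀ v, f v = MvPolynomial.eval v p

theorem IsPolyFun.const (a : ℂ) : IsPolyFun fun _ : ι → ℂ => a :=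
  ⟨MvPolynomial.C a, fun v => by simp⟩

theorem IsPolyFun.coord (i : ι) : IsPolyFun fun v : ι → ℂ => v i :=
  ⟨MvPolynomial.X i, fun v => by simp⟩

theorem IsPolyFun.mul {f g : (ι → ℂ) → ℂ} (hf : IsPolyFun f) (hg : IsPolyFun g) :
    IsPolyFun fun v => f v * g v := by
  obtain ⟨p, hp⟩ := hf
  obtain ⟨q, hq⟩ := hg
  exact ⟨p * q, fun v => by simp [hp, hq]⟩

theorem IsPolyFun.sub {f g : (ι → ℂ) → ℂ} (hf : IsPolyFun f) (hg : IsPolyFun g) :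
    IsPolyFun fun v => f v - g v := by
  obtain ⟨p, hp⟩ := hf
  obtain ⟨q, hq⟩ := hg
  exact ⟨p - q, fun v => by simp [hp, hq]⟩

theorem IsPolyFun.sum {κ : Type*} {s : Finset κ} {f : κ → (ι → ℂ) → ℂ}
    (hf : ∀ k, IsPolyFun (f k)) : IsPolyFun fun v => ∑ k ∈ s, f k v := by
  choose p hp using hf
  exact ⟨∑ k ∈ s, p k, fun v => by simp [hp]⟩

theorem IsPolyFun.det {n : ℕ} {M : (ι → ℂ) → Matrix (Fin n) (Fin n) ℂ}
    (hM : ∀ i j, IsPolyFun fun v => M v i j) : IsPolyFun fun v => (M v).det := by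
  choose p hp using hM
  refine ⟨(Matrix.of p).det, fun v => ?_⟩
  rw [RingHom.map_det]
  refine congrArg Matrix.det ?_
  ext i j
  simp [hp]

theorem IsPolyCond.of_eq {f g : (ι → ℂ) → ℂ} (hf : IsPolyFun f) (hg : IsPolyFun g) :
    IsPolyCond fun v => f v = g v := by
  obtain ⟨p, hp⟩ := hf.sub hg
  exact ⟨{p}, fun v => by simp [← hp, sub_eq_zero]⟩

theorem IsPolyCond.forall {κ : Sort*} {P : κ → (ι → ℂ) → Prop} (h : ∀ k, IsPolyCond (P k)) :
    IsPolyCond fun v => ∀ k, P k v := by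
  choose Q hQ using h
  refine ⟨⋃ k, Q k, fun v => ?_⟩
  simp only [hQ, Set.mem_iUnion]
  exact ⟨fun h q ⟨k, hk⟩ => h k q hk, fun h k q hq => h q ⟨k, hq⟩⟩

theorem IsPolyCond.and {P P' : (ι → ℂ) → Prop} (h : IsPolyCond P) (h' : IsPolyCond P') :
    IsPolyCond fun v => P v ∧ P' v := by
  obtain ⟨Q, hQ⟩ := h
  obtain ⟨Q', hQ'⟩ := h'
  refine ⟨Q ∪ Q', fun v => ?_⟩
  simp only [hQ, hQ', Set.mem_union]
  exact ⟨fun h q hq => hq.elim (h.1 q) (h.2 q),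
    fun h => ⟨fun q hq => h q (.inl hq), fun q hq => h q (.inr hq)⟩⟩

theorem IsHomogeneous.eval_smul [Fintype ι] {p : MvPolynomial ι ℂ} {n : ℕ} (hp : p.IsHomogeneous n)
    (a : ℂ) (v : ι → ℂ) : MvPolynomial.eval (a • v) p = a ^ n * MvPolynomial.eval v p := by
  rw [MvPolynomial.eval_eq', MvPolynomial.eval_eq', Finset.mul_sum]
  refine Finset.sum_congr rfl fun d hd => ?_
  have h1 : ∑ i, d i = n := by
    have := hp (MvPolynomial.mem_support_iff.mp hd)
    rw [← this, Finsupp.weight_apply, Finsupp.sum_fintype _ _ (by simp)]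
    simp
  simp only [Pi.smul_apply, smul_eq_mul, mul_pow, Finset.prod_mul_distrib, Finset.prod_pow_eq_pow_sum,
    h1]
  ring

theorem exists_homogenization [Fintype ι] (q : MvPolynomial ι ℂ) (i : ι) :
    ∃ (n : ℕ) (p : MvPolynomial ι ℂ), p.IsHomogeneous n ∧
      (∀ v : ι → ℂ, v i = 0 → MvPolynomial.eval v p = 0) ∧
      ∀ v : ι → ℂ, v i = 1 → MvPolynomial.eval v p = MvPolynomial.eval v q := by
  -- One degree more than necessary, so that every term contains the `i`-th variable and the result
  -- vanishes outside the chart.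
  refine ⟨q.totalDegree + 1, ∑ k ∈ Finset.range (q.totalDegree + 1),
    q.homogeneousComponent k * MvPolynomial.X i ^ (q.totalDegree + 1 - k), ?_, ?_, ?_⟩
  · refine MvPolynomial.IsHomogeneous.sum _ _ _ fun k hk => ?_
    have := (MvPolynomial.homogeneousComponent_isHomogeneous k q).mul
      ((MvPolynomial.isHomogeneous_X ℂ i).pow (q.totalDegree + 1 - k))
    convert this using 1
    have := Finset.mem_range.mp hk
    omega
  · intro v hv
    rw [map_sum]
    refine Finset.sum_eq_zero fun k hk => ?_
    have : q.totalDegree + 1 - k ≠ 0 := by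
      have := Finset.mem_range.mp hk
      omega
    simp [hv, this]
  · intro v hv
    conv_rhs => rw [← MvPolynomial.sum_homogeneousComponent q]
    simp [hv]

/-- A subset of projective space is closed if it is given by polynomial equations in each of the
standard affine charts. -/
theorem isClosed_of_charts [Fintype ι] (C : Set (ℙ ℂ (ι → ℂ)))
    (h : ∀ i, ∃ P : (ι → ℂ) → Prop, IsPolyCond P ∧
      ∀ (v : ι → ℂ) (hv : v ≠ 0), v i = 1 → (Projectivization.mk ℂ v hv ∈ C ↔ P v)) :
    @IsClosed _ (zariski ι) C := by
  let _ := zariski ι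
  rw [← isOpen_compl_iff, isOpen_iff_forall_mem_open]
  intro x hx
  obtain ⟨i, hi⟩ := Function.ne_iff.mp x.rep_nonzero
  replace hi : x.rep i ≠ 0 := hi
  obtain ⟨P, ⟨Q, hQ⟩, hP⟩ := h i
  have norm : ∀ y : ℙ ℂ (ι → ℂ), y.rep i ≠ 0 →
      (y ∈ C ↔ P ((y.rep i)⁻¹ • y.rep)) := by
    intro y hy
    have h0 : (y.rep i)⁻¹ • y.rep ≠ 0 := smul_ne_zero (inv_ne_zero hy) y.rep_nonzero
    rw [← hP _ h0 (by simp [hy])]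
    have : Projectivization.mk ℂ ((y.rep i)⁻¹ • y.rep) h0 = y := by
      conv_rhs => rw [← y.mk_rep]
      exact (Projectivization.mk_eq_mk_iff' ℂ _ _ h0 y.rep_nonzero).mpr ⟨_, rfl⟩
    rw [this]
  have hx' : ¬ P ((x.rep i)⁻¹ • x.rep) := fun hP' => hx ((norm x hi).mpr hP')
  rw [hQ] at hx'
  push Not at hx'
  obtain ⟨q, hq, hqx⟩ := hx'
  obtain ⟨n, p, hp, hp0, hp1⟩ := exists_homogenization q i
  have hev : ∀ y : ℙ ℂ (ι → ℂ), y.rep i ≠ 0 → (MvPolynomial.eval y.rep p ≠ 0 ↔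
      MvPolynomial.eval ((y.rep i)⁻¹ • y.rep) q ≠ 0) := by
    intro y hy
    rw [← hp1 _ (by simp [hy]), IsHomogeneous.eval_smul hp]
    simp [hy]
  -- The set where the homogenized equation `p` is nonzero lies in the `i`-th chart, where it avoids
  -- `C`.
  refine ⟨{y | MvPolynomial.eval y.rep p ≠ 0}, fun y hy hyC => ?_,
    TopologicalSpace.isOpen_generateFrom_of_mem ⟨n, p, hp, rfl⟩, (hev x hi).mpr hqx⟩
  have hyi : y.rep i ≠ 0 := fun h0 => hy (hp0 _ h0)
  exact (hev y hyi).mp hy ((hQ _).mp ((norm y hyi).mp hyC) q hq)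

end Chart

/-! ### Plücker coordinates -/

section Pl

variable {ι : Type*} {d : ℕ}

theorem minors_mul (P : Matrix (Fin d) (Fin d) ℂ) (b : Fin d → ι → ℂ) :
    minors (fun s j => ∑ t, P s t * b t j) = P.det • minors b := by
  funext I
  rw [Pi.smul_apply, smul_eq_mul, minors, minors, ← Matrix.det_mul]
  rfl

theorem minors_mem_span {W : Submodule ℂ (ι → ℂ)} {b b' : Fin d → ι → ℂ}
    (hb : Submodule.span ℂ (Set.range b) = W) (hb' : ∀ s, b' s ∈ W) :
    ∃ a : ℂ, minors b' = a • minors b := by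
  have : ∀ s, ∃ c : Fin d → ℂ, ∑ t, c t • b t = b' s := fun s => by
    have := hb' s
    rwa [← hb, Submodule.mem_span_range_iff_exists_fun] at this
  choose P hP using this
  refine ⟨(Matrix.of P).det, ?_⟩
  rw [← minors_mul]
  congr 1
  funext s j
  rw [← hP s]
  simp

theorem pluckerPoint_eq_mk [Fintype ι] {W : Submodule ℂ (ι → ℂ)} (hW : Module.finrank ℂ W = d)
    {b : Fin d → ι → ℂ} (hb : LinearIndependent ℂ b) (hbW : Submodule.span ℂ (Set.range b) = W) :
    pluckerPoint W hW = Projectivization.mk ℂ (minors b) (minors_ne_zero hb) := by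
  obtain ⟨a, ha⟩ := minors_mem_span hbW
    (fun s => ((Module.finBasisOfFinrankEq ℂ W hW s : W)).2)
  exact (Projectivization.mk_eq_mk_iff' ℂ _ _ _ _).mpr ⟨a, ha.symm⟩

/-- The vectors that are read off from Plücker coordinates in a standard chart. -/
def chartBasis (I : Fin d → ι) (v : (Fin d → ι) → ℂ) (s : Fin d) (j : ι) : ℂ :=
  v (Function.update I s j)

/-- Replacing one column of an identity matrix by another column and taking the determinant picks
out one entry of that column (Cramer). -/
theorem minors_update {I : Fin d → ι} {b : Fin d → ι → ℂ}
    (hb : ∀ s t, b s (I t) = (1 : Matrix (Fin d) (Fin d) ℂ) s t) (s : Fin d) (j : ι) :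
    minors b (Function.update I s j) = b s j := by
  have h1 : (Matrix.of fun s' t => b s' (Function.update I s j t)) =
      (1 : Matrix (Fin d) (Fin d) ℂ).updateCol s fun s' => b s' j := by
    ext s' t
    rcases eq_or_ne t s with rfl | ht
    · simp
    · simp [Function.update_of_ne ht, Matrix.updateCol_ne ht, hb]
  rw [minors, h1, ← Matrix.cramer_apply, Matrix.cramer_one]
  rfl

theorem chartBasis_minors {I : Fin d → ι} {b : Fin d → ι → ℂ}
    (hb : ∀ s t, b s (I t) = (1 : Matrix (Fin d) (Fin d) ℂ) s t) : chartBasis I (minors b) = b := by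
  funext s j
  exact minors_update hb s j

theorem linearIndependent_of_chart {I : Fin d → ι} {b : Fin d → ι → ℂ}
    (hb : ∀ s t, b s (I t) = (1 : Matrix (Fin d) (Fin d) ℂ) s t) : LinearIndependent ℂ b := by
  rw [Fintype.linearIndependent_iff]
  intro c hc t
  have := congrFun hc (I t)
  simpa [hb, Matrix.one_apply] using this

/-- Multiplying any basis of `W` by the inverse of its block of columns `I` makes this block the
identity; the remaining entries of the new basis are then Plücker coordinates. -/
theorem exists_chart_basis [Fintype ι] {W : Submodule ℂ (ι → ℂ)} (hW : Module.finrank ℂ W = d)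
    {v : (Fin d → ι) → ℂ} (hv : v ≠ 0) (hWv : pluckerPoint W hW = Projectivization.mk ℂ v hv)
    {I : Fin d → ι} (hI : v I = 1) :
    (∀ s t, chartBasis I v s (I t) = (1 : Matrix (Fin d) (Fin d) ℂ) s t) ∧
      Submodule.span ℂ (Set.range (chartBasis I v)) = W ∧ minors (chartBasis I v) = v := by
  let B : Fin d → ι → ℂ := fun s => ((Module.finBasisOfFinrankEq ℂ W hW s : W) : ι → ℂ)
  obtain ⟨a, ha⟩ := (Projectivization.mk_eq_mk_iff' ℂ _ _ _ _).mp hWv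
  replace ha : a • v = minors B := ha
  let P : Matrix (Fin d) (Fin d) ℂ := Matrix.of fun s t => B s (I t)
  have hP : P.det = a := by
    have := congrFun ha I
    rw [Pi.smul_apply, hI, smul_eq_mul, mul_one] at this
    exact this.symm
  have ha0 : a ≠ 0 := by
    rintro rfl
    rw [zero_smul] at ha
    have hB : LinearIndependent ℂ B := LinearIndependent.map'
      (Module.finBasisOfFinrankEq ℂ W hW).linearIndependent W.subtype W.ker_subtype
    exact minors_ne_zero hB ha.symm
  have hPu : IsUnit P.det := by rw [hP]; exact ha0.isUnit
  let b : Fin d → ι → ℂ := fun s j => ∑ t, P⁻¹ s t * B t j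
  have hb : ∀ s t, b s (I t) = (1 : Matrix (Fin d) (Fin d) ℂ) s t := by
    intro s t
    rw [← Matrix.nonsing_inv_mul P hPu]
    rfl
  have hbv : minors b = v := by
    rw [minors_mul, Matrix.det_nonsing_inv, hP, ← ha, smul_smul, Ring.inverse_eq_inv',
      inv_mul_cancel₀ ha0, one_smul]
  have hcb : chartBasis I v = b := by rw [← hbv, chartBasis_minors hb]
  refine ⟨by rwa [hcb], ?_, by rw [hcb, hbv]⟩
  rw [hcb]
  apply Submodule.eq_of_le_of_finrank_le
  · rw [Submodule.span_le]
    rintro _ ⟨s, rfl⟩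
    have : b s = ∑ t, P⁻¹ s t • B t := by
      funext j
      simp [b]
    rw [this]
    exact Submodule.sum_mem _ fun t _ => Submodule.smul_mem _ _ (Subtype.mem _)
  · rw [finrank_span_eq_card (linearIndependent_of_chart hb), Fintype.card_fin, hW]

/-- A subspace is recovered as the span of the chart basis read off from its Plücker vector. -/
theorem pluckerPoint_injective [Fintype ι] {W W' : Submodule ℂ (ι → ℂ)} {hW : Module.finrank ℂ W = d}
    {hW' : Module.finrank ℂ W' = d} (h : pluckerPoint W hW = pluckerPoint W' hW') : W = W' := by
  obtain ⟨I, hI⟩ := Function.ne_iff.mp (pluckerPoint W hW).rep_nonzero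
  replace hI : (pluckerPoint W hW).rep I ≠ 0 := hI
  set x := pluckerPoint W hW with hx
  have h0 : (x.rep I)⁻¹ • x.rep ≠ 0 := smul_ne_zero (inv_ne_zero hI) x.rep_nonzero
  have hmk : Projectivization.mk ℂ ((x.rep I)⁻¹ • x.rep) h0 = x := by
    conv_rhs => rw [← x.mk_rep]
    exact (Projectivization.mk_eq_mk_iff' ℂ _ _ h0 x.rep_nonzero).mpr ⟨_, rfl⟩
  have h1 : ((x.rep I)⁻¹ • x.rep) I = 1 := by simp [hI]
  rw [← (exists_chart_basis hW h0 hmk.symm h1).2.1,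
    ← (exists_chart_basis hW' h0 (h ▸ hmk.symm) h1).2.1]

end Pl

/-! ### Powers of the uniformizer -/

/-- The element `zⁿ` of `𝒦`. -/
def zp (n : ℤ) : KK := (HahnSeries.single n (1 : ℂ) : LaurentSeries ℂ)

theorem zp_add (m n : ℤ) : zp (m + n) = zp m * zp n := by
  have := HahnSeries.single_mul_single (a := m) (b := n) (r := (1 : ℂ)) (s := 1)
  rw [mul_one] at this
  exact this.symm

theorem zp_zero : zp 0 = 1 := rfl

theorem zp_mul_zp_neg (n : ℤ) : zp n * zp (-n) = 1 := by
  rw [← zp_add, add_neg_cancel, zp_zero]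

theorem zp_neg_mul_zp (n : ℤ) : zp (-n) * zp n = 1 := by
  rw [← zp_add, neg_add_cancel, zp_zero]

theorem zp_ne_zero (n : ℤ) : zp n ≠ 0 := left_ne_zero_of_mul_eq_one (zp_mul_zp_neg n)

theorem coeffK_zp_mul (n j : ℤ) (x : KK) : coeffK j (zp n * x) = coeffK (j - n) x := by
  have := HahnSeries.coeff_single_mul_add (r := (1 : ℂ)) (x := (x : LaurentSeries ℂ))
    (a := j - n) (b := n)
  rw [one_mul, sub_add_cancel] at this
  exact this

theorem coeffK_zp (n j : ℤ) : coeffK j (zp n) = if j = n then 1 else 0 := by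
  rw [← mul_one (zp n), coeffK_zp_mul, ← map_one incl]
  rcases lt_or_ge (j - n) 0 with h | h
  · rw [coeffK_incl_neg _ h, if_neg (by omega)]
  · obtain ⟨m, hm⟩ := Int.eq_ofNat_of_zero_le h
    rw [hm, coeffK_incl, PowerSeries.coeff_one]
    by_cases h0 : m = 0
    · rw [if_pos h0, if_pos (by omega)]
    · rw [if_neg h0, if_neg (by omega)]

theorem incl_X_pow (n : ℕ) : incl (PowerSeries.X ^ n) = zp n := by
  refine coeffK_ext fun j => ?_
  rw [coeffK_zp]
  rcases lt_or_ge j 0 with h | h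
  · rw [coeffK_incl_neg _ h, if_neg (by omega)]
  · lift j to ℕ using h
    rw [coeffK_incl, PowerSeries.coeff_X_pow]
    norm_cast

theorem incl_X : incl PowerSeries.X = zp 1 := by
  have := incl_X_pow 1
  rwa [pow_one] at this

/-- The elements of `zⁿ 𝒪`. -/
theorem zp_mul_mem_intK {n : ℤ} {x : KK} : zp (-n) * x ∈ intK ↔ ∀ j < n, coeffK j x = 0 := by
  rw [mem_intK]
  constructor
  · intro h j hj
    have := h (j - n) (by omega)
    rwa [coeffK_zp_mul, sub_neg_eq_add, sub_add_cancel] at this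
  · intro h j hj
    rw [coeffK_zp_mul]
    exact h _ (by omega)

theorem mem_stdLattice {r : ℕ} {n : ℤ} {v : Fin r → KK} :
    v ∈ stdLattice r n ↔ ∀ i, zp (-n) * v i ∈ intK :=
  forall_congr' fun _ => zp_mul_mem_intK.symm

theorem mem_stdLattice_zero {r : ℕ} {v : Fin r → KK} :
    v ∈ stdLattice r 0 ↔ ∀ i, v i ∈ intK := by
  simp [mem_stdLattice, zp_zero]

theorem exists_zp_mul_mem_intK (x : KK) : ∃ n : ℕ, zp n * x ∈ intK := by
  obtain ⟨n, hn⟩ : ∃ (n : ℤ), ∀ j < n, coeffK j x = 0 :=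
    ⟨HahnSeries.order (x : LaurentSeries ℂ), fun j hj => HahnSeries.coeff_eq_zero_of_lt_order hj⟩
  refine ⟨(-n).toNat, ?_⟩
  have h := (zp_mul_mem_intK (n := -((-n).toNat : ℤ)) (x := x)).mpr fun j hj => hn j (by omega)
  rwa [neg_neg] at h

theorem zp_mem_intK {n : ℤ} (hn : 0 ≤ n) : zp n ∈ intK := by
  lift n to ℕ using hn
  rw [← incl_X_pow]
  exact incl_mem_intK _

theorem zp_mul_mem_intK_of_le {m n : ℤ} (h : m ≤ n) {x : KK} (hx : zp m * x ∈ intK) :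
    zp n * x ∈ intK := by
  have : zp n * x = zp (n - m) * (zp m * x) := by
    rw [← mul_assoc, ← zp_add, sub_add_cancel]
  rw [this]
  exact mul_mem (zp_mem_intK (by omega)) hx

theorem stdLattice_anti {r : ℕ} {m n : ℤ} (h : m ≤ n) : stdLattice r n ≤ stdLattice r m :=
  fun _ hv i j hj => hv i j (lt_of_lt_of_le hj h)

theorem incl_smul_mem_stdLattice {r : ℕ} {n : ℤ} (f : OO) {v : Fin r → KK}
    (hv : v ∈ stdLattice r n) : incl f • v ∈ stdLattice r n := by
  rw [mem_stdLattice] at hv ⊢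
  intro i
  rw [Pi.smul_apply, smul_eq_mul, mul_left_comm]
  exact mul_mem (incl_mem_intK f) (hv i)

/-! ### Windows -/

section Window

variable {r k : ℕ}

theorem window_apply (v : Fin r → KK) (p : Fin r × Fin (2 * k)) :
    window r k v p = coeffK ((p.2 : ℤ) - k) (v p.1) := rfl

/-- The Laurent polynomial vector with given window. -/
def unwindow (r k : ℕ) (w : Fin r × Fin (2 * k) → ℂ) : Fin r → KK :=
  fun i => ∑ e : Fin (2 * k), algebraMap ℂ KK (w (i, e)) * zp ((e : ℤ) - k)

theorem coeffK_algebraMap_mul (a : ℂ) (x : KK) (j : ℤ) :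
    coeffK j (algebraMap ℂ KK a * x) = a * coeffK j x := by
  rw [← Algebra.smul_def, map_smul, smul_eq_mul]

theorem coeffK_unwindow (w : Fin r × Fin (2 * k) → ℂ) (i : Fin r) (j : ℤ) :
    coeffK j (unwindow r k w i) =
      ∑ e : Fin (2 * k), if j = (e : ℤ) - k then w (i, e) else 0 := by
  simp [unwindow, map_sum, coeffK_algebraMap_mul, coeffK_zp]

theorem window_unwindow (w : Fin r × Fin (2 * k) → ℂ) : window r k (unwindow r k w) = w := by
  funext p
  rw [window_apply, coeffK_unwindow, Finset.sum_eq_single p.2]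
  · simp
  · intro e _ he
    rw [if_neg]
    intro h
    apply he
    ext
    omega
  · simp

theorem unwindow_mem (w : Fin r × Fin (2 * k) → ℂ) : unwindow r k w ∈ stdLattice r (-k) := by
  intro i j hj
  rw [coeffK_unwindow]
  refine Finset.sum_eq_zero fun e _ => if_neg ?_
  omega

theorem mem_stdLattice_of_window_eq_zero {v : Fin r → KK} (hv : v ∈ stdLattice r (-k))
    (h : window r k v = 0) : v ∈ stdLattice r k := by
  intro i j hj
  by_cases hj' : j < -k
  · exact hv i j hj'
  · have := congrFun h (i, ⟨(j + k).toNat, by omega⟩)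
    rw [window_apply] at this
    simp only [Pi.zero_apply] at this
    rwa [Int.toNat_of_nonneg (by omega), add_sub_cancel_right] at this

theorem window_eq_zero {v : Fin r → KK} (hv : v ∈ stdLattice r k) : window r k v = 0 := by
  funext p
  exact hv p.1 _ (by have := p.2.2; omega)

/-- The subspaces of `𝒦^r` between `z⁻ᵏ 𝒪^r` and `zᵏ 𝒪^r` with given window. -/
def ofWindow (r k : ℕ) (W : Submodule ℂ (Fin r × Fin (2 * k) → ℂ)) : Submodule ℂ (Fin r → KK) :=
  stdLattice r (-k) ⊓ W.comap (window r k)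

theorem stdLattice_le_ofWindow (W : Submodule ℂ (Fin r × Fin (2 * k) → ℂ)) :
    stdLattice r k ≤ ofWindow r k W := fun v hv =>
  ⟨stdLattice_anti (by omega) hv, by
    rw [SetLike.mem_coe, Submodule.mem_comap, window_eq_zero hv]
    exact W.zero_mem⟩

theorem ofWindow_le (W : Submodule ℂ (Fin r × Fin (2 * k) → ℂ)) :
    ofWindow r k W ≤ stdLattice r (-k) := inf_le_left

theorem map_window_ofWindow (W : Submodule ℂ (Fin r × Fin (2 * k) → ℂ)) :
    (ofWindow r k W).map (window r k) = W := by
  apply le_antisymm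
  · rintro _ ⟨v, hv, rfl⟩
    exact hv.2
  · intro w hw
    refine ⟨unwindow r k w, ⟨unwindow_mem w, ?_⟩, window_unwindow w⟩
    rw [SetLike.mem_coe, Submodule.mem_comap, window_unwindow]
    exact hw

theorem ofWindow_map_window {L : Submodule ℂ (Fin r → KK)} (h1 : stdLattice r k ≤ L)
    (h2 : L ≤ stdLattice r (-k)) : ofWindow r k (L.map (window r k)) = L := by
  apply le_antisymm
  · rintro v ⟨hv, w, hw, hwv⟩
    have h3 : v - w ∈ stdLattice r k := by
      refine mem_stdLattice_of_window_eq_zero (sub_mem hv (h2 hw)) ?_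
      rw [map_sub, hwv, sub_self]
    have := add_mem (h1 h3) hw
    rwa [sub_add_cancel] at this
  · exact fun v hv => ⟨h2 hv, v, hv, rfl⟩

/-- Multiplication by `z` on windows. -/
def shiftWindow (w : Fin r × Fin (2 * k) → ℂ) : Fin r × Fin (2 * k) → ℂ := fun p =>
  if _h : (p.2 : ℕ) = 0 then 0 else w (p.1, ⟨p.2 - 1, by omega⟩)

theorem window_zp_smul {v : Fin r → KK} (hv : v ∈ stdLattice r (-k)) :
    window r k (zp 1 • v) = shiftWindow (window r k v) := by
  funext p
  rw [window_apply, Pi.smul_apply, smul_eq_mul, coeffK_zp_mul, shiftWindow]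
  split_ifs with h
  · exact hv _ _ (by omega)
  · rw [window_apply]
    congr 1
    simp only
    congr 1
    omega

theorem shiftWindow_sum {κ : Type*} [Fintype κ] (c : κ → ℂ) (b : κ → Fin r × Fin (2 * k) → ℂ) :
    shiftWindow (∑ s, c s • b s) = ∑ s, c s • shiftWindow (b s) := by
  funext p
  simp only [shiftWindow, Finset.sum_apply, Pi.smul_apply, smul_eq_mul]
  split_ifs <;> simp

/-- Stability under `z` suffices: write `f = a + f₁ z` with `a` constant, and note that `z v` is one
step closer to `zᵏ 𝒪^r`, where every multiple is allowed. After `2k` steps the whole window is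
exhausted. -/
theorem incl_smul_mem_ofWindow {W : Submodule ℂ (Fin r × Fin (2 * k) → ℂ)}
    (hW : ∀ w ∈ W, shiftWindow w ∈ W) (f : OO) {v : Fin r → KK} (hv : v ∈ ofWindow r k W) :
    incl f • v ∈ ofWindow r k W := by
  have key : ∀ (n : ℕ) (f : OO) (v : Fin r → KK), v ∈ ofWindow r k W →
      v ∈ stdLattice r ((k : ℤ) - n) → incl f • v ∈ ofWindow r k W := by
    intro n
    induction n with
    | zero =>
      intro f v _ hv
      rw [Nat.cast_zero, sub_zero] at hv
      exact stdLattice_le_ofWindow W (incl_smul_mem_stdLattice f hv)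
    | succ n ih =>
      intro f v hv hn
      have hf : incl f = incl (PowerSeries.mk fun p => PowerSeries.coeff (p + 1) f) * zp 1 +
          algebraMap ℂ KK (PowerSeries.constantCoeff f) := by
        have h := congrArg incl (PowerSeries.eq_shift_mul_X_add_const f)
        rw [map_add, map_mul, incl_X] at h
        refine h.trans ?_
        congr 1
        exact incl.commutes _
      rw [hf, add_smul, mul_smul]
      refine add_mem (ih _ _ ⟨?_, ?_⟩ ?_) ?_
      · rw [← incl_X]
        exact incl_smul_mem_stdLattice _ hv.1
      · rw [SetLike.mem_coe, Submodule.mem_comap, window_zp_smul hv.1]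
        exact hW _ hv.2
      · intro i j hj
        rw [Pi.smul_apply, smul_eq_mul, coeffK_zp_mul]
        exact hn i _ (by push_cast; omega)
      · rw [algebraMap_smul]
        exact Submodule.smul_mem _ _ hv
  exact key (2 * k) f v hv (by
    have : (k : ℤ) - (2 * k : ℕ) = -k := by push_cast; ring
    rw [this]
    exact hv.1)

end Window

/-! ### Bases of lattices -/

section LatticeBasis

variable {r k : ℕ}

/-- Over the principal ideal domain `𝒪` the submodule `zᵏ L` of `𝒪^r` is free. It contains `z²ᵏ
𝒪^r`, so the matrix of its basis is invertible over `𝒦`, and hence square. -/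
theorem exists_lattice_basis {L : Submodule ℂ (Fin r → KK)}
    (hz : ∀ (f : OO), ∀ v ∈ L, incl f • v ∈ L) (h1 : stdLattice r k ≤ L)
    (h2 : L ≤ stdLattice r (-k)) :
    ∃ M M' : Matrix (Fin r) (Fin r) KK, M * M' = 1 ∧
      L = (stdLattice r 0).map (M.mulVecLin.restrictScalars ℂ) := by
  classical
  let Lw : Submodule OO (Fin r → OO) :=
    { carrier := {w | (fun i => zp (-k) * incl (w i)) ∈ L}
      zero_mem' := by
        have : (fun i : Fin r => zp (-k) * incl ((0 : Fin r → OO) i)) = 0 := by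
          funext i
          simp
        rw [Set.mem_ofPred_eq, this]
        exact L.zero_mem
      add_mem' := by
        intro a b ha hb
        have : (fun i => zp (-k) * incl ((a + b) i)) =
            (fun i => zp (-k) * incl (a i)) + fun i => zp (-k) * incl (b i) := by
          funext i
          simp [mul_add]
        rw [Set.mem_ofPred_eq, this]
        exact L.add_mem ha hb
      smul_mem' := by
        intro f a ha
        have : (fun i => zp (-k) * incl ((f • a) i)) =
            incl f • fun i => zp (-k) * incl (a i) := by
          funext i
          simp only [Pi.smul_apply, smul_eq_mul, map_mul]
          ring
        rw [Set.mem_ofPred_eq, this]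
        exact hz f _ ha }
  have hLw : ∀ w, w ∈ Lw ↔ (fun i => zp (-k) * incl (w i)) ∈ L := fun _ => Iff.rfl
  obtain ⟨n, B⟩ := Submodule.basisOfPid (Pi.basisFun OO (Fin r)) Lw
  let P : Matrix (Fin r) (Fin n) OO := Matrix.of fun i j => (B j : Fin r → OO) i
  have hP : ∀ w, w ∈ Lw ↔ ∃ c : Fin n → OO, P.mulVec c = w := by
    intro w
    constructor
    · intro hw
      refine ⟨B.repr ⟨w, hw⟩, ?_⟩
      have h3 := congrArg Lw.subtype (B.sum_repr ⟨w, hw⟩)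
      rw [map_sum] at h3
      funext i
      refine Eq.trans ?_ (congrFun h3 i)
      simp [P, Matrix.mulVec, dotProduct, mul_comm]
    · rintro ⟨c, rfl⟩
      have h3 : P.mulVec c = ∑ j, c j • (B j : Fin r → OO) := by
        funext i
        simp [P, Matrix.mulVec, dotProduct, mul_comm]
      rw [h3]
      exact Submodule.sum_mem _ fun j _ => Submodule.smul_mem _ _ (B j).2
  have hPinj : ∀ c : Fin n → OO, P.mulVec c = 0 → c = 0 := by
    intro c hc
    have h3 : ∑ j, c j • B j = 0 := by
      apply Subtype.ext
      funext i
      have := congrFun hc i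
      simpa [P, Matrix.mulVec, dotProduct, mul_comm] using this
    exact funext fun j => Fintype.linearIndependent_iff.mp B.linearIndependent c h3 j
  have hX : ∀ i, (Pi.single i (PowerSeries.X ^ (2 * k)) : Fin r → OO) ∈ Lw := by
    intro i
    rw [hLw]
    refine h1 (mem_stdLattice.mpr fun j => ?_)
    rcases eq_or_ne j i with rfl | hj
    · rw [Pi.single_eq_same, incl_X_pow, ← zp_add, ← zp_add]
      exact zp_mem_intK (by push_cast; omega)
    · rw [Pi.single_eq_of_ne hj, map_zero, mul_zero, mul_zero]
      exact zero_mem _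
  choose c hc using fun i => (hP _).mp (hX i)
  let C : Matrix (Fin n) (Fin r) OO := Matrix.of fun j i => c i j
  have hPC : P * C = (PowerSeries.X : OO) ^ (2 * k) • (1 : Matrix (Fin r) (Fin r) OO) := by
    ext i j : 1
    have := congrFun (hc j) i
    rw [Matrix.smul_apply, Matrix.one_apply, smul_eq_mul]
    refine this.trans ?_
    rw [Pi.single_apply]
    split_ifs <;> simp
  -- `P (C P - z²ᵏ) = 0` follows from the previous equation, and `P` is injective.
  have hCP : C * P = (PowerSeries.X : OO) ^ (2 * k) • (1 : Matrix (Fin n) (Fin n) OO) := by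
    rw [← sub_eq_zero]
    ext j i : 1
    have h3 : P.mulVec ((C * P - (PowerSeries.X : OO) ^ (2 * k) • (1 : Matrix (Fin n) (Fin n) OO)).col i) = 0 := by
      have h4 : P * (C * P - (PowerSeries.X : OO) ^ (2 * k) • (1 : Matrix (Fin n) (Fin n) OO)) = 0 := by
        rw [Matrix.mul_sub, ← Matrix.mul_assoc, hPC, Matrix.smul_mul, Matrix.one_mul,
          Matrix.mul_smul, Matrix.mul_one, sub_self]
      funext l
      exact congrFun (congrFun h4 l) i
    exact congrFun (hPinj _ h3) j
  let PK : Matrix (Fin r) (Fin n) KK := zp (-k) • P.map incl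
  let CK : Matrix (Fin n) (Fin r) KK := zp (-k) • C.map incl
  have hz1 : zp (-k) * (zp (-k) * incl (PowerSeries.X ^ (2 * k))) = 1 := by
    rw [incl_X_pow, ← zp_add, ← zp_add, ← zp_zero]
    congr 1
    push_cast
    omega
  have hmap : ∀ {a b c : ℕ} (X : Matrix (Fin a) (Fin b) OO) (Y : Matrix (Fin b) (Fin c) OO),
      (X * Y).map incl = X.map incl * Y.map incl := fun X Y =>
    Matrix.map_mul (f := (incl : OO →+* KK))
  have hsm : ∀ {a : ℕ}, ((PowerSeries.X : OO) ^ (2 * k) • (1 : Matrix (Fin a) (Fin a) OO)).map incl =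
      incl (PowerSeries.X ^ (2 * k)) • 1 := by
    intro a
    ext i j
    simp only [Matrix.map_apply, Matrix.smul_apply, Matrix.one_apply, smul_eq_mul, map_mul]
    split_ifs <;> simp
  have hPCK : PK * CK = 1 := by
    simp only [PK, CK]
    rw [Matrix.smul_mul, Matrix.mul_smul, ← hmap, hPC, hsm, smul_smul, smul_smul, mul_assoc, hz1,
      one_smul]
  have hCPK : CK * PK = 1 := by
    simp only [PK, CK]
    rw [Matrix.smul_mul, Matrix.mul_smul, ← hmap, hCP, hsm, smul_smul, smul_smul, mul_assoc, hz1,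
      one_smul]
  obtain rfl : r = n := by
    simpa using Matrix.square_of_invertible PK CK hPCK hCPK
  refine ⟨PK, CK, hPCK, ?_⟩
  have hmv : ∀ c : Fin r → OO, PK.mulVec (fun i => incl (c i)) =
      fun i => zp (-k) * incl (P.mulVec c i) := by
    intro c
    funext i
    simp [PK, Matrix.mulVec, dotProduct, Finset.mul_sum, mul_assoc]
  ext v
  constructor
  · intro hv
    choose w hw using fun i => mem_stdLattice.mp (h2 hv) i
    have hvw : v = fun i => zp (-k) * incl (w i) := by
      funext i
      have : incl (w i) = zp (- -k) * v i := hw i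
      rw [this, ← mul_assoc, ← zp_add, add_neg_cancel, zp_zero, one_mul]
    obtain ⟨c, hc⟩ := (hP w).mp ((hLw w).mpr (hvw ▸ hv))
    refine ⟨fun i => incl (c i), mem_stdLattice_zero.mpr fun i => incl_mem_intK _, ?_⟩
    change PK.mulVec _ = v
    rw [hmv, hc, hvw]
  · rintro ⟨w, hw, rfl⟩
    choose c hc using fun i => mem_stdLattice_zero.mp hw i
    replace hc : w = fun i => incl (c i) := funext fun i => (hc i).symm
    change PK.mulVec w ∈ L
    rw [hc, hmv]
    exact (hLw _).mp ((hP _).mpr ⟨c, rfl⟩)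

end LatticeBasis

/-! ### Generators of a lattice and of its dual -/

section Dual

variable {r k d : ℕ}

/-- In the residue of a product of two series of order at least `-k` only the degrees `-k, …, k - 1`
occur, and the degree `e - k` is paired with `(2k - 1 - e) - k`; hence `Fin.rev`. -/
theorem coeffK_neg_one_mul {x y : KK} (hx : ∀ j < -(k : ℤ), coeffK j x = 0)
    (hy : ∀ j < -(k : ℤ), coeffK j y = 0) :
    coeffK (-1) (x * y) =
      ∑ e : Fin (2 * k), coeffK ((Fin.rev e : ℤ) - k) x * coeffK ((e : ℤ) - k) y := by
  obtain ⟨f, hf⟩ := zp_mul_mem_intK.mpr hx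
  obtain ⟨g, hg⟩ := zp_mul_mem_intK.mpr hy
  replace hf : incl f = zp k * x := by rw [← neg_neg (k : ℤ)]; exact hf
  replace hg : incl g = zp k * y := by rw [← neg_neg (k : ℤ)]; exact hg
  have hcx : ∀ n : ℕ, PowerSeries.coeff n f = coeffK ((n : ℤ) - k) x := fun n => by
    rw [← coeffK_incl, hf, coeffK_zp_mul]
  have hcy : ∀ n : ℕ, PowerSeries.coeff n g = coeffK ((n : ℤ) - k) y := fun n => by
    rw [← coeffK_incl, hg, coeffK_zp_mul]
  have hxy : coeffK (-1) (x * y) = coeffK ((2 * k : ℤ) - 1) (incl (f * g)) := by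
    have : incl (f * g) = zp (2 * k) * (x * y) := by
      rw [map_mul, hf, hg, two_mul, zp_add]
      ring
    rw [this, coeffK_zp_mul]
    congr 1
    ring_nf
  rw [hxy]
  rcases Nat.eq_zero_or_pos k with rfl | hk
  · rw [coeffK_incl_neg _ (by norm_num)]
    simp
  · obtain ⟨N, hN⟩ : ∃ N, 2 * k = N + 1 := ⟨2 * k - 1, by omega⟩
    have hN' : (2 * k : ℤ) - 1 = N := by omega
    rw [hN', coeffK_incl, PowerSeries.coeff_mul, ← Finset.Nat.sum_antidiagonal_swap,
      Finset.Nat.sum_antidiagonal_eq_sum_range_succ_mk, Nat.succ_eq_add_one, ← hN, Finset.sum_range]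
    refine Finset.sum_congr rfl fun e _ => ?_
    simp only [Prod.swap_prod_mk, hcx, hcy, Fin.val_rev]
    congr 4
    have := e.2
    omega

/-- The reversal of windows. -/
def revWindow (w : Fin r × Fin (2 * k) → ℂ) : Fin r × Fin (2 * k) → ℂ :=
  fun p => w (p.1, Fin.rev p.2)

theorem coeffK_neg_one_dotProduct {u l : Fin r → KK} (hu : u ∈ stdLattice r (-k))
    (hl : l ∈ stdLattice r (-k)) :
    coeffK (-1) (u ⬝ᵥ l) = ∑ p, revWindow (window r k u) p * window r k l p := by
  rw [dotProduct, map_sum, Fintype.sum_prod_type]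
  exact Finset.sum_congr rfl fun i _ => coeffK_neg_one_mul (hu i) (hl i)

/-- Every negative coefficient of `u · l` is the residue of `u · zⁿ l` for some `n`, and `zⁿ l`
belongs to the lattice again. So only residues need to vanish, and the dual lattice is the
annihilator of `W` for the residue pairing of windows. -/
theorem dual_iff {W : Submodule ℂ (Fin r × Fin (2 * k) → ℂ)} (hW : ∀ w ∈ W, shiftWindow w ∈ W)
    {u : Fin r → KK} (hu : u ∈ stdLattice r (-k)) :
    (∀ l ∈ ofWindow r k W, u ⬝ᵥ l ∈ intK) ↔
      ∀ w ∈ W, ∑ p, revWindow (window r k u) p * w p = 0 := by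
  constructor
  · intro h w hw
    have h1 : unwindow r k w ∈ ofWindow r k W :=
      ⟨unwindow_mem w, by
        rw [SetLike.mem_coe, Submodule.mem_comap, window_unwindow]
        exact hw⟩
    have h2 := mem_intK.mp (h _ h1) (-1) (by norm_num)
    rwa [coeffK_neg_one_dotProduct hu h1.1, window_unwindow] at h2
  · intro h l hl
    rw [mem_intK]
    intro j hj
    obtain ⟨n, hn⟩ : ∃ n : ℕ, j = -1 - n := ⟨(-1 - j).toNat, by omega⟩
    have h1 := incl_smul_mem_ofWindow hW (PowerSeries.X ^ n) hl
    have h2 := h _ h1.2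
    rw [← coeffK_neg_one_dotProduct hu h1.1, dotProduct_smul, smul_eq_mul, incl_X_pow,
      coeffK_zp_mul] at h2
    rw [hn, h2]

/-- The vectors `zᵏ eᵢ`. -/
def zE (r k : ℕ) (i : Fin r) : Fin r → KK := Pi.single i (zp k)

theorem OO_smul_def {n : Type*} (f : OO) (v : n → KK) : f • v = incl f • v :=
  algebra_compatible_smul KK f v

theorem mem_span_zE {v : Fin r → KK} (hv : v ∈ stdLattice r k) :
    v ∈ Submodule.span OO (Set.range (zE r k)) := by
  choose f hf using fun i => mem_stdLattice.mp hv i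
  have : v = ∑ i, f i • zE r k i := by
    funext j
    have hfj : incl (f j) = zp (-k) * v j := hf j
    simp only [Finset.sum_apply, OO_smul_def, Pi.smul_apply, smul_eq_mul, zE, Pi.single_apply,
      mul_ite, mul_zero, Finset.sum_ite_eq, Finset.mem_univ, if_true]
    rw [hfj, mul_comm, ← mul_assoc, zp_mul_zp_neg, one_mul]
  rw [this]
  exact Submodule.sum_mem _ fun i _ => Submodule.smul_mem _ _ (Submodule.subset_span ⟨i, rfl⟩)

theorem zE_mem (i : Fin r) : zE r k i ∈ stdLattice r k := by
  rw [mem_stdLattice]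
  intro j
  rw [zE, Pi.single_apply]
  split_ifs
  · rw [zp_neg_mul_zp]
    exact one_mem _
  · rw [mul_zero]
    exact zero_mem _

/-- Generators of a lattice. -/
def primalGen (r k : ℕ) (b : Fin d → Fin r × Fin (2 * k) → ℂ) : Fin d ⊕ Fin r → Fin r → KK :=
  Sum.elim (fun s => unwindow r k (b s)) (zE r k)

/-- A basis of the annihilator of a subspace given by a basis in standard form. -/
def dualVec (b : Fin d → Fin r × Fin (2 * k) → ℂ) (I : Fin d → Fin r × Fin (2 * k))
    (j : Fin r × Fin (2 * k)) : Fin r × Fin (2 * k) → ℂ :=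
  fun p => (if p = j then 1 else 0) - ∑ s, b s j * if p = I s then 1 else 0

/-- Generators of the dual lattice. -/
def dualGen (r k : ℕ) (b : Fin d → Fin r × Fin (2 * k) → ℂ) (I : Fin d → Fin r × Fin (2 * k)) :
    (Fin r × Fin (2 * k)) ⊕ Fin r → Fin r → KK :=
  Sum.elim (fun j => unwindow r k (revWindow (dualVec b I j))) (zE r k)

theorem smul_mem_OO_span {n : Type*} {S : Submodule OO (n → KK)} (a : ℂ) {v : n → KK}
    (hv : v ∈ S) : a • v ∈ S := by
  rw [← algebraMap_smul OO a v]
  exact S.smul_mem _ hv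

/-- The lifts of the `b s` generate the lattice modulo `zᵏ 𝒪^r`, and the vectors `zᵏ eᵢ` generate
the rest. -/
theorem mem_span_primalGen {b : Fin d → Fin r × Fin (2 * k) → ℂ}
    (hz : ∀ w ∈ Submodule.span ℂ (Set.range b), shiftWindow w ∈ Submodule.span ℂ (Set.range b))
    {v : Fin r → KK} : v ∈ Submodule.span OO (Set.range (primalGen r k b)) ↔
      v ∈ ofWindow r k (Submodule.span ℂ (Set.range b)) := by
  constructor
  · intro hv
    induction hv using Submodule.span_induction with
    | mem x hx =>
      obtain ⟨s | i, rfl⟩ := hx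
      · refine ⟨unwindow_mem _, ?_⟩
        simp only [SetLike.mem_coe, Submodule.mem_comap, primalGen, Sum.elim_inl, window_unwindow]
        exact Submodule.subset_span ⟨s, rfl⟩
      · exact stdLattice_le_ofWindow _ (zE_mem i)
    | zero => exact Submodule.zero_mem _
    | add x y _ _ hx hy => exact add_mem hx hy
    | smul f x _ hx =>
      rw [OO_smul_def]
      exact incl_smul_mem_ofWindow hz f hx
  · rintro ⟨hv1, hv2⟩
    obtain ⟨c, hc⟩ := (Submodule.mem_span_range_iff_exists_fun ℂ).mp hv2
    have h1 : v - ∑ s, c s • unwindow r k (b s) ∈ stdLattice r k := by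
      refine mem_stdLattice_of_window_eq_zero (sub_mem hv1 (Submodule.sum_mem _ fun s _ =>
        Submodule.smul_mem _ _ (unwindow_mem _))) ?_
      rw [map_sub, map_sum, ← hc, sub_eq_zero]
      simp only [map_smul, window_unwindow]
    have h2 : Submodule.span OO (Set.range (zE r k)) ≤
        Submodule.span OO (Set.range (primalGen r k b)) := by
      refine Submodule.span_mono ?_
      rintro _ ⟨i, rfl⟩
      exact ⟨Sum.inr i, rfl⟩
    have h3 := add_mem (h2 (mem_span_zE h1)) (Submodule.sum_mem _ fun s (_ : s ∈ Finset.univ) =>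
      smul_mem_OO_span (c s) (Submodule.subset_span (s := Set.range (primalGen r k b))
        ⟨Sum.inl s, rfl⟩))
    exact (sub_add_cancel v _).subst (motive := fun x => x ∈ _) h3

theorem dual_mem_stdLattice {W : Submodule ℂ (Fin r × Fin (2 * k) → ℂ)} {u : Fin r → KK}
    (hu : ∀ l ∈ ofWindow r k W, u ⬝ᵥ l ∈ intK) : u ∈ stdLattice r (-k) := by
  rw [mem_stdLattice]
  intro i
  have := hu _ (stdLattice_le_ofWindow W (zE_mem i))
  rw [zE, dotProduct_single, mul_comm] at this
  rwa [neg_neg]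

theorem revWindow_revWindow (w : Fin r × Fin (2 * k) → ℂ) : revWindow (revWindow w) = w := by
  funext p
  simp [revWindow]

theorem mem_span_dualGen {b : Fin d → Fin r × Fin (2 * k) → ℂ}
    {I : Fin d → Fin r × Fin (2 * k)}
    (hb : ∀ s t, b s (I t) = (1 : Matrix (Fin d) (Fin d) ℂ) s t)
    (hz : ∀ w ∈ Submodule.span ℂ (Set.range b), shiftWindow w ∈ Submodule.span ℂ (Set.range b))
    {u : Fin r → KK} : u ∈ Submodule.span OO (Set.range (dualGen r k b I)) ↔
      ∀ l ∈ ofWindow r k (Submodule.span ℂ (Set.range b)), u ⬝ᵥ l ∈ intK := by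
  constructor
  · intro hu
    induction hu using Submodule.span_induction with
    | mem x hx =>
      obtain ⟨j | i, rfl⟩ := hx
      · simp only [dualGen, Sum.elim_inl]
        rw [dual_iff hz (unwindow_mem _), window_unwindow, revWindow_revWindow]
        intro w hw
        induction hw using Submodule.span_induction with
        | mem w hw =>
          obtain ⟨t, rfl⟩ := hw
          simp only [dualVec, sub_mul, Finset.sum_sub_distrib, Finset.sum_mul, ite_mul, one_mul,
            zero_mul, Finset.sum_ite_eq', Finset.mem_univ, if_true, mul_assoc]
          rw [Finset.sum_comm]
          simp only [mul_ite, mul_zero, Finset.sum_ite_eq', Finset.mem_univ, if_true, hb,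
            Matrix.one_apply, mul_one, Finset.sum_ite_eq, sub_self]
        | zero => simp
        | add w w' _ _ h h' => simp [mul_add, Finset.sum_add_distrib, h, h']
        | smul a w _ h => simp [mul_left_comm _ a, ← Finset.mul_sum, h]
      · intro l hl
        simp only [dualGen, Sum.elim_inr]
        rw [zE, single_dotProduct]
        have := mem_stdLattice.mp (ofWindow_le _ hl) i
        rwa [neg_neg] at this
    | zero =>
      intro l _
      rw [zero_dotProduct]
      exact zero_mem _
    | add x y _ _ hx hy =>
      intro l hl
      rw [add_dotProduct]
      exact add_mem (hx l hl) (hy l hl)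
    | smul f x _ hx =>
      intro l hl
      rw [OO_smul_def, smul_dotProduct, smul_eq_mul]
      exact mul_mem (incl_mem_intK f) (hx l hl)
  · intro hu
    have hu1 := dual_mem_stdLattice hu
    rw [dual_iff hz hu1] at hu
    set ξ := revWindow (window r k u) with hξ
    -- A covector `ξ` annihilating the `b s` is the combination of the `dualVec b I j` with
    -- coefficients `ξ j`: the correction terms sum to multiples of `ξ · b s = 0`.
    have h0 : ∀ p, ∑ j, ξ j * dualVec b I j p = ξ p := by
      intro p
      simp only [dualVec, mul_sub, Finset.sum_sub_distrib, Finset.mul_sum]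
      have : ∀ s, ∑ j, ξ j * (b s j * if p = I s then (1 : ℂ) else 0) = 0 := by
        intro s
        simp only [← mul_assoc, ← Finset.sum_mul]
        rw [hu _ (Submodule.subset_span ⟨s, rfl⟩), zero_mul]
      rw [Finset.sum_comm, Finset.sum_eq_zero fun s _ => this s, sub_zero]
      simp
    have h1 : u - ∑ j, ξ j • unwindow r k (revWindow (dualVec b I j)) ∈ stdLattice r k := by
      refine mem_stdLattice_of_window_eq_zero (sub_mem hu1 (Submodule.sum_mem _ fun s _ =>
        Submodule.smul_mem _ _ (unwindow_mem _))) ?_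
      rw [map_sub, map_sum, sub_eq_zero]
      simp only [map_smul, window_unwindow]
      funext p
      have h2 := h0 (p.1, Fin.rev p.2)
      simp only [Finset.sum_apply, Pi.smul_apply, smul_eq_mul]
      refine Eq.trans ?_ h2.symm
      simp [hξ, revWindow]
    have h2 : Submodule.span OO (Set.range (zE r k)) ≤
        Submodule.span OO (Set.range (dualGen r k b I)) := by
      refine Submodule.span_mono ?_
      rintro _ ⟨i, rfl⟩
      exact ⟨Sum.inr i, rfl⟩
    have h3 := add_mem (h2 (mem_span_zE h1)) (Submodule.sum_mem _ fun j (_ : j ∈ Finset.univ) =>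
      smul_mem_OO_span (ξ j) (Submodule.subset_span (s := Set.range (dualGen r k b I))
        ⟨Sum.inl j, rfl⟩))
    exact (sub_add_cancel u _).subst (motive := fun x => x ∈ _) h3

end Dual

/-! ### Integrality of tensors on a lattice -/

section TensorValue

variable {ι κ κ' : Type*} [Fintype ι] {D : ℕ}

/-- The value of a tensor, as a multilinear form, at a tuple of vectors. -/
def tval (t : (Fin D → ι) → KK) (l : Fin D → ι → KK) : KK := ∑ J, t J * ∏ s, l s (J s)

theorem tval_sum [Fintype κ] (t : (Fin D → ι) → KK) (c : Fin D → κ → KK) (G : κ → ι → KK) :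
    tval t (fun s => ∑ p, c s p • G p) =
      ∑ P : Fin D → κ, (∏ s, c s (P s)) * tval t (fun s => G (P s)) := by
  classical
  simp only [tval, Finset.mul_sum, Finset.sum_apply, Pi.smul_apply, smul_eq_mul]
  rw [Finset.sum_comm]
  refine Finset.sum_congr rfl fun J _ => ?_
  rw [Finset.prod_univ_sum, Fintype.piFinset_univ, Finset.mul_sum]
  refine Finset.sum_congr rfl fun P _ => ?_
  rw [Finset.prod_mul_distrib]
  ring

theorem tval_mem_of_mem_span [Fintype κ] {t : (Fin D → ι) → KK} {G : κ → ι → KK}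
    (h : ∀ P : Fin D → κ, tval t (fun s => G (P s)) ∈ intK) {l : Fin D → ι → KK}
    (hl : ∀ s, l s ∈ Submodule.span OO (Set.range G)) : tval t l ∈ intK := by
  choose c hc using fun s => (Submodule.mem_span_range_iff_exists_fun OO).mp (hl s)
  have : l = fun s => ∑ p, incl (c s p) • G p := by
    funext s
    rw [← hc s]
    rfl
  rw [this, tval_sum]
  refine sum_mem fun P _ => mul_mem (prod_mem fun s _ => incl_mem_intK _) (h P)

/-- By multilinearity, integrality of a tensor depends only on the `𝒪`-module spanned by the vectors
on which it is tested. -/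
theorem tval_mem_iff [Fintype κ] [Fintype κ'] {t : (Fin D → ι) → KK} {G : κ → ι → KK}
    {G' : κ' → ι → KK}
    (h : Submodule.span OO (Set.range G) = Submodule.span OO (Set.range G')) :
    (∀ P : Fin D → κ, tval t (fun s => G (P s)) ∈ intK) ↔
      ∀ P : Fin D → κ', tval t (fun s => G' (P s)) ∈ intK :=
  ⟨fun h1 _ => tval_mem_of_mem_span h1 fun _ => h ▸ Submodule.subset_span ⟨_, rfl⟩,
    fun h1 _ => tval_mem_of_mem_span h1 fun _ => h ▸ Submodule.subset_span ⟨_, rfl⟩⟩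

theorem tpow_mulVec_eq_tval (Z : Matrix ι ι KK) (t : (Fin D → ι) → KK) (I : Fin D → ι) :
    (tpow D Z).mulVec t I = tval t fun s j => Z (I s) j := by
  simp only [tval, Matrix.mulVec, dotProduct, tpow_apply, mul_comm]

end TensorValue

/-! ### The lattice `L* ⊕ L ⊕ 𝒪` attached to a lattice `L` -/

section Joint

variable {r : ℕ} {κ₁ κ₂ : Type*}

/-- Vectors of `𝒦^r ⊕ (𝒦^r ⊕ 𝒦)`: those of two given families and `1 ∈ 𝒦`. -/
def joint (G₁ : κ₁ → Fin r → KK) (G₂ : κ₂ → Fin r → KK) : κ₁ ⊕ (κ₂ ⊕ Unit) → Idx r → KK :=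
  Sum.elim (fun p => Sum.elim (G₁ p) 0)
    (Sum.elim (fun p => Sum.elim 0 (Sum.elim (G₂ p) 0)) fun _ => Sum.elim 0 (Sum.elim 0 1))

theorem blk_eq_joint (N M : Matrix (Fin r) (Fin r) KK) (i : Idx r) :
    (fun j => blk N M i j) = joint (fun i j => N i j) (fun i j => M j i) i := by
  funext j
  rcases i with i | i | i <;> rcases j with j | j | j <;> rfl

theorem mem_span_joint {G₁ : κ₁ → Fin r → KK} {G₂ : κ₂ → Fin r → KK} {v : Idx r → KK} :
    v ∈ Submodule.span OO (Set.range (joint G₁ G₂)) ↔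
      (fun i => v (Sum.inl i)) ∈ Submodule.span OO (Set.range G₁) ∧
      (fun i => v (Sum.inr (Sum.inl i))) ∈ Submodule.span OO (Set.range G₂) ∧
      v (Sum.inr (Sum.inr ())) ∈ intK := by
  constructor
  · intro hv
    induction hv using Submodule.span_induction with
    | mem x hx =>
      obtain ⟨p | p | p, rfl⟩ := hx
      · exact ⟨Submodule.subset_span ⟨p, rfl⟩, Submodule.zero_mem _, zero_mem _⟩
      · exact ⟨Submodule.zero_mem _, Submodule.subset_span ⟨p, rfl⟩, zero_mem _⟩
      · exact ⟨Submodule.zero_mem _, Submodule.zero_mem _, one_mem _⟩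
    | zero => exact ⟨Submodule.zero_mem _, Submodule.zero_mem _, zero_mem _⟩
    | add x y _ _ hx hy =>
      exact ⟨add_mem hx.1 hy.1, add_mem hx.2.1 hy.2.1, add_mem hx.2.2 hy.2.2⟩
    | smul f x _ hx =>
      refine ⟨Submodule.smul_mem _ f hx.1, Submodule.smul_mem _ f hx.2.1, ?_⟩
      rw [OO_smul_def]
      exact mul_mem (incl_mem_intK f) hx.2.2
  · rintro ⟨h1, h2, f, hf⟩
    have key1 : ∀ w ∈ Submodule.span OO (Set.range G₁),
        (Sum.elim w 0 : Idx r → KK) ∈ Submodule.span OO (Set.range (joint G₁ G₂)) := by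
      intro w hw
      induction hw using Submodule.span_induction with
      | mem x hx =>
        obtain ⟨p, rfl⟩ := hx
        exact Submodule.subset_span ⟨Sum.inl p, rfl⟩
      | zero =>
        convert Submodule.zero_mem _
        funext i
        rcases i with i | i <;> rfl
      | add x y _ _ hx hy =>
        convert add_mem hx hy
        funext i
        rcases i with i | i <;> simp
      | smul f x _ hx =>
        convert Submodule.smul_mem _ f hx
        funext i
        rcases i with i | i <;> simp
    have key2 : ∀ w ∈ Submodule.span OO (Set.range G₂),
        (Sum.elim 0 (Sum.elim w 0) : Idx r → KK) ∈
          Submodule.span OO (Set.range (joint G₁ G₂)) := by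
      intro w hw
      induction hw using Submodule.span_induction with
      | mem x hx =>
        obtain ⟨p, rfl⟩ := hx
        exact Submodule.subset_span ⟨Sum.inr (Sum.inl p), rfl⟩
      | zero =>
        convert Submodule.zero_mem _
        funext i
        rcases i with i | i | i <;> rfl
      | add x y _ _ hx hy =>
        convert add_mem hx hy
        funext i
        rcases i with i | i | i <;> simp
      | smul f x _ hx =>
        convert Submodule.smul_mem _ f hx
        funext i
        rcases i with i | i | i <;> simp
    have h3 : f • (Sum.elim 0 (Sum.elim 0 1) : Idx r → KK) ∈
        Submodule.span OO (Set.range (joint G₁ G₂)) :=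
      Submodule.smul_mem _ _ (Submodule.subset_span ⟨Sum.inr (Sum.inr ()), rfl⟩)
    convert add_mem (add_mem (key1 _ h1) (key2 _ h2)) h3
    funext i
    rcases i with i | i | ⟨⟩
    · simp
    · simp
    · simp only [OO_smul_def, Pi.add_apply, Pi.smul_apply, Sum.elim_inr, Pi.zero_apply,
        Pi.one_apply, zero_add, smul_eq_mul, mul_one]
      exact hf.symm

theorem span_joint_eq {κ₁' κ₂' : Type*} {G₁ : κ₁ → Fin r → KK} {G₂ : κ₂ → Fin r → KK}
    {G₁' : κ₁' → Fin r → KK} {G₂' : κ₂' → Fin r → KK}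
    (h1 : Submodule.span OO (Set.range G₁) = Submodule.span OO (Set.range G₁'))
    (h2 : Submodule.span OO (Set.range G₂) = Submodule.span OO (Set.range G₂')) :
    Submodule.span OO (Set.range (joint G₁ G₂)) = Submodule.span OO (Set.range (joint G₁' G₂')) := by
  ext v
  rw [mem_span_joint, mem_span_joint, h1, h2]

theorem mem_span_transpose {M : Matrix (Fin r) (Fin r) KK} {v : Fin r → KK} :
    v ∈ Submodule.span OO (Set.range fun i j => M j i) ↔
      v ∈ (stdLattice r 0).map (M.mulVecLin.restrictScalars ℂ) := by
  rw [Submodule.mem_span_range_iff_exists_fun]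
  have key : ∀ c : Fin r → OO, ∑ i, c i • (fun j => M j i) = M.mulVec fun i => incl (c i) := by
    intro c
    funext j
    simp [OO_smul_def, Matrix.mulVec, dotProduct, mul_comm]
  constructor
  · rintro ⟨c, rfl⟩
    exact ⟨_, mem_stdLattice_zero.mpr fun i => incl_mem_intK (c i), (key c).symm⟩
  · rintro ⟨w, hw, rfl⟩
    choose c hc using fun i => mem_stdLattice_zero.mp hw i
    refine ⟨c, (key c).trans ?_⟩
    rw [show (fun i => incl (c i)) = w from funext hc]
    rfl

/-- The rows of the inverse of `M` are the basis dual to the columns of `M`, so they generate the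
dual lattice. -/
theorem mem_span_rows {N M : Matrix (Fin r) (Fin r) KK} (h : M * N = 1) {u : Fin r → KK} :
    u ∈ Submodule.span OO (Set.range fun i j => N i j) ↔
      ∀ l ∈ (stdLattice r 0).map (M.mulVecLin.restrictScalars ℂ), u ⬝ᵥ l ∈ intK := by
  rw [Submodule.mem_span_range_iff_exists_fun]
  have key : ∀ c : Fin r → OO, ∑ i, c i • (fun j => N i j) = Matrix.vecMul (fun i => incl (c i)) N := by
    intro c
    funext j
    simp [OO_smul_def, Matrix.vecMul, dotProduct]
  have hNM := mul_eq_one_comm.mp h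
  constructor
  · rintro ⟨c, rfl⟩ _ ⟨w, hw, rfl⟩
    change _ ⬝ᵥ M.mulVec w ∈ intK
    rw [key, ← Matrix.dotProduct_mulVec, Matrix.mulVec_mulVec, hNM, Matrix.one_mulVec]
    exact sum_mem fun i _ => mul_mem (incl_mem_intK _) (mem_stdLattice_zero.mp hw i)
  · intro hu
    have h1 : ∀ j, Matrix.vecMul u M j ∈ intK := by
      intro j
      have := hu (M.mulVec (Pi.single j 1)) ⟨_, mem_stdLattice_zero.mpr fun i => ?_, rfl⟩
      · rwa [Matrix.dotProduct_mulVec, dotProduct_single, mul_one] at this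
      · rw [Pi.single_apply]
        split_ifs
        exacts [one_mem _, zero_mem _]
    choose c hc using h1
    refine ⟨c, (key c).trans ?_⟩
    rw [show (fun i => incl (c i)) = Matrix.vecMul u M from funext hc, Matrix.vecMul_vecMul, h,
      Matrix.vecMul_one]

variable {k d : ℕ}

/-- Integrality of a tensor on a lattice can be tested on the standard generators. -/
theorem tpow_blk_mulVec_mem_iff {M N : Matrix (Fin r) (Fin r) KK} (h : M * N = 1)
    {b : Fin d → Fin r × Fin (2 * k) → ℂ} {I : Fin d → Fin r × Fin (2 * k)}
    (hb : ∀ s t, b s (I t) = (1 : Matrix (Fin d) (Fin d) ℂ) s t)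
    (hz : ∀ w ∈ Submodule.span ℂ (Set.range b), shiftWindow w ∈ Submodule.span ℂ (Set.range b))
    (hL : ofWindow r k (Submodule.span ℂ (Set.range b)) =
      (stdLattice r 0).map (M.mulVecLin.restrictScalars ℂ)) {D : ℕ} (t : (Fin D → Idx r) → KK) :
    (∀ I, (tpow D (blk N M)).mulVec t I ∈ intK) ↔
      ∀ P : Fin D → _, tval t (fun s => joint (dualGen r k b I) (primalGen r k b) (P s)) ∈ intK := by
  -- The coordinates of the transformed tensor are its values on the rows of `blk N M`, and these
  -- rows generate the same module as the standard generators of the dual lattice, the lattice and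
  -- `𝒪`.
  simp only [tpow_mulVec_eq_tval, blk_eq_joint]
  refine tval_mem_iff (span_joint_eq ?_ ?_)
  · ext u
    rw [mem_span_dualGen hb hz, hL]
    exact mem_span_rows h
  · ext v
    rw [mem_span_primalGen hz, hL]
    exact mem_span_transpose

end Joint

/-! ### Laurent series that depend polynomially on parameters -/

section PolyK

variable {ι : Type*}

/-- A Laurent series whose coefficients are polynomial functions of the parameters, and whose
order is bounded below. -/
def IsPolyK (f : (ι → ℂ) → KK) : Prop :=
  ∃ (n : ℕ) (F : PowerSeries (MvPolynomial ι ℂ)),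
    ∀ v, zp n * f v = incl (PowerSeries.map (MvPolynomial.eval v) F)

theorem IsPolyK.const (x : KK) : IsPolyK fun _ : ι → ℂ => x := by
  obtain ⟨n, f, hf⟩ := exists_zp_mul_mem_intK x
  refine ⟨n, PowerSeries.map MvPolynomial.C f, fun v => ?_⟩
  refine hf.symm.trans (congrArg incl ?_)
  ext m
  simp

theorem IsPolyK.mul {f g : (ι → ℂ) → KK} (hf : IsPolyK f) (hg : IsPolyK g) :
    IsPolyK fun v => f v * g v := by
  obtain ⟨m, F, hF⟩ := hf
  obtain ⟨n, G, hG⟩ := hg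
  refine ⟨m + n, F * G, fun v => ?_⟩
  rw [map_mul, map_mul, ← hF, ← hG, Nat.cast_add, zp_add]
  ring

theorem IsPolyK.add {f g : (ι → ℂ) → KK} (hf : IsPolyK f) (hg : IsPolyK g) :
    IsPolyK fun v => f v + g v := by
  obtain ⟨m, F, hF⟩ := hf
  obtain ⟨n, G, hG⟩ := hg
  refine ⟨m + n, PowerSeries.X ^ n * F + PowerSeries.X ^ m * G, fun v => ?_⟩
  simp only [map_add, map_mul, map_pow, PowerSeries.map_X]
  rw [← hF, ← hG, ← map_pow, ← map_pow, incl_X_pow, incl_X_pow, Nat.cast_add, zp_add]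
  ring

theorem IsPolyK.sum {κ : Type*} {s : Finset κ} {f : κ → (ι → ℂ) → KK}
    (hf : ∀ k, IsPolyK (f k)) : IsPolyK fun v => ∑ k ∈ s, f k v := by
  classical
  induction s using Finset.induction_on with
  | empty => simpa using IsPolyK.const 0
  | insert a s ha ih =>
    simp only [Finset.sum_insert ha]
    exact (hf a).add ih

theorem IsPolyK.prod {κ : Type*} {s : Finset κ} {f : κ → (ι → ℂ) → KK}
    (hf : ∀ k, IsPolyK (f k)) : IsPolyK fun v => ∏ k ∈ s, f k v := by
  classical
  induction s using Finset.induction_on with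
  | empty => simpa using IsPolyK.const 1
  | insert a s ha ih =>
    simp only [Finset.prod_insert ha]
    exact (hf a).mul ih

theorem IsPolyFun.isPolyK {f : (ι → ℂ) → ℂ} (hf : IsPolyFun f) :
    IsPolyK fun v => algebraMap ℂ KK (f v) := by
  obtain ⟨p, hp⟩ := hf
  refine ⟨0, PowerSeries.C p, fun v => ?_⟩
  simp only [hp]
  rw [Nat.cast_zero, zp_zero, one_mul, PowerSeries.map_C, ← incl.commutes]
  rfl

/-- The order is bounded below uniformly, so only finitely many coefficients have to vanish, and
each is polynomial in the parameters. -/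
theorem IsPolyK.isPolyCond {f : (ι → ℂ) → KK} (hf : IsPolyK f) :
    IsPolyCond fun v => f v ∈ intK := by
  obtain ⟨n, F, hF⟩ := hf
  refine ⟨{q | ∃ j : ℕ, j < n ∧ q = PowerSeries.coeff j F}, fun v => ?_⟩
  have h1 : ∀ j : ℕ, coeffK ((j : ℤ) - n) (f v) = MvPolynomial.eval v (PowerSeries.coeff j F) := by
    intro j
    rw [← coeffK_zp_mul, hF, coeffK_incl, PowerSeries.coeff_map]
  have h2 : ∀ j : ℤ, j < -n → coeffK j (f v) = 0 := by
    refine zp_mul_mem_intK.mp ?_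
    rw [neg_neg, hF]
    exact incl_mem_intK _
  simp only [mem_intK]
  constructor
  · rintro h q ⟨j, hj, rfl⟩
    rw [← h1]
    exact h _ (by omega)
  · intro h j hj
    by_cases hj' : j < -n
    · exact h2 j hj'
    · obtain ⟨i, hi⟩ := Int.eq_ofNat_of_zero_le (show 0 ≤ j + n by omega)
      have h3 := h1 i
      rw [h _ ⟨i, by omega, rfl⟩] at h3
      rw [← h3, show j = (i : ℤ) - n by omega]

end PolyK

/-! ### Springer fibres are closed in each piece -/

section ChartCondition

variable {ι : Type*} {r k d : ℕ}

theorem isPolyK_tval {D : ℕ} [Fintype ι] {κ : Type*} (t : (Fin D → ι) → KK)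
    {l : (κ → ℂ) → Fin D → ι → KK} (hl : ∀ s i, IsPolyK fun v => l v s i) :
    IsPolyK fun v => tval t (l v) :=
  IsPolyK.sum fun J => (IsPolyK.const _).mul (IsPolyK.prod fun s => hl s (J s))

theorem isPolyFun_shiftWindow {w : (ι → ℂ) → Fin r × Fin (2 * k) → ℂ}
    (hw : ∀ p, IsPolyFun fun v => w v p) (p : Fin r × Fin (2 * k)) :
    IsPolyFun fun v => shiftWindow (w v) p := by
  unfold shiftWindow
  split_ifs with h
  · exact .const 0
  · exact hw _

theorem isPolyK_unwindow {w : (ι → ℂ) → Fin r × Fin (2 * k) → ℂ}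
    (hw : ∀ p, IsPolyFun fun v => w v p) (i : Fin r) : IsPolyK fun v => unwindow r k (w v) i :=
  IsPolyK.sum fun _ => (hw _).isPolyK.mul (IsPolyK.const _)

theorem isPolyK_primalGen {b : (ι → ℂ) → Fin d → Fin r × Fin (2 * k) → ℂ}
    (hb : ∀ s p, IsPolyFun fun v => b v s p) (p : Fin d ⊕ Fin r) (i : Fin r) :
    IsPolyK fun v => primalGen r k (b v) p i := by
  rcases p with s | j
  · exact isPolyK_unwindow (hb s) i
  · exact IsPolyK.const _

theorem isPolyK_dualGen {b : (ι → ℂ) → Fin d → Fin r × Fin (2 * k) → ℂ}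
    (hb : ∀ s p, IsPolyFun fun v => b v s p) (I : Fin d → Fin r × Fin (2 * k))
    (p : (Fin r × Fin (2 * k)) ⊕ Fin r) (i : Fin r) :
    IsPolyK fun v => dualGen r k (b v) I p i := by
  rcases p with j | j
  · refine isPolyK_unwindow (fun p => ?_) i
    exact (IsPolyFun.const _).sub (IsPolyFun.sum fun s => (hb s j).mul (IsPolyFun.const _))
  · exact IsPolyK.const _

theorem isPolyK_joint {κ₁ κ₂ : Type*} {G₁ : (ι → ℂ) → κ₁ → Fin r → KK}
    {G₂ : (ι → ℂ) → κ₂ → Fin r → KK} (h₁ : ∀ p i, IsPolyK fun v => G₁ v p i)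
    (h₂ : ∀ p i, IsPolyK fun v => G₂ v p i) (p : κ₁ ⊕ (κ₂ ⊕ Unit)) (i : Idx r) :
    IsPolyK fun v => joint (G₁ v) (G₂ v) p i := by
  rcases p with p | p | p <;> rcases i with i | i | i
  exacts [h₁ p i, .const _, .const _, .const _, h₂ p i, .const _, .const _, .const _, .const _]

/-- The columns `I` of `b` form the identity, so the coefficient of `w` at `b t` can only be `w (I
t)`. This turns membership in the span into polynomial equations. -/
theorem mem_span_chart_iff {I : Fin d → ι} {b : Fin d → ι → ℂ}
    (hb : ∀ s t, b s (I t) = (1 : Matrix (Fin d) (Fin d) ℂ) s t) {w : ι → ℂ} :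
    w ∈ Submodule.span ℂ (Set.range b) ↔ ∀ p, w p = ∑ t, w (I t) * b t p := by
  constructor
  · intro hw
    obtain ⟨c, rfl⟩ := (Submodule.mem_span_range_iff_exists_fun ℂ).mp hw
    intro p
    simp [hb, Matrix.one_apply]
  · intro hw
    have : w = ∑ t, w (I t) • b t := by
      funext p
      simpa using hw p
    rw [this]
    exact Submodule.sum_mem _ fun t _ => Submodule.smul_mem _ _ (Submodule.subset_span ⟨t, rfl⟩)

theorem shiftWindow_mem_span {b : Fin d → Fin r × Fin (2 * k) → ℂ}
    (h : ∀ s, shiftWindow (b s) ∈ Submodule.span ℂ (Set.range b)) :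
    ∀ w ∈ Submodule.span ℂ (Set.range b), shiftWindow w ∈ Submodule.span ℂ (Set.range b) := by
  intro w hw
  obtain ⟨c, rfl⟩ := (Submodule.mem_span_range_iff_exists_fun ℂ).mp hw
  rw [shiftWindow_sum]
  exact Submodule.sum_mem _ fun t _ => Submodule.smul_mem _ _ (h t)

end ChartCondition

/-! ### Closedness of Springer fibres, injectivity of the Plücker map -/

section SpringerClosed

variable {A : Type*} [CommRing A] [HopfAlgebra ℂ A] {r : ℕ}

theorem incl_smul_mem_latticeOf (ρ : Rep A r) (g : Points A KK) (f : OO) {v : Fin r → KK}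
    (hv : v ∈ latticeOf ρ g) : incl f • v ∈ latticeOf ρ g := by
  obtain ⟨w, hw, rfl⟩ := hv
  refine ⟨incl f • w, incl_smul_mem_stdLattice f hw, ?_⟩
  exact Matrix.mulVec_smul (ρ.mat g) (incl f) w

theorem shiftWindow_mem_map {k : ℕ} {L : Submodule ℂ (Fin r → KK)}
    (hz : ∀ (f : OO), ∀ v ∈ L, incl f • v ∈ L) (h : L ≤ stdLattice r (-k)) :
    ∀ w ∈ L.map (window r k), shiftWindow w ∈ L.map (window r k) := by
  rintro _ ⟨l, hl, rfl⟩
  refine ⟨zp 1 • l, ?_, window_zp_smul (h hl)⟩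
  rw [← incl_X]
  exact hz _ _ hl

theorem mulVec_mem_intK {m n : Type*} [Fintype n] {X : Matrix m n KK} {w : n → KK}
    (hX : ∀ i j, X i j ∈ intK) (hw : ∀ j, w j ∈ intK) (i : m) : X.mulVec w i ∈ intK := by
  rw [Matrix.mulVec, dotProduct]
  exact sum_mem fun j _ => mul_mem (hX i j) (hw j)

theorem algebraMap_mem_intK (a : ℂ) : algebraMap ℂ KK a ∈ intK := intK.algebraMap_mem a

/-- The equations of a Springer fibre, in an affine chart of the Grassmannian. -/
theorem exists_springer_equations [Algebra.FiniteType ℂ A] [IsReduced A] (hG : IsReductive A)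
    {ρ : Rep A r} (hρ : ρ.IsClosedEmbedding) {m : ℕ} (ν : Rep A m) (c : Fin m → KK) (k d : ℕ)
    (I : Fin d → Fin r × Fin (2 * k)) :
    ∃ P : ((Fin d → Fin r × Fin (2 * k)) → ℂ) → Prop, IsPolyCond P ∧ ∀ v (hv : v ≠ 0), v I = 1 →
      (Projectivization.mk ℂ v hv ∈ plucker ρ k d '' (Subtype.val ⁻¹' springerFibre ν c) ↔
        P v) := by
  obtain ⟨D, ψ, hψ, hψ1⟩ := exists_tensor_embedding hG hρ ν
  -- The intertwining property of `ψ a`, evaluated at `𝒦`-points of the group.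
  have hact : ∀ (g : Points A KK) a, (tpow D (blk (ρ.mat g) (ρ.mat g⁻¹))).mulVec
      ((bmap KK (ψ a)).mulVec c) = (bmap KK (ψ a)).mulVec ((ν.mat g).mulVec c) := by
    intro g a
    rw [Matrix.mulVec_mulVec, Matrix.mulVec_mulVec]
    congr 1
    have h1 := congrArg (fun M => M.map (g.eval : A →+* KK)) (hψ a)
    simp only [Matrix.map_mul] at h1
    rw [tpow_map] at h1
    have h2 : (bmap A (ψ a)).map (g.eval : A →+* KK) = bmap KK (ψ a) := by
      ext i j
      simp [bmap]
    rw [h2] at h1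
    rw [← pmat_kap]
    exact h1
  let b := fun v : (Fin d → Fin r × Fin (2 * k)) → ℂ => chartBasis I v
  have hbp : ∀ s p, IsPolyFun fun v => b v s p := fun s p => .coord _
  -- The first two conditions say that `v` is the Plücker vector of its chart basis, the third that
  -- the subspace is stable under `z` and so defines a lattice, the fourth that this lattice comes
  -- from `G(𝒦)`, and the last that `c` lies in the corresponding lattice of the representation.
  refine ⟨fun v => (∀ s t, b v s (I t) = (1 : Matrix (Fin d) (Fin d) ℂ) s t) ∧
    (∀ J, minors (b v) J = v J) ∧
    (∀ s p, shiftWindow (b v s) p = ∑ t, shiftWindow (b v s) (I t) * b v t p) ∧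
    (∀ (D' : ℕ) (t : (Fin D' → Idx r) → ℂ), IsInvTensor ρ t → ∀ P : Fin D' → _,
      tval (fun J => algebraMap ℂ KK (t J))
        (fun s => joint (dualGen r k (b v) I) (primalGen r k (b v)) (P s)) ∈ intK) ∧
    ∀ a, ∀ P : Fin D → _, tval ((bmap KK (ψ a)).mulVec c)
        (fun s => joint (dualGen r k (b v) I) (primalGen r k (b v)) (P s)) ∈ intK, ?_, ?_⟩
  · have hj := fun p i => isPolyK_joint (isPolyK_dualGen hbp I) (isPolyK_primalGen hbp) p i
    refine .and (.forall fun s => .forall fun t => .of_eq (hbp _ _) (.const _)) <|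
      .and (.forall fun J => .of_eq (.det fun _ _ => hbp _ _) (.coord _)) <|
      .and (.forall fun s => .forall fun p => .of_eq (isPolyFun_shiftWindow (hbp _) _)
        (.sum fun t => .mul (isPolyFun_shiftWindow (hbp _) _) (hbp _ _))) <|
      .and (.forall fun D' => .forall fun t => .forall fun _ => .forall fun P => ?_)
        (.forall fun a => .forall fun P => ?_)
    · exact (isPolyK_tval _ fun s i => hj (P s) i).isPolyCond
    · exact (isPolyK_tval _ fun s i => hj (P s) i).isPolyCond
  intro v hv hvI
  constructor
  · rintro ⟨⟨x, hx⟩, ⟨g, rfl, w, hw, hwc⟩, hxv⟩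
    obtain ⟨hb, hspan, hmin⟩ := exists_chart_basis hx.2.2 hv hxv hvI
    have hL : ofWindow r k (Submodule.span ℂ (Set.range (b v))) = latticeOf ρ g := by
      rw [hspan]
      exact ofWindow_map_window hx.1 hx.2.1
    have hz : ∀ w ∈ Submodule.span ℂ (Set.range (b v)),
        shiftWindow w ∈ Submodule.span ℂ (Set.range (b v)) := by
      rw [hspan]
      exact shiftWindow_mem_map (fun f u hu => incl_smul_mem_latticeOf ρ g f hu) hx.2.1
    have hgg : ρ.mat g * ρ.mat g⁻¹ = 1 := by rw [← ρ.mat_mul, mul_inv_cancel, ρ.mat_one]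
    refine ⟨hb, fun J => congrFun hmin J, fun s => ?_, fun D' t ht => ?_, fun a => ?_⟩
    · exact (mem_span_chart_iff hb).mp (hz _ (Submodule.subset_span ⟨s, rfl⟩))
    · rw [← tpow_blk_mulVec_mem_iff hgg hb hz hL]
      intro J
      have h1 := ht.mulVec_eq g⁻¹
      rw [pmat_kap, inv_inv] at h1
      rw [h1]
      exact algebraMap_mem_intK _
    · rw [← tpow_blk_mulVec_mem_iff hgg hb hz hL]
      intro J
      have h1 := hact g⁻¹ a
      rw [inv_inv] at h1
      rw [h1, ← hwc, Matrix.mulVec_mulVec (v := w), ← ν.mat_mul, inv_mul_cancel, ν.mat_one,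
        Matrix.one_mulVec]
      exact mulVec_mem_intK (fun _ _ => algebraMap_mem_intK _) (mem_stdLattice_zero.mp hw) J
  · rintro ⟨hb, hmin, hsh, hinv, hc⟩
    have hz := shiftWindow_mem_span fun s => (mem_span_chart_iff hb).mpr (hsh s)
    have hli := linearIndependent_of_chart hb
    obtain ⟨M, N, hMN, hL⟩ := exists_lattice_basis
      (fun f v hv => incl_smul_mem_ofWindow hz f hv)
      (stdLattice_le_ofWindow _) (ofWindow_le _)
    -- Here `N = M⁻¹ = h g`, so `M = g⁻¹ h⁻¹`. As `h⁻¹` preserves `𝒪^r`, the lattice is `g⁻¹ 𝒪^r`,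
    -- and the point of Gr is the class of `g⁻¹`.
    obtain ⟨g, h, h', hh, hN⟩ := exists_factorization hG hρ (mul_eq_one_comm.mp hMN)
      fun D' t ht => (tpow_blk_mulVec_mem_iff hMN hb hz hL _).mpr (hinv D' t ht)
    have hgg : ρ.mat g⁻¹ * ρ.mat g = 1 := by rw [← ρ.mat_mul, inv_mul_cancel, ρ.mat_one]
    have hhK : h.map incl * h'.map incl = 1 := by
      have := congrArg (fun X => X.map (incl : OO →+* KK)) hh
      simp only [Matrix.map_mul] at this
      refine this.trans ?_
      exact Matrix.map_one _ (map_zero _) (map_one _)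
    have hM : M = ρ.mat g⁻¹ * h'.map incl := by
      have h1 : N * (ρ.mat g⁻¹ * h'.map incl) = 1 := by
        rw [hN, Matrix.mul_assoc, ← Matrix.mul_assoc (ρ.mat g), mul_eq_one_comm.mp hgg,
          Matrix.one_mul, hhK]
      calc M = M * (N * (ρ.mat g⁻¹ * h'.map incl)) := by rw [h1, Matrix.mul_one]
        _ = _ := by rw [← Matrix.mul_assoc, hMN, Matrix.one_mul]
    have hint : ∀ (X : Matrix (Fin r) (Fin r) OO) (w : Fin r → KK), w ∈ stdLattice r 0 →
        (X.map incl).mulVec w ∈ stdLattice r 0 := by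
      intro X w hw
      rw [mem_stdLattice_zero] at hw ⊢
      exact mulVec_mem_intK (fun _ _ => incl_mem_intK _) hw
    have hL' : ofWindow r k (Submodule.span ℂ (Set.range (b v))) = latticeOf ρ g⁻¹ := by
      rw [hL]
      ext u
      constructor
      · rintro ⟨w, hw, rfl⟩
        refine ⟨_, hint h' w hw, ?_⟩
        change (ρ.mat g⁻¹).mulVec _ = M.mulVec w
        rw [Matrix.mulVec_mulVec, hM]
      · rintro ⟨w, hw, rfl⟩
        refine ⟨_, hint h w hw, ?_⟩
        change M.mulVec _ = (ρ.mat g⁻¹).mulVec w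
        rw [Matrix.mulVec_mulVec, hM, Matrix.mul_assoc, mul_eq_one_comm.mp hhK, Matrix.mul_one]
    have hmap : (latticeOf ρ g⁻¹).map (window r k) = Submodule.span ℂ (Set.range (b v)) := by
      rw [← hL', map_window_ofWindow]
    have hdim : Module.finrank ℂ ((latticeOf ρ g⁻¹).map (window r k)) = d := by
      rw [hmap, finrank_span_eq_card hli, Fintype.card_fin]
    refine ⟨⟨((g⁻¹ : Points A KK) : Gr A), ?_, ?_, hdim⟩, ⟨g⁻¹, rfl, (ν.mat g).mulVec c, ?_, ?_⟩, ?_⟩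
    · change _ ≤ latticeOf ρ g⁻¹
      rw [← hL']
      exact stdLattice_le_ofWindow _
    · change latticeOf ρ g⁻¹ ≤ _
      rw [← hL']
      exact ofWindow_le _
    · rw [mem_stdLattice_zero]
      intro i
      -- The left inverse of the embedding writes each coordinate of `g c` as a sum of tensor
      -- coordinates, which are integral by `hc`.
      have h1 : ∑ J, (bmap KK (ψ (J, i))).mulVec ((ν.mat g).mulVec c) J = (ν.mat g).mulVec c i := by
        generalize (ν.mat g).mulVec c = u
        simp only [Matrix.mulVec, dotProduct]
        rw [Finset.sum_comm]
        simp only [← Finset.sum_mul, bmap, Matrix.map_apply, ← map_sum, hψ1, Matrix.one_apply]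
        simp
      rw [← h1]
      refine sum_mem fun J _ => ?_
      rw [← hact]
      exact (tpow_blk_mulVec_mem_iff hgg hb hz hL' _).mpr (hc (J, i)) J
    · rw [Matrix.mulVec_mulVec, ← ν.mat_mul, inv_mul_cancel, ν.mat_one, Matrix.one_mulVec]
    · refine (pluckerPoint_eq_mk hdim hli hmap.symm).trans ?_
      congr 1
      exact funext hmin

theorem isClosed_plucker_springerFibre [Algebra.FiniteType ℂ A] [IsReduced A] (hG : IsReductive A)
    {ρ : Rep A r} (hρ : ρ.IsClosedEmbedding) {m : ℕ} (ν : Rep A m) (c : Fin m → KK) (k d : ℕ) :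
    @IsClosed _ (zariski _) (plucker ρ k d '' (Subtype.val ⁻¹' springerFibre ν c)) :=
  isClosed_of_charts _ fun I => exists_springer_equations hG hρ ν c k d I

/-- If `g` and `g'` have the same lattice, `g⁻¹ g'` and its inverse have entries in `𝒪`. These
entries generate `ℂ[G]`, so every function on `G` has an integral value at `g⁻¹ g'`, which thus lies
in `G(𝒪)`. -/
theorem plucker_injective {ρ : Rep A r} (hρ : ρ.IsClosedEmbedding) (k d : ℕ) :
    Function.Injective (plucker ρ k d) := by
  rintro ⟨x, hx⟩ ⟨y, hy⟩ hxy
  have h1 : lattice ρ x = lattice ρ y := by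
    rw [← ofWindow_map_window hx.1 hx.2.1, ← ofWindow_map_window hy.1 hy.2.1,
      pluckerPoint_injective hxy]
  apply Subtype.ext
  change x = y
  induction x using QuotientGroup.induction_on with | _ g
  induction y using QuotientGroup.induction_on with | _ g'
  replace h1 : latticeOf ρ g = latticeOf ρ g' := h1
  have key : ∀ g g' : Points A KK, latticeOf ρ g = latticeOf ρ g' →
      ∀ i j, ρ.mat (g⁻¹ * g') i j ∈ intK := by
    intro g g' h i j
    have h2 : (ρ.mat g').mulVec (Pi.single j 1) ∈ latticeOf ρ g := by
      rw [h]
      refine ⟨_, mem_stdLattice_zero.mpr fun i => ?_, rfl⟩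
      rw [Pi.single_apply]
      split_ifs
      exacts [one_mem _, zero_mem _]
    obtain ⟨w, hw, hw'⟩ := h2
    replace hw' : (ρ.mat g).mulVec w = (ρ.mat g').mulVec (Pi.single j 1) := hw'
    have h3 : (ρ.mat (g⁻¹ * g')).mulVec (Pi.single j 1) = w := by
      rw [ρ.mat_mul, ← Matrix.mulVec_mulVec, ← hw', Matrix.mulVec_mulVec, ← ρ.mat_mul,
        inv_mul_cancel, ρ.mat_one, Matrix.one_mulVec]
    have h4 := congrFun h3 i
    rw [Matrix.mulVec_single_one] at h4
    change ρ.mat (g⁻¹ * g') i j = w i at h4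
    rw [h4]
    exact mem_stdLattice_zero.mp hw i
  rw [QuotientGroup.eq]
  have h2 : ∀ a, (g⁻¹ * g').eval a ∈ intK := by
    intro a
    have ha : a ∈ (intK.comap (g⁻¹ * g').eval : Subalgebra ℂ A) := by
      have h3 : (⊤ : Subalgebra ℂ A) ≤ intK.comap (g⁻¹ * g').eval := by
        rw [← hρ, Algebra.adjoin_le_iff]
        rintro _ (⟨p, rfl⟩ | ⟨p, rfl⟩)
        · exact key g g' h1 p.1 p.2
        · have h4 := key g' g h1.symm p.1 p.2
          rw [show g'⁻¹ * g = (g⁻¹ * g')⁻¹ by simp] at h4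
          exact h4
      exact h3 trivial
    exact ha
  let e : OO ≃ₐ[ℂ] intK := AlgEquiv.ofInjective incl incl_injective
  let f : A →ₐ[ℂ] OO := (e.symm : intK →ₐ[ℂ] OO).comp ((g⁻¹ * g').eval.codRestrict intK h2)
  refine ⟨Points.ofHom f, ?_⟩
  apply Points.ext
  intro a
  change incl (e.symm ⟨(g⁻¹ * g').eval a, h2 a⟩) = _
  exact congrArg Subtype.val (e.apply_symm_apply ⟨(g⁻¹ * g').eval a, h2 a⟩)

end SpringerClosed

/-! ### Integrality of a homogeneous extension with finite fibres -/

/-- The product of denominators for finitely many generators of `R` serves for all elements, at the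
price of a power. -/
theorem exists_denominator {F R : Type*} [Field F] [CommRing R] [IsDomain R] [Algebra F R]
    [Algebra.FiniteType F R] (C : Subalgebra F R) (halg : ∀ a : R, IsAlgebraic C a) :
    ∃ b : C, b ≠ 0 ∧ ∀ a : R, ∃ k : ℕ, IsIntegral C ((b : R) ^ k * a) := by
  classical
  obtain ⟨s, hs⟩ := Algebra.FiniteType.out (R := F) (A := R)
  choose c hc0 hc using fun a => (halg a).exists_integral_multiple
  refine ⟨∏ a ∈ s, c a, Finset.prod_ne_zero_iff.mpr fun a _ => hc0 a, fun a => ?_⟩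
  set b := ∏ a ∈ s, c a with hb
  have hbi : ∀ k : ℕ, IsIntegral C ((b : R) ^ k) := fun k =>
    (isIntegral_algebraMap (R := C) (x := b)).pow k
  have ha : a ∈ Algebra.adjoin F (s : Set R) := hs ▸ trivial
  induction ha using Algebra.adjoin_induction with
  | mem x hx =>
    refine ⟨1, ?_⟩
    have h1 : b = (∏ a ∈ s.erase x, c a) * c x := (Finset.prod_erase_mul _ _ hx).symm
    rw [pow_one, h1, MulMemClass.coe_mul, mul_assoc]
    exact (isIntegral_algebraMap (R := C) (x := ∏ a ∈ s.erase x, c a)).mul (hc x)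
  | algebraMap r =>
    refine ⟨0, ?_⟩
    rw [pow_zero, one_mul]
    exact isIntegral_algebraMap (R := C) (x := algebraMap F C r)
  | add x y _ _ hx hy =>
    obtain ⟨k, hk⟩ := hx
    obtain ⟨l, hl⟩ := hy
    refine ⟨k + l, ?_⟩
    have : (b : R) ^ (k + l) * (x + y) = b ^ l * (b ^ k * x) + b ^ k * (b ^ l * y) := by ring
    rw [this]
    exact ((hbi l).mul hk).add ((hbi k).mul hl)
  | mul x y _ _ hx hy =>
    obtain ⟨k, hk⟩ := hx
    obtain ⟨l, hl⟩ := hy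
    refine ⟨k + l, ?_⟩
    have : (b : R) ^ (k + l) * (x * y) = (b ^ k * x) * (b ^ l * y) := by ring
    rw [this]
    exact hk.mul hl

section Homogeneous

variable {F S R : Type*} [Field F] [IsAlgClosed F] [CommRing R] [IsDomain R] [Algebra F R]
  [Algebra.FiniteType F R]

/-- A dominant morphism of varieties is surjective over a nonempty open set. -/
theorem exists_lift_of_injective [CommRing S] [IsDomain S] [Algebra F S] [Algebra.FiniteType F S]
    (φ : S →ₐ[F] R) (hφ : Function.Injective φ) :
    ∃ s : S, s ≠ 0 ∧ ∀ y : S →ₐ[F] F, y s ≠ 0 → ∃ x : R →ₐ[F] F, x.comp φ = y := by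
  have : IsNoetherianRing S := Algebra.FiniteType.isNoetherianRing F S
  have hft : (φ : S →+* R).FiniteType := by
    refine RingHom.FiniteType.of_comp_finiteType (f := algebraMap F S) ?_
    have : (φ : S →+* R).comp (algebraMap F S) = algebraMap F R := φ.comp_algebraMap
    rw [this, RingHom.finiteType_algebraMap]
    infer_instance
  -- Chevalley: the image on spectra is constructible, and it contains the generic point by
  -- injectivity.
  have hc := PrimeSpectrum.isConstructible_range_comap
    (RingHom.FinitePresentation.of_finiteType.mp hft)
  obtain ⟨T, hT⟩ := PrimeSpectrum.exists_constructibleSetData_iff.mpr hc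
  have hbot : (⊥ : PrimeSpectrum S) ∈ T.toSet := by
    rw [hT]
    refine ⟨⊥, PrimeSpectrum.ext ?_⟩
    change Ideal.comap (φ : S →+* R) ⊥ = ⊥
    exact Ideal.comap_bot_of_injective _ hφ
  simp only [PrimeSpectrum.ConstructibleSetData.toSet, Set.mem_iUnion] at hbot
  -- In the basic constructible set containing the generic point all closed conditions are trivial,
  -- so it is the open set where `B.f` does not vanish.
  obtain ⟨B, hB, hB1, hB2⟩ := hbot
  refine ⟨B.f, ?_, fun y hy => ?_⟩
  · rintro h0
    apply hB2
    rw [h0]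
    simp
  · have hp : (RingHom.ker (y : S →+* F)).IsPrime := RingHom.ker_isPrime _
    have hmem : (⟨RingHom.ker (y : S →+* F), hp⟩ : PrimeSpectrum S) ∈ T.toSet := by
      simp only [PrimeSpectrum.ConstructibleSetData.toSet, Set.mem_iUnion]
      refine ⟨B, hB, ?_, ?_⟩
      · rintro _ ⟨i, rfl⟩
        have h1 : B.g i ∈ (⊥ : Ideal S) := hB1 ⟨i, rfl⟩
        rw [Ideal.mem_bot.mp h1]
        exact Ideal.zero_mem _
      · intro h
        exact hy (h rfl)
    rw [hT] at hmem
    obtain ⟨q, hq⟩ := hmem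
    obtain ⟨x, hx⟩ := exists_algHom_of_ideal_ne_top (k := F) q.2.ne_top
    refine ⟨x, AlgHom.ext fun s => ?_⟩
    have h1 : s - algebraMap F S (y s) ∈ RingHom.ker (y : S →+* F) := by
      rw [RingHom.mem_ker]
      simp
    have h2 : s - algebraMap F S (y s) ∈ Ideal.comap (φ : S →+* R) q.asIdeal := by
      have h3 := congrArg PrimeSpectrum.asIdeal hq
      change Ideal.comap (φ : S →+* R) q.asIdeal = _ at h3
      rw [h3]
      exact h1
    have h3 := hx _ h2
    rw [RingHom.coe_coe, map_sub, map_sub, AlgHom.commutes, AlgHom.commutes, sub_eq_zero] at h3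
    exact h3

variable (C : Subalgebra F R) [Algebra.FiniteType F C]

/-- If `a` were transcendental, `C[t]` would embed in `R` by `t ↦ a`. Over a suitable point of `C`
the function `a` would then take all but finitely many values, so the fibre would be infinite. -/
theorem isAlgebraic_of_finite_fibres
    (hfin : ∀ y : C →ₐ[F] F, {x : R →ₐ[F] F | x.comp C.val = y}.Finite) (a : R) :
    IsAlgebraic C a := by
  by_contra ha
  let φ : Polynomial C →ₐ[F] R := (Polynomial.aeval (R := C) a).restrictScalars F
  have hφ : Function.Injective φ := by
    exact transcendental_iff_injective.mp ha
  obtain ⟨p, hp, hlift⟩ := exists_lift_of_injective φ hφ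
  obtain ⟨j, hj⟩ : ∃ j, p.coeff j ≠ 0 := by
    by_contra! h
    exact hp (Polynomial.ext h)
  obtain ⟨y, hy⟩ := exists_algHom_ne_zero (k := F) hj
  have hpy : p.map (y : C →+* F) ≠ 0 := by
    intro h
    have := congrArg (fun q => q.coeff j) h
    rw [Polynomial.coeff_map, Polynomial.coeff_zero] at this
    exact hy this
  let yt : F → Polynomial C →ₐ[F] F := fun t =>
    ((Polynomial.aeval t).restrictScalars F).comp (Polynomial.mapAlgHom y)
  have hyt : ∀ t q, yt t q = (q.map (y : C →+* F)).eval t := fun t q => by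
    change Polynomial.aeval t _ = _
    rw [Polynomial.coe_aeval_eq_eval]
    rfl
  have h1 : ∀ t : {t : F // (p.map (y : C →+* F)).eval t ≠ 0},
      ∃ x : R →ₐ[F] F, x.comp φ = yt t := fun t => hlift _ (by rw [hyt]; exact t.2)
  choose x hx using h1
  have hxa : ∀ t, x t a = t := by
    intro t
    have := DFunLike.congr_fun (hx t) Polynomial.X
    rw [hyt] at this
    simpa [φ] using this
  have hxC : ∀ t, (x t).comp C.val = y := by
    intro t
    ext c
    have := DFunLike.congr_fun (hx t) (Polynomial.C c)
    rw [hyt] at this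
    simpa [φ] using this
  have : Finite ({t : F | (p.map (y : C →+* F)).eval t ≠ 0} : Set F) := by
    have := (hfin y).to_subtype
    refine Finite.of_injective
      (fun t => (⟨x t, hxC t⟩ : {x : R →ₐ[F] F | x.comp C.val = y})) fun t t' h => ?_
    apply Subtype.ext
    have h' : x t = x t' := congrArg Subtype.val h
    rw [← hxa t, ← hxa t', h']
  have h2 : ({t : F | (p.map (y : C →+* F)).eval t ≠ 0} ∪
      {t : F | (p.map (y : C →+* F)).eval t = 0}).Finite := by
    exact Set.Finite.union (Set.toFinite {t : F | (p.map (y : C →+* F)).eval t ≠ 0})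
      (Polynomial.finite_setOfPred_isRoot hpy)
  refine Set.infinite_univ (α := F) (h2.subset fun t _ => ?_)
  rcases eq_or_ne ((p.map (y : C →+* F)).eval t) 0 with h | h
  exacts [Or.inr h, Or.inl h]

/-- A morphism of affine varieties that is surjective, with finite fibres, and equivariant
for a transitive group of automorphisms of the source is finite. -/
theorem isIntegral_of_homogeneous
    (hsurj : ∀ y : C →ₐ[F] F, ∃ x : R →ₐ[F] F, x.comp C.val = y)
    (hfin : ∀ y : C →ₐ[F] F, {x : R →ₐ[F] F | x.comp C.val = y}.Finite)
    (htrans : ∀ x x' : R →ₐ[F] F, ∃ τ : R ≃ₐ[F] R, x.comp τ = x' ∧ C.map (τ : R →ₐ[F] R) ≤ C)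
    (a : R) : IsIntegral C a := by
  obtain ⟨b, hb, hbint⟩ := exists_denominator C (isAlgebraic_of_finite_fibres C hfin)
  have hb' : (b : R) ≠ 0 := fun h => hb (Subtype.ext h)
  obtain ⟨x₀, hx₀⟩ := exists_algHom_ne_zero (k := F) hb'
  -- The ideal of denominators of `a`. It is shown to have no zeros, so that it contains `1`.
  let J : Ideal C :=
    { carrier := {c | IsIntegral C ((c : R) * a)}
      zero_mem' := by
        rw [Set.mem_ofPred_eq, ZeroMemClass.coe_zero, zero_mul]
        exact isIntegral_zero
      add_mem' := by
        intro c c' hc hc'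
        rw [Set.mem_ofPred_eq, AddMemClass.coe_add, add_mul]
        exact hc.add hc'
      smul_mem' := by
        intro c c' hc'
        rw [Set.mem_ofPred_eq, smul_eq_mul, MulMemClass.coe_mul, mul_assoc]
        exact (isIntegral_algebraMap (R := C) (x := c)).mul hc' }
  have hJ : J = ⊤ := by
    by_contra hJ
    obtain ⟨y, hy⟩ := exists_algHom_of_ideal_ne_top (k := F) hJ
    obtain ⟨x, rfl⟩ := hsurj y
    -- `τ` moves a supposed zero `x` of `J` to the point `x₀` where `b` does not vanish. Applying
    -- `τ` to the integral element `bᵏ τ⁻¹(a)` shows `τ(b)ᵏ ∈ J`, although `τ(b)` is nonzero at `x`.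
    obtain ⟨τ, hτ, hτC⟩ := htrans x x₀
    obtain ⟨k, hk⟩ := hbint (τ.symm a)
    let τC : C →ₐ[F] C := ((τ : R →ₐ[F] R).comp C.val).codRestrict C fun c =>
      hτC ⟨c, c.2, rfl⟩
    have h1 : IsIntegral C (τ ((b : R) ^ k * τ.symm a)) :=
      IsIntegral.map_of_comp_eq (τC : C →+* C) (τ : R →+* R) (RingHom.ext fun _ => rfl) hk
    rw [map_mul, map_pow, AlgEquiv.apply_symm_apply] at h1
    have h2 := hy (τC b ^ k) h1
    rw [map_pow] at h2
    refine pow_ne_zero k ?_ h2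
    change x (τ b) ≠ 0
    rw [← hτ] at hx₀
    exact hx₀
  have h1 : (1 : C) ∈ J := hJ ▸ trivial
  change IsIntegral C (((1 : C) : R) * a) at h1
  rwa [OneMemClass.coe_one, one_mul] at h1

end Homogeneous

/-! ### Base change of the coordinate ring -/

section BaseChange

theorem repr_lift_eq {F A ι : Type*} [CommRing F] [Algebra ℂ F] [CommRing A] [Algebra ℂ A]
    [DecidableEq ι] (B : Module.Basis ι ℂ F) (p : A →ₐ[ℂ] ℂ) (w : F ⊗[ℂ] A) (i : ι) :
    B.repr (Algebra.TensorProduct.lift (AlgHom.id F F)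
      ((Algebra.ofId ℂ F).comp p) (fun _ _ => .all _ _) w) i =
      p (TensorProduct.equivFinsuppOfBasisLeft B w i) := by
  induction w with
  | zero => simp
  | add x y hx hy => simp only [map_add, Finsupp.add_apply, hx, hy]
  | tmul x y =>
    have h2 : x * algebraMap ℂ F (p y) = p y • x := by rw [Algebra.smul_def, mul_comm]
    rw [TensorProduct.equivFinsuppOfBasisLeft_apply_tmul_apply, map_smul,
      Algebra.TensorProduct.lift_tmul]
    change B.repr (x * algebraMap ℂ F (p y)) i = _
    rw [h2, map_smul, Finsupp.smul_apply, smul_eq_mul, smul_eq_mul, mul_comm]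

/-- The coordinates with respect to a basis of `F` over `ℂ` are elements of `A`, which are
determined by their values at complex points. -/
theorem tensor_ext_of_points {F A : Type*} [CommRing F] [Algebra ℂ F] [CommRing A] [Algebra ℂ A]
    [Algebra.FiniteType ℂ A] [IsReduced A] {u v : F ⊗[ℂ] A}
    (h : ∀ p : A →ₐ[ℂ] ℂ, Algebra.TensorProduct.lift (AlgHom.id F F)
      ((Algebra.ofId ℂ F).comp p) (fun _ _ => .all _ _) u =
        Algebra.TensorProduct.lift (AlgHom.id F F)
          ((Algebra.ofId ℂ F).comp p) (fun _ _ => .all _ _) v) : u = v := by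
  classical
  let B := Module.Free.chooseBasis ℂ F
  apply (TensorProduct.equivFinsuppOfBasisLeft (N := A) B).injective
  refine Finsupp.ext fun i => eq_of_forall_algHom_eq (k := ℂ) fun p => ?_
  rw [← repr_lift_eq, ← repr_lift_eq, h]

/-- A nonzero element has a nonzero coordinate in `A`, and it is nonzero at all complex points where
this coordinate is. For two elements the product of the coordinates is nonzero in the domain `A`, so
at some complex point neither element vanishes. -/
theorem isDomain_baseChange {F A : Type*} [Field F] [Algebra ℂ F] [CommRing A] [Algebra ℂ A]
    [Algebra.FiniteType ℂ A] [IsDomain A] : IsDomain (F ⊗[ℂ] A) := by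
  classical
  have key : ∀ u : F ⊗[ℂ] A, u ≠ 0 → ∃ a : A, a ≠ 0 ∧ ∀ p : A →ₐ[ℂ] ℂ, p a ≠ 0 →
      Algebra.TensorProduct.lift (AlgHom.id F F) ((Algebra.ofId ℂ F).comp p)
        (fun _ _ => .all _ _) u ≠ 0 := by
    intro u hu
    let B := Module.Free.chooseBasis ℂ F
    obtain ⟨i, hi⟩ : ∃ i, TensorProduct.equivFinsuppOfBasisLeft (N := A) B u i ≠ 0 := by
      by_contra! h
      exact hu ((TensorProduct.equivFinsuppOfBasisLeft B).map_eq_zero_iff.mp (Finsupp.ext h))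
    refine ⟨_, hi, fun p hp h0 => hp ?_⟩
    rw [← repr_lift_eq, h0, map_zero, Finsupp.zero_apply]
  have : Nontrivial (F ⊗[ℂ] A) := inferInstance
  have : NoZeroDivisors (F ⊗[ℂ] A) := by
    refine ⟨fun {u v} huv => ?_⟩
    by_contra! h
    obtain ⟨a, ha, hpa⟩ := key u h.1
    obtain ⟨b, hb, hpb⟩ := key v h.2
    obtain ⟨p, hp⟩ := exists_algHom_ne_zero (k := ℂ) (mul_ne_zero ha hb)
    rw [map_mul] at hp
    have h1 := mul_ne_zero (hpa p (left_ne_zero_of_mul hp)) (hpb p (right_ne_zero_of_mul hp))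
    rw [← map_mul, huv, map_zero] at h1
    exact h1 rfl
  exact NoZeroDivisors.to_isDomain _

end BaseChange

/-! ### Functions on the group are integral over functions on a stable orbit -/

section GeometricPoints

variable {A : Type*} [CommRing A] [HopfAlgebra ℂ A]

/-- The coordinate ring of the group over the algebraic closure of `𝒦`. -/
abbrev GeomRing (A : Type*) [CommRing A] [Algebra ℂ A] : Type _ := KKbar ⊗[ℂ] A

/-- The evaluation of functions at a geometric point. -/
def geomEval (g : Points A KKbar) : GeomRing A →ₐ[KKbar] KKbar :=
  Algebra.TensorProduct.lift (AlgHom.id KKbar KKbar) g.eval (fun _ _ => .all _ _)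

theorem geomEval_tmul (g : Points A KKbar) (x : KKbar) (a : A) :
    geomEval g (x ⊗ₜ a) = x * g.eval a := by
  simp [geomEval]

theorem exists_geomEval (x : GeomRing A →ₐ[KKbar] KKbar) : ∃ g : Points A KKbar, geomEval g = x := by
  refine ⟨Points.ofHom ((x.restrictScalars ℂ).comp Algebra.TensorProduct.includeRight), ?_⟩
  ext a
  simp [geomEval]

theorem geom_ext [Algebra.FiniteType ℂ A] [IsDomain A] {u v : GeomRing A}
    (h : ∀ g : Points A KKbar, geomEval g u = geomEval g v) : u = v := by
  have : IsDomain (GeomRing A) := isDomain_baseChange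
  refine eq_of_forall_algHom_eq (k := KKbar) fun x => ?_
  obtain ⟨g, rfl⟩ := exists_geomEval x
  exact h g

/-- The translation of functions by a geometric point. -/
def geomTranslate (h : Points A KKbar) : GeomRing A →ₐ[KKbar] GeomRing A :=
  Algebra.TensorProduct.lift (Algebra.ofId KKbar (GeomRing A))
    (Points.ofHom Algebra.TensorProduct.includeRight *
      Points.map ((Algebra.ofId KKbar (GeomRing A)).restrictScalars ℂ) h :
        Points A (GeomRing A)).eval (fun _ _ => .all _ _)

theorem geomEval_geomTranslate (g h : Points A KKbar) (u : GeomRing A) :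
    geomEval g (geomTranslate h u) = geomEval (g * h) u := by
  have h1 : (geomEval g).comp (geomTranslate h) = geomEval (g * h) := by
    ext a
    have h2 : Points.map ((geomEval g).restrictScalars ℂ)
        (Points.ofHom Algebra.TensorProduct.includeRight *
          Points.map ((Algebra.ofId KKbar (GeomRing A)).restrictScalars ℂ) h) = g * h := by
      rw [map_mul]
      congr 1
      · apply Points.ext
        intro a
        simp [geomEval]
      · apply Points.ext
        intro a
        change geomEval g (algebraMap KKbar (GeomRing A) (h.eval a)) = h.eval a
        rw [AlgHom.commutes]
        rfl
    have h3 := congrArg (fun p => p.eval a) h2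
    simp only [Points.map_eval] at h3
    simp only [AlgHom.comp_apply, AlgHom.restrictScalars_apply,
      Algebra.TensorProduct.includeRight_apply, geomEval_tmul, one_mul]
    rw [← h3, geomTranslate, Algebra.TensorProduct.lift_tmul, map_one, one_mul]
    rfl
  exact DFunLike.congr_fun h1 u

/-- Translation as an automorphism. -/
def geomTranslateEquiv [Algebra.FiniteType ℂ A] [IsDomain A] (h : Points A KKbar) :
    GeomRing A ≃ₐ[KKbar] GeomRing A :=
  AlgEquiv.ofAlgHom (geomTranslate h) (geomTranslate h⁻¹)
    (AlgHom.ext fun u => geom_ext fun g => by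
      simp [geomEval_geomTranslate])
    (AlgHom.ext fun u => geom_ext fun g => by
      simp [geomEval_geomTranslate])

/-- A function over `𝒦`, viewed over the algebraic closure. -/
def toGeom (χ : KK ⊗[ℂ] A) : GeomRing A :=
  Algebra.TensorProduct.map ((Algebra.ofId KK KKbar).restrictScalars ℂ) (AlgHom.id ℂ A) χ

theorem geomEval_toGeom (g : Points A KKbar) (χ : KK ⊗[ℂ] A) :
    geomEval g (toGeom χ) = evalBar χ g := by
  induction χ with
  | zero => simp [toGeom, evalBar]
  | add x y hx hy =>
    have h1 : toGeom (x + y) = toGeom x + toGeom y := map_add _ _ _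
    have h2 : evalBar (x + y) g = evalBar x g + evalBar y g := map_add _ _ _
    rw [h1, h2, map_add, hx, hy]
  | tmul x a =>
    rw [toGeom, Algebra.TensorProduct.map_tmul, geomEval_tmul, evalBar,
      Algebra.TensorProduct.lift_tmul]
    rfl

variable {m : ℕ}

/-- The coordinates of `g⁻¹ c`, as functions of `g`. -/
def orbitCoord (ν : Rep A m) (c : Fin m → KK) (i : Fin m) : GeomRing A :=
  ∑ j, toBar c j ⊗ₜ HopfAlgebra.antipode ℂ (ν.coeff i j)

theorem geomEval_orbitCoord (ν : Rep A m) (c : Fin m → KK) (i : Fin m) (g : Points A KKbar) :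
    geomEval g (orbitCoord ν c i) = (ν.mat g⁻¹).mulVec (toBar c) i := by
  simp only [orbitCoord, map_sum, geomEval_tmul, Matrix.mulVec, dotProduct, mul_comm]
  rfl

/-- The functions on the group that come from the orbit map of `c`. -/
def orbitFun (ν : Rep A m) (c : Fin m → KK) (χ : KK ⊗[ℂ] A) (n : ℕ) : Option (Fin m) → GeomRing A :=
  fun i => i.elim (toGeom χ ^ n) (orbitCoord ν c)

theorem geomEval_orbitFun (ν : Rep A m) (c : Fin m → KK) (χ : KK ⊗[ℂ] A) (n : ℕ)
    (g : Points A KKbar) (i : Option (Fin m)) : geomEval g (orbitFun ν c χ n i) =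
      i.elim (evalBar χ g ^ n) ((ν.mat g⁻¹).mulVec (toBar c)) := by
  cases i with
  | none => simp [orbitFun, geomEval_toGeom]
  | some i => simp [orbitFun, geomEval_orbitCoord]

theorem aeval_toBar_ne_zero {c : Fin m → KK} {f : MvPolynomial (Fin m) KK}
    (hfc : MvPolynomial.aeval c f ≠ 0) : MvPolynomial.aeval (toBar c) f ≠ 0 := by
  have : MvPolynomial.aeval (toBar c) f = algebraMap KK KKbar (MvPolynomial.aeval c f) :=
    MvPolynomial.aeval_algebraMap_apply KKbar c f
  rw [this]
  simpa using hfc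

/-- Compute `f (g h c)` in two ways and cancel `f c`. -/
theorem IsSemiInvariant.evalBar_mul {ν : Rep A m} {χ : KK ⊗[ℂ] A} {c : Fin m → KK} {n : ℕ}
    {f : MvPolynomial (Fin m) KK} (hf : IsSemiInvariant ν χ n f)
    (hfc : MvPolynomial.aeval c f ≠ 0) (g h : Points A KKbar) :
    evalBar χ (g * h) ^ n = evalBar χ g ^ n * evalBar χ h ^ n := by
  have h1 := hf (g * h) (toBar c)
  rw [ν.mat_mul, ← Matrix.mulVec_mulVec, hf, hf, ← mul_assoc] at h1
  exact (mul_right_cancel₀ (aeval_toBar_ne_zero hfc) h1).symm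

/-- `isIntegral_of_homogeneous` for `g ↦ (χ(g)ⁿ, g⁻¹ c)`. The relation `χ(g)ⁿ f(g⁻¹ c) = f c`
extends to all points of the closure of the image and keeps `f` nonzero there; so the orbit being
closed in `{f ≠ 0}` gives surjectivity. The fibres are translates of the finite stabilizer, and
right translations of `G` preserve the span of the coordinates of the map. -/
theorem isIntegral_orbitFun [Algebra.FiniteType ℂ A] [IsDomain A] {ν : Rep A m} {χ : KK ⊗[ℂ] A}
    {c : Fin m → KK} {n : ℕ} {f : MvPolynomial (Fin m) KK} (hf : IsSemiInvariant ν χ n f)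
    (hfc : MvPolynomial.aeval c f ≠ 0) (hcl : OrbitClosedIn ν f c)
    (hst : {g : Points A KKbar | (ν.mat g).mulVec (toBar c) = toBar c}.Finite) (u : GeomRing A) :
    IsIntegral (Algebra.adjoin KKbar (Set.range (orbitFun ν c χ n))) u := by
  have : IsDomain (GeomRing A) := isDomain_baseChange
  set e := orbitFun ν c χ n with he
  set C := Algebra.adjoin KKbar (Set.range e) with hC
  have hCft : Algebra.FiniteType KKbar C :=
    (Subalgebra.fg_iff_finiteType _).mp ⟨(Set.finite_range e).toFinset, by rw [Set.Finite.coe_toFinset]⟩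
  let eC : Option (Fin m) → C := fun i => ⟨e i, Algebra.subset_adjoin ⟨i, rfl⟩⟩
  have hext : ∀ (x : GeomRing A →ₐ[KKbar] KKbar) (y : C →ₐ[KKbar] KKbar),
      x.comp C.val = y ↔ ∀ i, x (e i) = y (eC i) := by
    intro x y
    constructor
    · rintro rfl i
      rfl
    · intro h
      ext ⟨w, hw⟩
      change x w = _
      induction hw using Algebra.adjoin_induction with
      | mem w hw =>
        obtain ⟨i, rfl⟩ := hw
        exact h i
      | algebraMap a =>
        rw [AlgHom.commutes]
        exact (y.commutes a).symm
      | add w w' hw hw' h1 h2 =>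
        rw [map_add, h1, h2, ← map_add]
        rfl
      | mul w w' hw hw' h1 h2 =>
        rw [map_mul, h1, h2, ← map_mul]
        rfl
  set fc : KKbar := MvPolynomial.aeval (toBar c) f with hfc'
  have hfc0 : fc ≠ 0 := aeval_toBar_ne_zero hfc
  have hrel : ∀ g : Points A KKbar,
      evalBar χ g ^ n * MvPolynomial.aeval ((ν.mat g⁻¹).mulVec (toBar c)) f = fc := by
    intro g
    rw [← hf, Matrix.mulVec_mulVec, ← ν.mat_mul, mul_inv_cancel, ν.mat_one, Matrix.one_mulVec]
  have hmul := hf.evalBar_mul hfc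
  obtain ⟨I, hI⟩ := hcl
  have horb : ∀ g : Points A KKbar, ∀ P ∈ I,
      MvPolynomial.aeval ((ν.mat g⁻¹).mulVec (toBar c)) P = 0 := by
    intro g P hP
    have h1 : MvPolynomial.aeval ((ν.mat g⁻¹).mulVec (toBar c)) f ≠ 0 := fun h0 =>
      hfc0 (by rw [← hrel g, h0, mul_zero])
    exact MvPolynomial.mem_zeroLocus_iff.mp ((hI _ h1).mp ⟨g⁻¹, rfl⟩) P hP
  have haeval : ∀ (y : C →ₐ[KKbar] KKbar) (P : MvPolynomial (Fin m) KKbar),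
      MvPolynomial.aeval (fun i => y (eC (some i))) P =
        y (MvPolynomial.aeval (fun i => eC (some i)) P) := fun y P =>
    (MvPolynomial.comp_aeval_apply _ y P).symm
  have hpt : ∀ (g : Points A KKbar) (P : MvPolynomial (Fin m) KKbar),
      geomEval g (MvPolynomial.aeval (fun i => eC (some i)) P : C) =
        MvPolynomial.aeval ((ν.mat g⁻¹).mulVec (toBar c)) P := by
    intro g P
    refine (MvPolynomial.comp_aeval_apply _ ((geomEval g).comp C.val) P).trans ?_
    congr 2
    funext i
    exact geomEval_orbitFun ν c χ n g (some i)
  have hsurj : ∀ y : C →ₐ[KKbar] KKbar, ∃ g : Points A KKbar, (geomEval g).comp C.val = y := by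
    intro y
    set v : Fin m → KKbar := fun i => y (eC (some i)) with hv
    have h1 : eC none * MvPolynomial.aeval (fun i => eC (some i))
        (MvPolynomial.map (algebraMap KK KKbar) f) = algebraMap KKbar C fc := by
      apply Subtype.ext
      refine geom_ext fun g => ?_
      rw [MulMemClass.coe_mul, map_mul, hpt, geomEval_orbitFun, Subalgebra.coe_algebraMap,
        AlgHom.commutes, MvPolynomial.aeval_map_algebraMap]
      exact hrel g
    have h2 : y (eC none) * MvPolynomial.aeval v f = fc := by
      have h3 := congrArg y h1
      rw [map_mul, ← haeval, AlgHom.commutes, MvPolynomial.aeval_map_algebraMap] at h3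
      exact h3
    have h3 : MvPolynomial.aeval v f ≠ 0 := fun h0 => hfc0 (by rw [← h2, h0, mul_zero])
    have h4 : v ∈ MvPolynomial.zeroLocus KKbar I := by
      rw [MvPolynomial.mem_zeroLocus_iff]
      intro P hP
      rw [hv, haeval]
      have : MvPolynomial.aeval (fun i => eC (some i)) P = 0 := by
        apply Subtype.ext
        refine geom_ext fun g => ?_
        rw [hpt, horb g P hP, ZeroMemClass.coe_zero, map_zero]
      rw [this, map_zero]
    obtain ⟨h, hh⟩ := (hI v h3).mpr h4
    refine ⟨h⁻¹, (hext _ _).mpr fun i => ?_⟩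
    rw [geomEval_orbitFun, inv_inv]
    cases i with
    | some i => exact congrFun hh i
    | none =>
      -- The value of `χⁿ` is determined by the other coordinates through the relation.
      have h5 := hrel h⁻¹
      rw [inv_inv] at h5
      change (ν.mat h).mulVec (toBar c) = v at hh
      rw [hh, ← h2] at h5
      exact mul_right_cancel₀ h3 h5
  refine isIntegral_of_homogeneous C (fun y => ?_) (fun y => ?_) (fun x x' => ?_) u
  · obtain ⟨g, hg⟩ := hsurj y
    exact ⟨_, hg⟩
  · obtain ⟨g₀, hg₀⟩ := hsurj y
    -- A point `g` in the fibre of `g₀` satisfies `g⁻¹ c = g₀⁻¹ c`, so `s = g₀ g⁻¹` stabilizes `c`.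
    refine (hst.image fun s => geomEval (s⁻¹ * g₀)).subset ?_
    intro x hx
    obtain ⟨g, rfl⟩ := exists_geomEval x
    refine ⟨g₀ * g⁻¹, ?_, by simp⟩
    have h1 : (ν.mat g⁻¹).mulVec (toBar c) = (ν.mat g₀⁻¹).mulVec (toBar c) := by
      funext i
      have h2 := (hext _ _).mp hx (some i)
      have h3 := (hext _ _).mp hg₀ (some i)
      rw [geomEval_orbitFun] at h2 h3
      exact h2.trans h3.symm
    rw [Set.mem_ofPred_eq, ν.mat_mul, ← Matrix.mulVec_mulVec, h1, Matrix.mulVec_mulVec,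
      ← ν.mat_mul, mul_inv_cancel, ν.mat_one, Matrix.one_mulVec]
  · obtain ⟨g, rfl⟩ := exists_geomEval x
    obtain ⟨g', rfl⟩ := exists_geomEval x'
    refine ⟨geomTranslateEquiv (g⁻¹ * g'), ?_, ?_⟩
    · refine AlgHom.ext fun w => ?_
      refine (geomEval_geomTranslate g (g⁻¹ * g') w).trans ?_
      rw [mul_inv_cancel_left]
    · rw [hC, AlgHom.map_adjoin, Algebra.adjoin_le_iff]
      rintro _ ⟨_, ⟨i, rfl⟩, rfl⟩
      set h := g⁻¹ * g'
      cases i with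
      | none =>
        have : geomTranslateEquiv h (e none) = algebraMap KKbar _ (evalBar χ h ^ n) * e none := by
          refine geom_ext fun g => ?_
          refine (geomEval_geomTranslate g h _).trans ?_
          rw [map_mul, AlgHom.commutes, geomEval_orbitFun, geomEval_orbitFun]
          simp [hmul, mul_comm]
        change geomTranslateEquiv h (e none) ∈ C
        rw [this]
        exact C.mul_mem (C.algebraMap_mem _) (Algebra.subset_adjoin ⟨_, rfl⟩)
      | some i =>
        have : geomTranslateEquiv h (e (some i)) = ∑ j, ν.mat h⁻¹ i j • e (some j) := by
          refine geom_ext fun g => ?_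
          refine (geomEval_geomTranslate g h _).trans ?_
          simp only [map_sum, map_smul, he, geomEval_orbitFun, mul_inv_rev, ν.mat_mul,
            ← Matrix.mulVec_mulVec]
          rfl
        change geomTranslateEquiv h (e (some i)) ∈ C
        rw [this]
        exact C.sum_mem fun j _ => C.smul_mem (Algebra.subset_adjoin ⟨_, rfl⟩) _

/-- The value of a function over `𝒦` at a `𝒦`-point. -/
def evalK (χ : KK ⊗[ℂ] A) (g : Points A KK) : KK :=
  Algebra.TensorProduct.lift (AlgHom.id KK KK) g.eval (fun _ _ => .all _ _) χ

/-- The inclusion of `𝒦` into its algebraic closure. -/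
def barHom : KK →ₐ[ℂ] KKbar := (Algebra.ofId KK KKbar).restrictScalars ℂ

theorem evalBar_map (χ : KK ⊗[ℂ] A) (g : Points A KK) :
    evalBar χ (Points.map barHom g) = algebraMap KK KKbar (evalK χ g) := by
  induction χ with
  | zero => simp [evalBar, evalK]
  | add x y hx hy =>
    have h1 : evalK (x + y) g = evalK x g + evalK y g := map_add _ _ _
    have h2 : ∀ g, evalBar (x + y) g = evalBar x g + evalBar y g := fun _ => map_add _ _ _
    rw [h1, h2, map_add, hx, hy]
  | tmul x a =>
    rw [evalBar, evalK, Algebra.TensorProduct.lift_tmul, Algebra.TensorProduct.lift_tmul, map_mul]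
    rfl

/-- Needed to descend integral equations from coefficients in the algebraic closure to coefficients
in `𝒦`. -/
theorem isIntegral_map_bar (σ : Type*) :
    (MvPolynomial.map (algebraMap KK KKbar) :
      MvPolynomial σ KK →+* MvPolynomial σ KKbar).IsIntegral := by
  intro p
  induction p using MvPolynomial.induction_on with
  | C a =>
    obtain ⟨q, hq, hqa⟩ := Algebra.IsIntegral.isIntegral (R := KK) a
    refine ⟨q.map MvPolynomial.C, hq.map _, ?_⟩
    rw [Polynomial.eval₂_map]
    have : (MvPolynomial.map (algebraMap KK KKbar)).comp (MvPolynomial.C (σ := σ)) =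
        MvPolynomial.C.comp (algebraMap KK KKbar) := by
      ext x : 1
      simp
    rw [this, ← Polynomial.hom_eval₂, hqa, map_zero]
  | add p q hp hq => exact RingHom.IsIntegralElem.add _ hp hq
  | mul_X p i hp =>
    refine RingHom.IsIntegralElem.mul _ hp ?_
    rw [← MvPolynomial.map_X (algebraMap KK KKbar) i]
    exact RingHom.isIntegralElem_map _

/-- The entries of a point of the group satisfy monic equations whose coefficients are polynomials
in the coordinates of `g⁻¹ c` and the value of the character. -/
theorem exists_monic_relation [Algebra.FiniteType ℂ A] [IsDomain A] {ν : Rep A m} {χ : KK ⊗[ℂ] A}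
    {c : Fin m → KK} {n : ℕ} {f : MvPolynomial (Fin m) KK} (hf : IsSemiInvariant ν χ n f)
    (hfc : MvPolynomial.aeval c f ≠ 0) (hcl : OrbitClosedIn ν f c)
    (hst : {g : Points A KKbar | (ν.mat g).mulVec (toBar c) = toBar c}.Finite) (a : A) :
      ∃ p : Polynomial (MvPolynomial (Option (Fin m)) KK), p.Monic ∧ ∀ g : Points A KK,
        p.eval₂ (MvPolynomial.eval fun i => i.elim (evalK χ g ^ n) ((ν.mat g⁻¹).mulVec c))
          (g.eval a) = 0 := by
  set e := orbitFun ν c χ n with he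
  let φ : MvPolynomial (Option (Fin m)) KKbar →ₐ[KKbar] GeomRing A := MvPolynomial.aeval e
  have hφ : (φ : MvPolynomial (Option (Fin m)) KKbar →+* GeomRing A).IsIntegral := by
    let C := Algebra.adjoin KKbar (Set.range e)
    have hφC : ∀ q, φ q ∈ C := fun q => by
      simp only [C, Algebra.adjoin_range_eq_range_aeval]
      exact ⟨q, rfl⟩
    have hψ : Function.Surjective (φ.codRestrict C hφC) := by
      rintro ⟨x, hx⟩
      have hx' := hx
      simp only [C, Algebra.adjoin_range_eq_range_aeval] at hx'
      obtain ⟨q, hq⟩ := hx'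
      exact ⟨q, Subtype.ext hq⟩
    have h1 := RingHom.isIntegral_of_surjective
      (φ.codRestrict C hφC : MvPolynomial (Option (Fin m)) KKbar →+* C) hψ
    exact h1.trans _ (algebraMap C (GeomRing A))
      fun u => isIntegral_orbitFun hf hfc hcl hst u
  obtain ⟨p, hp, hpa⟩ := (isIntegral_map_bar _).trans _ _ hφ (1 ⊗ₜ a)
  refine ⟨p, hp, fun g => ?_⟩
  apply (algebraMap KK KKbar).injective
  rw [map_zero, Polynomial.hom_eval₂]
  have h1 := congrArg (geomEval (Points.map barHom g) : GeomRing A →+* KKbar) hpa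
  rw [map_zero, Polynomial.hom_eval₂] at h1
  refine Eq.trans ?_ h1
  congr 1
  · apply MvPolynomial.ringHom_ext
    · intro x
      simp only [RingHom.comp_apply, MvPolynomial.eval_C, MvPolynomial.map_C, RingHom.coe_coe, φ,
        MvPolynomial.aeval_C, AlgHom.commutes]
      rfl
    · intro i
      have h2 := geomEval_orbitFun ν c χ n (Points.map barHom g) i
      simp only [RingHom.comp_apply, MvPolynomial.eval_X, MvPolynomial.map_X, RingHom.coe_coe, φ,
        MvPolynomial.aeval_X]
      refine Eq.trans ?_ h2.symm
      cases i with
      | none =>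
        change algebraMap KK KKbar (evalK χ g ^ n) = _
        rw [map_pow, ← evalBar_map]
        rfl
      | some i =>
        change algebraMap KK KKbar ((ν.mat g⁻¹).mulVec c i) =
          (ν.mat (Points.map barHom g)⁻¹).mulVec (toBar c) i
        rw [← map_inv]
        simp only [Matrix.mulVec, dotProduct, map_sum, map_mul]
        rfl
  · rw [RingHom.coe_coe, geomEval_tmul, one_mul]
    rfl

end GeometricPoints

/-! ### Bounds on group elements -/

theorem exists_eval_bound {σ : Type*} (e : ℕ) (p : MvPolynomial σ KK) :
    ∃ M : ℕ, ∀ x : σ → KK, (∀ i, zp e * x i ∈ intK) → zp M * MvPolynomial.eval x p ∈ intK := by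
  induction p using MvPolynomial.induction_on with
  | C a =>
    obtain ⟨M, hM⟩ := exists_zp_mul_mem_intK a
    exact ⟨M, fun x _ => by rwa [MvPolynomial.eval_C]⟩
  | add p q hp hq =>
    obtain ⟨M, hM⟩ := hp
    obtain ⟨N, hN⟩ := hq
    refine ⟨M + N, fun x hx => ?_⟩
    rw [map_add, mul_add]
    exact add_mem (zp_mul_mem_intK_of_le (by push_cast; omega) (hM x hx))
      (zp_mul_mem_intK_of_le (by push_cast; omega) (hN x hx))
  | mul_X p i hp =>
    obtain ⟨M, hM⟩ := hp
    refine ⟨M + e, fun x hx => ?_⟩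
    have : zp ((M + e : ℕ) : ℤ) * MvPolynomial.eval x (p * MvPolynomial.X i) =
        (zp M * MvPolynomial.eval x p) * (zp e * x i) := by
      rw [Nat.cast_add, zp_add, map_mul, MvPolynomial.eval_X]
      ring
    rw [this]
    exact mul_mem (hM x hx) (hx i)

theorem mem_intK_of_monic {q : Polynomial KK} (hq : q.Monic) (hc : ∀ i, q.coeff i ∈ intK) {x : KK}
    (hx : q.eval x = 0) : x ∈ intK := by
  have hl : q ∈ Polynomial.lifts (algebraMap OO KK) := by
    rw [Polynomial.lifts_iff_coeff_lifts]
    exact hc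
  obtain ⟨p, hp, -, hpm⟩ := Polynomial.lifts_and_natDegree_eq_and_monic hl hq
  have hint : IsIntegral OO x := ⟨p, hpm, by rw [← Polynomial.eval_map, hp, hx]⟩
  exact IsIntegrallyClosed.isIntegral_iff.mp hint

/-- Scaling the roots by `zᴹ` multiplies each coefficient below the leading one by a positive power
of `zᴹ`, which makes it integral; and `𝒪` is integrally closed. -/
theorem zp_mul_mem_intK_of_monic {q : Polynomial KK} (hq : q.Monic) {M : ℕ}
    (hc : ∀ i, zp M * q.coeff i ∈ intK) {x : KK} (hx : q.eval x = 0) : zp M * x ∈ intK := by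
  refine mem_intK_of_monic ((Polynomial.monic_scaleRoots_iff (zp M)).mpr hq) (fun i => ?_)
    (x := zp M * x) ?_
  · rw [Polynomial.coeff_scaleRoots]
    rcases lt_trichotomy i q.natDegree with h | h | h
    · obtain ⟨j, hj⟩ : ∃ j, q.natDegree - i = j + 1 := ⟨q.natDegree - i - 1, by omega⟩
      rw [hj, pow_succ', ← mul_assoc, mul_comm (q.coeff i)]
      exact mul_mem (hc i) (pow_mem (zp_mem_intK (by omega)) _)
    · rw [h, hq.coeff_natDegree, Nat.sub_self, pow_zero, mul_one]
      exact one_mem _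
    · rw [Polynomial.coeff_eq_zero_of_natDegree_lt h, zero_mul]
      exact zero_mem _
  · have := Polynomial.scaleRoots_eval₂_eq_zero (p := q) (RingHom.id KK) (s := zp M) (r := x) hx
    simpa using this

section Bound

variable {A : Type*} [CommRing A] [HopfAlgebra ℂ A] {m : ℕ}

/-- The monic relation is the same for all `g`, so bounds for `g⁻¹ c` and `χ(g)ⁿ` bound its
coefficients uniformly, and hence its roots. -/
theorem exists_point_bound [Algebra.FiniteType ℂ A] [IsDomain A] {ν : Rep A m} {χ : KK ⊗[ℂ] A}
    {c : Fin m → KK} {n : ℕ} {f : MvPolynomial (Fin m) KK} (hf : IsSemiInvariant ν χ n f)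
    (hfc : MvPolynomial.aeval c f ≠ 0) (hcl : OrbitClosedIn ν f c)
    (hst : {g : Points A KKbar | (ν.mat g).mulVec (toBar c) = toBar c}.Finite) (e : ℕ) (a : A) :
      ∃ M : ℕ, ∀ g : Points A KK, (∀ i, (ν.mat g⁻¹).mulVec c i ∈ intK) →
        zp e * evalK χ g ^ n ∈ intK → zp M * g.eval a ∈ intK := by
  obtain ⟨p, hp, hpa⟩ := exists_monic_relation hf hfc hcl hst a
  choose N hN using fun i => exists_eval_bound e (p.coeff i)
  refine ⟨∑ i ∈ Finset.range (p.natDegree + 1), N i, fun g hg hgχ => ?_⟩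
  have h1 := hpa g
  rw [← Polynomial.eval_map] at h1
  refine zp_mul_mem_intK_of_monic (hp.map _) (fun i => ?_) h1
  rw [Polynomial.coeff_map]
  rcases le_or_gt i p.natDegree with hi | hi
  · refine zp_mul_mem_intK_of_le ?_ (hN i _ fun j => ?_)
    · exact_mod_cast Finset.single_le_sum (f := N) (fun _ _ => Nat.zero_le _)
        (Finset.mem_range.mpr (Nat.lt_succ_of_le hi))
    · cases j with
      | none => exact hgχ
      | some j => exact mul_mem (zp_mem_intK (by omega)) (hg j)
  · rw [Polynomial.coeff_eq_zero_of_natDegree_lt hi, map_zero, mul_zero]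
    exact zero_mem _

end Bound

/-! ### Characters -/

section Character

variable {A : Type*} [CommRing A] [HopfAlgebra ℂ A]

theorem mem_range_of_isIntegral {x : KK} (hx : IsIntegral ℂ x) : ∃ a : ℂ, algebraMap ℂ KK a = x :=
  hx.mem_range_algebraMap_of_minpoly_splits (K := ℂ) (IsAlgClosed.splits _)

/-- A multiplicative function over `𝒦` on the group is defined over `ℂ`. -/
theorem exists_eq_one_tmul [Algebra.FiniteType ℂ A] [IsReduced A] {u : KK ⊗[ℂ] A}
    (hmul : ∀ g h : Points A KK, evalK u (g * h) = evalK u g * evalK u h) (hone : evalK u 1 = 1) :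
    ∃ x : A, u = 1 ⊗ₜ x := by
  let val : Points A ℂ → KK := fun g => evalK u (Points.map (Algebra.ofId ℂ KK) g)
  obtain ⟨s, hs⟩ : ∃ s : Finset KK, ∀ g, val g ∈ Submodule.span ℂ (s : Set KK) := by
    have key : ∀ w : KK ⊗[ℂ] A, ∃ s : Finset KK, ∀ g : Points A ℂ,
        evalK w (Points.map (Algebra.ofId ℂ KK) g) ∈ Submodule.span ℂ (s : Set KK) := by
      classical
      intro w
      induction w with
      | zero => exact ⟨∅, fun g => by simp [evalK]⟩
      | tmul x a =>
        refine ⟨{x}, fun g => ?_⟩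
        have : evalK (x ⊗ₜ a) (Points.map (Algebra.ofId ℂ KK) g) = g.eval a • x := by
          rw [evalK, Algebra.TensorProduct.lift_tmul, Algebra.smul_def, mul_comm]
          rfl
        rw [this]
        exact Submodule.smul_mem _ _ (Submodule.subset_span (by simp))
      | add x y hx hy =>
        obtain ⟨s, hs⟩ := hx
        obtain ⟨t, ht⟩ := hy
        refine ⟨s ∪ t, fun g => ?_⟩
        rw [Finset.coe_union, Submodule.span_union]
        have h1 : ∀ g', evalK (x + y) g' = evalK x g' + evalK y g' := fun _ => map_add _ _ _
        rw [h1]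
        exact Submodule.add_mem_sup (hs g) (ht g)
    exact key u
  -- The values at complex points span a finite-dimensional space, stable under multiplication by
  -- each value. So the values are integral over `ℂ`, which means complex.
  let V : Submodule ℂ KK := Submodule.span ℂ (Set.range val)
  have hVfg : V.FG := by
    have : V ≤ Submodule.span ℂ (s : Set KK) := by
      rw [Submodule.span_le]
      rintro _ ⟨g, rfl⟩
      exact hs g
    have hfin : Module.Finite ℂ (Submodule.span ℂ (s : Set KK)) :=
      Module.Finite.span_finset ℂ s
    exact Submodule.FG.of_le ⟨s, rfl⟩ this
  have hval1 : val 1 = 1 := by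
    simp only [val, map_one, hone]
  have hV : V ≠ ⊥ := by
    intro h
    have h1 : val 1 ∈ V := Submodule.subset_span ⟨1, rfl⟩
    rw [h, Submodule.mem_bot, hval1] at h1
    exact one_ne_zero h1
  have hint : ∀ g, ∃ a : ℂ, algebraMap ℂ KK a = val g := by
    intro g
    refine mem_range_of_isIntegral (isIntegral_of_smul_mem_submodule V hV hVfg _ fun v hv => ?_)
    induction hv using Submodule.span_induction with
    | mem v hv =>
      obtain ⟨h, rfl⟩ := hv
      refine Submodule.subset_span ⟨g * h, ?_⟩
      simp only [val, map_mul, hmul, smul_eq_mul]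
    | zero => rw [smul_zero]; exact V.zero_mem
    | add v w _ _ hv hw => rw [smul_add]; exact V.add_mem hv hw
    | smul a v _ hv => rw [smul_comm]; exact V.smul_mem a hv
  -- As all values at complex points are constants, taking the coefficient of `z⁰` in the first
  -- factor changes nothing.
  refine ⟨TensorProduct.lid ℂ A ((coeffK 0).rTensor A u), tensor_ext_of_points fun p => ?_⟩
  obtain ⟨a, ha⟩ := hint (Points.ofHom p)
  have h1 : ∀ w : KK ⊗[ℂ] A, p (TensorProduct.lid ℂ A ((coeffK 0).rTensor A w)) =
      coeffK 0 (Algebra.TensorProduct.lift (AlgHom.id KK KK)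
        ((Algebra.ofId ℂ KK).comp p) (fun _ _ => .all _ _) w) := by
    intro w
    induction w with
    | zero => simp
    | add x y hx hy => simp only [map_add, hx, hy]
    | tmul x y =>
      rw [Algebra.TensorProduct.lift_tmul, LinearMap.rTensor_tmul, TensorProduct.lid_tmul, map_smul,
        smul_eq_mul, mul_comm]
      change _ = coeffK 0 (x * algebraMap ℂ KK (p y))
      rw [mul_comm x, coeffK_algebraMap_mul]
  change val (Points.ofHom p) = _
  rw [Algebra.TensorProduct.lift_tmul, map_one, one_mul]
  change _ = algebraMap ℂ KK (p _)
  rw [h1]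
  change val (Points.ofHom p) = algebraMap ℂ KK (coeffK 0 (val (Points.ofHom p)))
  rw [← ha]
  congr 1
  have h2 := coeffK_algebraMap_mul a 1 0
  rw [mul_one, ← zp_zero, coeffK_zp, if_pos rfl, mul_one] at h2
  exact h2.symm

theorem tensor_ext_of_point_pairs [Algebra.FiniteType ℂ A] [IsReduced A] {u v : A ⊗[ℂ] A}
    (h : ∀ p q : A →ₐ[ℂ] ℂ, Algebra.TensorProduct.lift p q (fun _ _ => .all _ _) u =
      Algebra.TensorProduct.lift p q (fun _ _ => .all _ _) v) : u = v := by
  refine tensor_ext_of_points fun q => eq_of_forall_algHom_eq (k := ℂ) fun p => ?_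
  have key : ∀ w : A ⊗[ℂ] A, p (Algebra.TensorProduct.lift (AlgHom.id A A)
      ((Algebra.ofId ℂ A).comp q) (fun _ _ => .all _ _) w) =
        Algebra.TensorProduct.lift p q (fun _ _ => .all _ _) w := by
    intro w
    induction w with
    | zero => simp
    | add x y hx hy => simp only [map_add, hx, hy]
    | tmul x y =>
      rw [Algebra.TensorProduct.lift_tmul, Algebra.TensorProduct.lift_tmul, map_mul]
      congr 1
      exact p.commutes (q y)
  rw [key, key, h]

/-- The one-dimensional representation given by a multiplicative function. -/
def charRep [Algebra.FiniteType ℂ A] [IsReduced A] (x : A)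
    (hmul : ∀ g h : Points A ℂ, (g * h).eval x = g.eval x * h.eval x)
    (hone : (1 : Points A ℂ).eval x = 1) : Rep A 1 where
  coeff := Matrix.of fun _ _ => x
  comul_coeff _ _ := by
    rw [Fin.sum_univ_one]
    refine tensor_ext_of_point_pairs fun p q => ?_
    rw [Algebra.TensorProduct.lift_tmul]
    exact (Points.mul_eval (Points.ofHom p) (Points.ofHom q) x).symm.trans
      (hmul (Points.ofHom p) (Points.ofHom q))
  counit_coeff i j := by
    rw [Subsingleton.elim i j, Matrix.one_apply_eq]
    exact hone

/-- The complement of a condition on the pole of `x` becomes a condition of the same kind on `x⁻¹`.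
-/
theorem not_mem_intK_iff {x : KK} (hx : x ≠ 0) : x ∉ intK ↔ zp (-1) * x⁻¹ ∈ intK := by
  have hz : zp (-1) ∉ intK := by
    rw [mem_intK]
    intro h
    have := h (-1) (by norm_num)
    rw [coeffK_zp, if_pos rfl] at this
    exact one_ne_zero this
  constructor
  · intro h
    rcases ValuationRing.isInteger_or_isInteger OO x with h1 | h1
    · exact absurd h1 h
    · have h2 : x⁻¹ ∈ intK := h1
      rw [zp_mul_mem_intK]
      intro j hj
      rcases lt_or_ge j 0 with h0 | h0
      · exact mem_intK.mp h2 j h0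
      · obtain rfl : j = 0 := by omega
        by_contra hc
        obtain ⟨f, hf⟩ := h2
        replace hf : incl f = x⁻¹ := hf
        have hu : IsUnit f := by
          rw [PowerSeries.isUnit_iff_constantCoeff, isUnit_iff_ne_zero, constantCoeff_eq_coeffK, hf]
          exact hc
        obtain ⟨w, hw⟩ := hu.exists_right_inv
        apply h
        have h3 : incl f * incl w = 1 := by rw [← map_mul, hw, map_one]
        rw [hf] at h3
        have : x = incl w := by
          rw [← one_mul (incl w), ← mul_inv_cancel₀ hx, mul_assoc, h3, mul_one]
        rw [this]
        exact incl_mem_intK w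
  · intro h h'
    have := mul_mem h h'
    rw [mul_assoc, inv_mul_cancel₀ hx, mul_one] at this
    exact hz this

end Character

/-! ### The topology of the affine Grassmannian -/

section GrTopology

variable {A : Type*} [CommRing A] [HopfAlgebra ℂ A] {r : ℕ}

theorem isClosed_grTopology_iff {ρ : Rep A r} {S : Set (Gr A)} :
    @IsClosed _ (grTopology ρ) S ↔ ∀ k d : ℕ, @IsClosed _
      (TopologicalSpace.induced (plucker ρ k d) (zariski _)) (Subtype.val ⁻¹' S : Set (piece ρ k d)) := by
  simp only [isClosed_iSup_iff, isClosed_coinduced]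

theorem isClosed_springerFibre [Algebra.FiniteType ℂ A] [IsReduced A] (hG : IsReductive A)
    {ρ : Rep A r} (hρ : ρ.IsClosedEmbedding) {m : ℕ} (ν : Rep A m) (c : Fin m → KK) :
    @IsClosed _ (grTopology ρ) (springerFibre ν c) := by
  rw [isClosed_grTopology_iff]
  intro k d
  let _ := zariski (Fin d → Fin r × Fin (2 * k))
  rw [isClosed_induced_iff]
  exact ⟨_, isClosed_plucker_springerFibre hG hρ ν c k d,
    Set.preimage_image_eq _ (plucker_injective hρ k d)⟩

theorem mem_springerFibre_iff {m : ℕ} {ν : Rep A m} {c : Fin m → KK} {g : Points A KK} :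
    (g : Gr A) ∈ springerFibre ν c ↔ ∀ i, (ν.mat g⁻¹).mulVec c i ∈ intK := by
  rw [← mem_stdLattice_zero]
  constructor
  · rintro ⟨g', hg', w, hw, rfl⟩
    rw [Matrix.mulVec_mulVec, ← ν.mat_mul]
    exact mulVec_mem_stdLattice ν (QuotientGroup.eq.mp hg'.symm) hw
  · intro h
    refine ⟨g, rfl, _, h, ?_⟩
    rw [Matrix.mulVec_mulVec, ← ν.mat_mul, mul_inv_cancel, ν.mat_one, Matrix.one_mulVec]

theorem component_subset {ρ : Rep A r} {S : Set (Gr A)} (h1 : @IsClosed _ (grTopology ρ) S)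
    (h2 : @IsClosed _ (grTopology ρ) Sᶜ) {x : Gr A} (hx : x ∈ S) : component ρ x ⊆ S := by
  let _ := grTopology ρ
  exact IsClopen.connectedComponent_subset ⟨h1, isClosed_compl_iff.mp h2⟩ hx

/-- `zᵉ u(g) ∈ 𝒪` defines a Springer fibre of the character inverse to `u`. Its negation is `z⁻¹ᐨᵉ
u(g)⁻¹ ∈ 𝒪`, which defines a Springer fibre of `u`. Both are closed, so the condition holds on the
whole component of a point where it holds. -/
theorem exists_val_character [Algebra.FiniteType ℂ A] [IsReduced A] (hG : IsReductive A)
    {ρ : Rep A r} (hρ : ρ.IsClosedEmbedding) {u : A}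
    (hmul : ∀ g h : Points A ℂ, (g * h).eval u = g.eval u * h.eval u)
    (hone : (1 : Points A ℂ).eval u = 1) (x : Gr A) :
    ∃ e : ℕ, ∀ g : Points A KK, (g : Gr A) ∈ component ρ x → zp e * g.eval u ∈ intK := by
  let μ := charRep u hmul hone
  have hinv : ∀ g h : Points A ℂ, (g * h).eval (HopfAlgebra.antipode ℂ u) =
      g.eval (HopfAlgebra.antipode ℂ u) * h.eval (HopfAlgebra.antipode ℂ u) := by
    intro g h
    rw [← Points.inv_eval, ← Points.inv_eval, ← Points.inv_eval, mul_inv_rev, hmul, mul_comm]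
  have hinv1 : (1 : Points A ℂ).eval (HopfAlgebra.antipode ℂ u) = 1 := by
    rw [← Points.inv_eval, inv_one, hone]
  let μ' := charRep _ hinv hinv1
  have hgg : ∀ g : Points A KK, g.eval u * g⁻¹.eval u = 1 := by
    intro g
    have h1 : μ.mat (g * g⁻¹) 0 0 = 1 := by rw [mul_inv_cancel, μ.mat_one, Matrix.one_apply_eq]
    rw [μ.mat_mul, Matrix.mul_apply, Fin.sum_univ_one] at h1
    exact h1
  induction x using QuotientGroup.induction_on with | _ g₀
  obtain ⟨e, he⟩ := exists_zp_mul_mem_intK (g₀.eval u)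
  have hS : ∀ g : Points A KK, (g : Gr A) ∈ springerFibre μ' (fun _ => zp e) ↔
      zp e * g.eval u ∈ intK := by
    intro g
    rw [mem_springerFibre_iff]
    have h1 : ∀ i, (μ'.mat g⁻¹).mulVec (fun _ => zp e) i = zp e * g.eval u := by
      intro i
      rw [Matrix.mulVec, dotProduct, Fin.sum_univ_one, mul_comm]
      change zp e * g⁻¹.eval (HopfAlgebra.antipode ℂ u) = _
      rw [← Points.inv_eval, inv_inv]
    simp only [h1, forall_const]
  have hS' : (springerFibre μ' fun _ => zp e)ᶜ = springerFibre μ fun _ => zp (-1 - e) := by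
    ext y
    induction y using QuotientGroup.induction_on with | _ g
    rw [Set.mem_compl_iff, hS, mem_springerFibre_iff]
    have h1 : ∀ i, (μ.mat g⁻¹).mulVec (fun _ => zp (-1 - e)) i = zp (-1) * (zp e * g.eval u)⁻¹ := by
      intro i
      rw [Matrix.mulVec, dotProduct, Fin.sum_univ_one]
      change g⁻¹.eval u * _ = _
      rw [sub_eq_add_neg, zp_add, mul_inv, ← eq_inv_of_mul_eq_one_left (zp_neg_mul_zp e),
        ← eq_inv_of_mul_eq_one_right (hgg g)]
      ring
    simp only [h1, forall_const]
    exact not_mem_intK_iff (mul_ne_zero (zp_ne_zero _) (left_ne_zero_of_mul_eq_one (hgg g)))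
  refine ⟨e, fun g hg => (hS g).mp (component_subset ?_ ?_ ((hS g₀).mpr he) hg)⟩
  · exact isClosed_springerFibre hG hρ _ _
  · rw [hS']
    exact isClosed_springerFibre hG hρ _ _

end GrTopology

/-! ### The pieces of the affine Grassmannian -/

section Pieces

variable {A : Type*} [CommRing A] [HopfAlgebra ℂ A] {r : ℕ}

/-- The larger window adds the degrees `-k - 1` and `k`. Vectors of `L` vanish in the former, while
the latter is unrestricted because `zᵏ 𝒪^r ⊆ L`; it adds `r` dimensions. -/
theorem finrank_map_window_succ {k : ℕ} {L : Submodule ℂ (Fin r → KK)} (h1 : stdLattice r k ≤ L)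
    (h2 : L ≤ stdLattice r (-k)) : Module.finrank ℂ (L.map (window r (k + 1))) =
      Module.finrank ℂ (L.map (window r k)) + r := by
  -- The degree with index `e` in the smaller window has index `e + 1` in the larger one; `lst` is
  -- the index of degree `k`.
  let sh : Fin (2 * k) → Fin (2 * (k + 1)) := fun e => ⟨e + 1, by omega⟩
  let lst : Fin (2 * (k + 1)) := ⟨2 * k + 1, by omega⟩
  let π : (Fin r × Fin (2 * (k + 1)) → ℂ) →ₗ[ℂ] (Fin r × Fin (2 * k) → ℂ) :=
    LinearMap.funLeft ℂ ℂ fun p => (p.1, sh p.2)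
  have hπ : ∀ v, π (window r (k + 1) v) = window r k v := by
    intro v
    funext p
    change coeffK (((p.2 : ℕ) + 1 : ℕ) - ((k + 1 : ℕ) : ℤ)) (v p.1) = coeffK _ _
    congr 2
    push_cast
    ring
  set V := L.map (window r (k + 1)) with hV
  have hrange : LinearMap.range (π.domRestrict V) = L.map (window r k) := by
    rw [LinearMap.range_domRestrict, hV, ← Submodule.map_comp]
    congr 1
    exact LinearMap.ext hπ
  let U : Submodule ℂ V := LinearMap.ker (π.domRestrict V)
  have hker : Module.finrank ℂ U = r := by
    let g : U →ₗ[ℂ] (Fin r → ℂ) :=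
      (LinearMap.funLeft ℂ ℂ fun i => (i, lst)) ∘ₗ V.subtype ∘ₗ Submodule.subtype _
    have hg : ∀ w i, g w i = (w : V).1 (i, lst) := fun _ _ => rfl
    have hbij : Function.Bijective g := by
      constructor
      · have hmid : ∀ v, π (window r (k + 1) v) = 0 → v ∈ L →
            ∀ i (e : Fin (2 * (k + 1))), e ≠ lst → window r (k + 1) v (i, e) = 0 := by
          intro v hw hv i e he'
          change coeffK ((e : ℤ) - (k + 1 : ℕ)) (v i) = 0
          rcases Nat.eq_zero_or_pos (e : ℕ) with he | he
          · exact h2 hv i _ (by omega)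
          · have he'' : (e : ℕ) ≠ 2 * k + 1 := fun h => he' (Fin.ext h)
            have h3 := congrFun hw (i, ⟨e - 1, by omega⟩)
            rw [hπ] at h3
            change coeffK (((e - 1 : ℕ) : ℤ) - k) (v i) = 0 at h3
            rw [← h3]
            congr 2
            omega
        rintro ⟨⟨_, v, hv, rfl⟩, hw⟩ ⟨⟨_, v', hv', rfl⟩, hw'⟩ h
        apply Subtype.ext
        apply Subtype.ext
        funext ⟨i, e⟩
        by_cases he : e = lst
        · rw [he]
          exact congrFun h i
        · exact (hmid v hw hv i e he).trans
            (hmid v' hw' hv' i e he).symm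
      · intro a
        let v : Fin r → KK := fun i => algebraMap ℂ KK (a i) * zp k
        have hvc : ∀ i j, coeffK j (v i) = if j = k then a i else 0 := by
          intro i j
          rw [coeffK_algebraMap_mul, coeffK_zp]
          simp
        have hvL : v ∈ L := h1 fun i j hj => by rw [hvc, if_neg (by omega)]
        refine ⟨⟨⟨window r (k + 1) v, v, hvL, rfl⟩, ?_⟩, ?_⟩
        · rw [LinearMap.mem_ker, LinearMap.domRestrict_apply, hπ]
          funext p
          rw [window_apply, hvc, if_neg (by omega)]
          rfl
        · funext i
          change coeffK ((lst : ℤ) - (k + 1 : ℕ)) (v i) = a i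
          rw [hvc, if_pos]
          simp only [lst]
          omega
    rw [(LinearEquiv.ofBijective g hbij).finrank_eq, Module.finrank_fin_fun]
  rw [← hrange, ← LinearMap.finrank_range_add_finrank_ker (π.domRestrict V)]
  exact congrArg _ hker

theorem mem_piece_succ {ρ : Rep A r} {k d : ℕ} {x : Gr A} (hx : x ∈ piece ρ k d) :
    x ∈ piece ρ (k + 1) (d + r) := by
  refine ⟨le_trans (stdLattice_anti (by push_cast; omega)) hx.1,
    le_trans hx.2.1 (stdLattice_anti (by push_cast; omega)), ?_⟩
  rw [finrank_map_window_succ hx.1 hx.2.1, hx.2.2]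

theorem mem_piece_add {ρ : Rep A r} {k d : ℕ} {x : Gr A} (hx : x ∈ piece ρ k d) (n : ℕ) :
    x ∈ piece ρ (k + n) (d + n * r) := by
  induction n with
  | zero => simpa using hx
  | succ n ih =>
    have := mem_piece_succ ih
    rwa [show d + n * r + r = d + (n + 1) * r by ring] at this

/-- The number `d - k r` is the dimension of the lattice relative to `𝒪^r`, which does not depend on
the window. -/
theorem piece_index_eq {ρ : Rep A r} {k d k' d' : ℕ} {x : Gr A} (hx : x ∈ piece ρ k d)
    (hx' : x ∈ piece ρ k' d') : (d : ℤ) - k * r = d' - k' * r := by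
  have h1 := mem_piece_add hx k'
  have h2 := mem_piece_add hx' k
  rw [add_comm] at h2
  have h3 : d + k' * r = d' + k * r := h1.2.2.symm.trans h2.2.2
  have h4 : (d : ℤ) + k' * r = d' + k * r := by exact_mod_cast h3
  linarith

/-- The points with a given relative dimension contain each piece or are disjoint from it, so they
form an open and closed set. -/
theorem piece_index_of_mem_component {ρ : Rep A r} {k d k' d' : ℕ} {x y : Gr A}
    (hx : x ∈ piece ρ k d) (hy : y ∈ component ρ x) (hy' : y ∈ piece ρ k' d') :
    (d : ℤ) - k * r = d' - k' * r := by
  let S : Set (Gr A) := {y | ∃ k' d' : ℕ, y ∈ piece ρ k' d' ∧ (d : ℤ) - k * r = d' - k' * r}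
  have hS : ∀ k' d' : ℕ, (Subtype.val ⁻¹' S : Set (piece ρ k' d')) = Set.univ ∨
      (Subtype.val ⁻¹' S : Set (piece ρ k' d')) = ∅ := by
    intro k' d'
    by_cases h : (d : ℤ) - k * r = d' - k' * r
    · left
      rw [Set.eq_univ_iff_forall]
      exact fun y => ⟨k', d', y.2, h⟩
    · right
      rw [Set.eq_empty_iff_forall_notMem]
      rintro y ⟨k'', d'', hy, h'⟩
      exact h (h'.trans (piece_index_eq hy y.2))
  have h1 : @IsClosed _ (grTopology ρ) S := by
    rw [isClosed_grTopology_iff]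
    intro k' d'
    let _ := TopologicalSpace.induced (plucker ρ k' d') (zariski _)
    rcases hS k' d' with h | h
    · rw [h]
      exact isClosed_univ
    · rw [h]
      exact isClosed_empty
  have h2 : @IsClosed _ (grTopology ρ) Sᶜ := by
    rw [isClosed_grTopology_iff]
    intro k' d'
    let _ := TopologicalSpace.induced (plucker ρ k' d') (zariski _)
    rw [Set.preimage_compl]
    rcases hS k' d' with h | h
    · rw [h, Set.compl_univ]
      exact isClosed_empty
    · rw [h, Set.compl_empty]
      exact isClosed_univ
  obtain ⟨k'', d'', hy'', h⟩ := component_subset h1 h2 (x := x) ⟨k, d, hx, rfl⟩ hy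
  exact h.trans (piece_index_eq hy'' hy')

theorem latticeOf_bounds {ρ : Rep A r} {g : Points A KK} {k : ℕ}
    (h1 : ∀ i j, zp k * ρ.mat g i j ∈ intK) (h2 : ∀ i j, zp k * ρ.mat g⁻¹ i j ∈ intK) :
    stdLattice r k ≤ latticeOf ρ g ∧ latticeOf ρ g ≤ stdLattice r (-k) := by
  constructor
  · intro v hv
    refine ⟨(ρ.mat g⁻¹).mulVec v, ?_, ?_⟩
    · change _ ∈ stdLattice r 0
      rw [mem_stdLattice_zero]
      rw [mem_stdLattice] at hv
      intro i
      rw [Matrix.mulVec, dotProduct]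
      refine sum_mem fun j _ => ?_
      have : ρ.mat g⁻¹ i j * v j = (zp k * ρ.mat g⁻¹ i j) * (zp (-k) * v j) := by
        calc ρ.mat g⁻¹ i j * v j = (zp k * zp (-k)) * (ρ.mat g⁻¹ i j * v j) := by
              rw [zp_mul_zp_neg, one_mul]
          _ = _ := by ring
      rw [this]
      exact mul_mem (h2 i j) (hv j)
    · change (ρ.mat g).mulVec ((ρ.mat g⁻¹).mulVec v) = v
      rw [Matrix.mulVec_mulVec, ← ρ.mat_mul, mul_inv_cancel, ρ.mat_one, Matrix.one_mulVec]
  · rintro _ ⟨w, hw, rfl⟩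
    rw [mem_stdLattice]
    intro i
    change zp (- -(k : ℤ)) * (ρ.mat g).mulVec w i ∈ intK
    rw [neg_neg, Matrix.mulVec, dotProduct, Finset.mul_sum]
    refine sum_mem fun j _ => ?_
    rw [← mul_assoc]
    exact mul_mem (h1 i j) (mem_stdLattice_zero.mp hw j)

theorem exists_mem_piece (ρ : Rep A r) (x : Gr A) : ∃ k d : ℕ, x ∈ piece ρ k d := by
  induction x using QuotientGroup.induction_on with | _ g
  choose K hK using fun p : Fin r × Fin r => exists_zp_mul_mem_intK (ρ.mat g p.1 p.2)
  choose K' hK' using fun p : Fin r × Fin r => exists_zp_mul_mem_intK (ρ.mat g⁻¹ p.1 p.2)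
  obtain ⟨h1, h2⟩ := latticeOf_bounds (ρ := ρ) (g := g) (k := ∑ p, K p + ∑ p, K' p)
    (fun i j => zp_mul_mem_intK_of_le (by
      have := Finset.single_le_sum (f := K) (fun _ _ => Nat.zero_le _) (Finset.mem_univ (i, j))
      omega) (hK (i, j)))
    (fun i j => zp_mul_mem_intK_of_le (by
      have := Finset.single_le_sum (f := K') (fun _ _ => Nat.zero_le _) (Finset.mem_univ (i, j))
      omega) (hK' (i, j)))
  exact ⟨_, _, h1, h2, rfl⟩

end Pieces

/-! ### Boundedness in a component and the main theorem -/

section Main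

variable {A : Type*} [CommRing A] [HopfAlgebra ℂ A] {r m : ℕ}

theorem evalK_pow (χ : KK ⊗[ℂ] A) (n : ℕ) (g : Points A KK) :
    evalK (χ ^ n) g = evalK χ g ^ n := map_pow _ _ _

/-- The power `χⁿ` is multiplicative because it is the factor by which a function with `f c ≠ 0`
transforms; multiplicative functions are defined over `ℂ` by `exists_eq_one_tmul`. -/
theorem exists_character_power [Algebra.FiniteType ℂ A] [IsReduced A] {ν : Rep A m} {χ : KK ⊗[ℂ] A} {n : ℕ}
    {f : MvPolynomial (Fin m) KK} (hf : IsSemiInvariant ν χ n f) {c : Fin m → KK}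
    (hfc : MvPolynomial.aeval c f ≠ 0) : ∃ u : A, (∀ g : Points A KK, evalK χ g ^ n = g.eval u) ∧
      (∀ g h : Points A ℂ, (g * h).eval u = g.eval u * h.eval u) ∧
      (1 : Points A ℂ).eval u = 1 := by
  have h1 : ∀ g h : Points A KK, evalK (χ ^ n) (g * h) = evalK (χ ^ n) g * evalK (χ ^ n) h := by
    intro g h
    apply (algebraMap KK KKbar).injective
    simp only [evalK_pow, map_mul, map_pow, ← evalBar_map]
    exact hf.evalBar_mul hfc _ _
  have h2 : evalK (χ ^ n) (1 : Points A KK) = 1 := by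
    have h3 := h1 1 1
    rw [mul_one] at h3
    -- The value at `1` equals its square, and it is nonzero since otherwise `f c = 0`.
    refine (mul_eq_left₀ fun h0 => aeval_toBar_ne_zero hfc ?_).mp h3.symm
    have h4 := hf (Points.map barHom 1) (toBar c)
    rw [evalBar_map, ← map_pow, ← evalK_pow, h0, map_zero, zero_mul, map_one, ν.mat_one,
      Matrix.one_mulVec] at h4
    exact h4
  obtain ⟨u, hu⟩ := exists_eq_one_tmul h1 h2
  have h3 : ∀ g : Points A KK, evalK (χ ^ n) g = g.eval u := by
    intro g
    rw [hu, evalK, Algebra.TensorProduct.lift_tmul, map_one, one_mul]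
  have hinj : Function.Injective (algebraMap ℂ KK) := (algebraMap ℂ KK).injective
  have h4 : ∀ g : Points A ℂ, (Points.map (Algebra.ofId ℂ KK) g).eval u =
      algebraMap ℂ KK (g.eval u) := fun _ => rfl
  refine ⟨u, fun g => by rw [← evalK_pow, h3], fun g h => hinj ?_, hinj ?_⟩
  · rw [map_mul, ← h4, ← h4, ← h4, map_mul, ← h3, ← h3, ← h3, h1]
  · rw [map_one, ← h4, map_one, ← h3, h2]

/-- The bounds on the entries of `g` and of `g⁻¹` give `k`; the constancy of `d - k r` on the
component gives `d`. -/
theorem springerFibre_inter_component_subset_piece [Algebra.FiniteType ℂ A] [IsDomain A]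
    (hG : IsReductive A) {ρ : Rep A r} (hρ : ρ.IsClosedEmbedding) {ν : Rep A m} {c : Fin m → KK}
    {χ : KK ⊗[ℂ] A} (hs : IsStable ν χ c) (x : Gr A) :
    ∃ k d : ℕ, springerFibre ν c ∩ component ρ x ⊆ piece ρ k d := by
  obtain ⟨⟨n, f, hf, hfc, hcl⟩, hst⟩ := hs
  obtain ⟨u, hu, hmul, hone⟩ := exists_character_power hf hfc
  obtain ⟨e, he⟩ := exists_val_character hG hρ hmul hone x
  choose M hM using fun p : Fin r × Fin r =>
    exists_point_bound hf hfc hcl hst e (ρ.coeff p.1 p.2)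
  choose M' hM' using fun p : Fin r × Fin r =>
    exists_point_bound hf hfc hcl hst e (HopfAlgebra.antipode ℂ (ρ.coeff p.1 p.2))
  set k := ∑ p, M p + ∑ p, M' p with hk
  have hbd : ∀ g : Points A KK, (g : Gr A) ∈ springerFibre ν c → (g : Gr A) ∈ component ρ x →
      stdLattice r k ≤ latticeOf ρ g ∧ latticeOf ρ g ≤ stdLattice r (-k) := by
    intro g hg hgx
    have h1 := mem_springerFibre_iff.mp hg
    have h2 := he g hgx
    rw [← hu] at h2
    refine latticeOf_bounds (fun i j => ?_) fun i j => ?_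
    · refine zp_mul_mem_intK_of_le ?_ (hM (i, j) g h1 h2)
      have := Finset.single_le_sum (f := M) (fun _ _ => Nat.zero_le _) (Finset.mem_univ (i, j))
      omega
    · refine zp_mul_mem_intK_of_le ?_ (hM' (i, j) g h1 h2)
      have := Finset.single_le_sum (f := M') (fun _ _ => Nat.zero_le _) (Finset.mem_univ (i, j))
      omega
  have hpiece : ∀ y ∈ springerFibre ν c ∩ component ρ x, ∃ d, y ∈ piece ρ k d := by
    intro y hy
    induction y using QuotientGroup.induction_on with | _ g
    exact ⟨_, (hbd g hy.1 hy.2).1, (hbd g hy.1 hy.2).2, rfl⟩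
  rcases (springerFibre ν c ∩ component ρ x).eq_empty_or_nonempty with h0 | ⟨y₀, hy₀⟩
  · exact ⟨0, 0, h0 ▸ Set.empty_subset _⟩
  obtain ⟨d, hd⟩ := hpiece y₀ hy₀
  refine ⟨k, d, fun y hy => ?_⟩
  obtain ⟨d', hd'⟩ := hpiece y hy
  obtain ⟨k₀, d₀, hx⟩ := exists_mem_piece ρ x
  have h1 := piece_index_of_mem_component hx hy₀.2 hd
  have h2 := piece_index_of_mem_component hx hy.2 hd'
  have h3 : d' = d := by omega
  rwa [h3] at hd'

theorem isProjectiveVariety_springerFibre_inter_component [Algebra.FiniteType ℂ A] [IsDomain A]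
    (hG : IsReductive A) {ρ : Rep A r} (hρ : ρ.IsClosedEmbedding) {ν : Rep A m} {c : Fin m → KK}
    {χ : KK ⊗[ℂ] A} (hs : IsStable ν χ c) (x : Gr A) :
    IsProjectiveVariety ρ (springerFibre ν c ∩ component ρ x) := by
  obtain ⟨k, d, hkd⟩ := springerFibre_inter_component_subset_piece hG hρ hs x
  refine ⟨k, d, hkd, (plucker_injective hρ k d).injOn, ?_⟩
  have h1 : @IsClosed _ (grTopology ρ) (component ρ x) := by
    let _ := grTopology ρ
    exact isClosed_connectedComponent
  let _ := zariski (Fin d → Fin r × Fin (2 * k))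
  -- The component is cut out in the piece by a closed subset `Z` of projective space, so the image
  -- is `Z` intersected with the closed image of the Springer fibre.
  obtain ⟨Z, hZ, hZ'⟩ := isClosed_induced_iff.mp (isClosed_grTopology_iff.mp h1 k d)
  rw [Set.preimage_inter, ← hZ', Set.image_inter_preimage]
  exact (isClosed_plucker_springerFibre hG hρ ν c k d).inter hZ

end Main

end BFN

end

/-- The components of Gr are described by their points `x`, so letting `x` vary covers every `σ ∈
π₁(G)`. -/
theorem theorem3p5 (A : Type*) [CommRing A] [HopfAlgebra ℂ A] [Algebra.FiniteType ℂ A]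
    [IsDomain A] (hG : BFN.IsReductive A)
    {r : ℕ} (ρ : BFN.Rep A r) (hρ : ρ.IsClosedEmbedding)
    {m : ℕ} (ν : BFN.Rep A m) (c : Fin m → BFN.KK)
    (χ : BFN.KK ⊗[ℂ] A) (hχ : IsGroupLikeElem BFN.KK χ)
    (hstable : BFN.IsStable ν χ c) (hfree : BFN.ActsFreelyOn ν c) (x : BFN.Gr A) :
    BFN.IsProjectiveVariety ρ (BFN.springerFibre ν c ∩ BFN.component ρ x) :=
  BFN.isProjectiveVariety_springerFibre_inter_component hG hρ hstable x
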